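/- A modulus of continuity is an increasing (in the wide sense) continuous function $\omega:[0,\infty)\to[0,\infty)$ with $\omega(0)=0$ and $\omega(t)>0$ for $t>0$. It is called regular if $\int_0^1\frac{\omega(t)}{t}\,dt<\infty$ and there are $\varepsilon\in(0,1)$ and $C>0$ such that $\frac{\omega(t)}{t^{\varepsilon}}\le C\,\frac{\omega(s)}{s^{\varepsilon}}$ for all $t>s>0$. A bounded domain $\Omega\subset\mathbb C$ has $\mathcal C^{1,\omega}$-smooth boundary if its boundary is $\mathcal C^1$, that is, near every boundary point, in suitable orthonormal coordinates, $\Omega$ is the subgraph of a $\mathcal C^1$ function, and if its outer unit normal $\nu$ satisfies $|\nu(z)-\nu(w)|\le K\omega(|z-w|)$ for all $z,w\in\partial\Omega$, with a constant $K$. Let $dA$ denote the area measure on $\mathbb C$. The Campanato space $\mathrm{BMO}_\omega(\Omega)$ consists of those $f\in L^\infty(\Omega)$ for which \[ |f|_{\omega,\Omega}=\sup_{Q}\ \frac1{\omega(\ell)}\,\frac1{|Q|}\int_{Q\cap\Omega}\bigl|f(z)-f_{Q|\Omega}\bigr|\,dA(z)<\infty ,\qquad f_{Q|\Omega}=\frac1{|Q\cap\Omega|}\int_{Q\cap\Omega}f\,dA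 , \] where the supremum is over all squares $Q\subset\mathbb C$ with edges parallel to the coordinate axes, $\ell>0$ is the side length of $Q$, and the term is $0$ if $Q\cap\Omega=\varnothing$. It is normed by $\|f\|=\|f\|_{L^\infty(\Omega)}+|f|_{\omega,\Omega}$. The restricted Beurling transform is \[ B_\Omega f(z)=-\frac1\pi\lim_{\delta\to0+}\int_{|w|>\delta}\frac{(\chi_\Omega f)(z-w)}{w^2}\,dA(w),\qquad z\in\Omega . \] Theorem. Let $\omega$ be a regular modulus of continuity and let $\Omega\subset\mathbb C$ be a bounded domain with $\mathcal C^{1,\omega}$-smooth boundary. Then for every $f\in\mathrm{BMO}_\omega(\Omega)$ the limit defining $B_\Omega f(z)$ exists at every $z\in\Omega$, and $B_\Omega$ is a bounded linear operator on $\mathrm{BMO}_\omega(\Omega)$: $B_\Omega f$ depends linearly on $f$, and there is a constant $C=C(\omega,\Omega)$ such that $B_\Omega f\in\mathrm{BMO}_\omega(\Omega)$ and $\|B_\Omega f\|\le C\|f\|$ for all $f\in\mathrm{BMO}_\omega(\Omega)$. -/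

import Mathlib

open MeasureTheory Filter Topology Set
open scoped ENNReal NNReal

noncomputable section

namespace BeurlingCampanato

/-- Modulus of continuity: an increasing continuous function on `[0, ∞)` with `ω 0 = 0`
(positive off the origin, as the quotients by `ω` presuppose).
Only the values on `[0, ∞)` matter. -/
structure IsModulus (ω : ℝ → ℝ) : Prop where
  map_zero : ω 0 = 0
  pos : ∀ t, 0 < t → 0 < ω t
  monotoneOn : MonotoneOn ω (Ici 0)
  continuousOn : ContinuousOn ω (Ici 0)

/-- The integral of `ω t / t` converges at the origin. -/
def IsDiniSmooth (ω : ℝ → ℝ) : Prop :=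
  IntegrableOn (fun t : ℝ => ω t / t) (Ioc 0 1)

/-- `g` is almost decreasing on `(0, ∞)`. -/
def IsAlmostDecreasing (g : ℝ → ℝ) : Prop :=
  ∃ C : ℝ, 0 < C ∧ ∀ s t : ℝ, 0 < s → s < t → g t ≤ C * g s

/-- Regular modulus of continuity. -/
structure IsRegularModulus (ω : ℝ → ℝ) : Prop extends IsModulus ω where
  dini : IsDiniSmooth ω
  almostDecreasing : ∃ ε : ℝ, 0 < ε ∧ ε < 1 ∧ IsAlmostDecreasing (fun t : ℝ => ω t / t ^ ε)

/-- The Lipschitz class `Λ^ω` on a set `S ⊆ ℂ`. -/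
def IsLipschitzClass (ω : ℝ → ℝ) (S : Set ℂ) (g : ℂ → ℂ) : Prop :=
  ∃ K : ℝ, ∀ z ∈ S, ∀ w ∈ S, ‖g z - g w‖ ≤ K * ω ‖z - w‖

/-- In the orthonormal coordinates `(x, y) ↦ ζ + c (x + i y)`, where `|c| = 1`, the part of `Ω`
in the open square `|x| < r`, `|y| < r` is the subgraph of the `C¹` function `φ`. -/
structure IsC1Chart (Ω : Set ℂ) (ζ c : ℂ) (r : ℝ) (φ : ℝ → ℝ) : Prop where
  norm_eq : ‖c‖ = 1
  r_pos : 0 < r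
  contDiffOn : ContDiffOn ℝ 1 φ (Ioo (-r) r)
  mem_iff : ∀ x ∈ Ioo (-r) r, ∀ y ∈ Ioo (-r) r,
    (ζ + c * ((x : ℂ) + (y : ℂ) * Complex.I) ∈ Ω ↔ y < φ x)

/-- `Ω` has `C¹` boundary and `ν`, restricted to the boundary, is its outer unit normal vector:
at the point of the graph above `x`, the outer unit normal is `(-φ'(x), 1)`, normalized,
in the coordinates of the chart. -/
def IsC1BoundaryWithNormal (Ω : Set ℂ) (ν : ℂ → ℂ) : Prop :=
  ∀ ζ ∈ frontier Ω, ∃ (c : ℂ) (r : ℝ) (φ : ℝ → ℝ), IsC1Chart Ω ζ c r φ ∧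
    ∀ x ∈ Ioo (-r) r, φ x ∈ Ioo (-r) r →
      ν (ζ + c * ((x : ℂ) + (φ x : ℂ) * Complex.I)) =
        c * ((-((deriv φ x : ℝ) : ℂ) + Complex.I) / ((‖-((deriv φ x : ℝ) : ℂ) + Complex.I‖ : ℝ) : ℂ))

/-- `C^{1,ω}`-smooth boundary: the boundary is `C¹` and its unit normal vector belongs to `Λ^ω`
as a function on the boundary. -/
def HasC1OmegaBoundary (ω : ℝ → ℝ) (Ω : Set ℂ) : Prop :=
  ∃ ν : ℂ → ℂ, IsC1BoundaryWithNormal Ω ν ∧ IsLipschitzClass ω (frontier Ω) ν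

/-- The closed square with lower left vertex `a`, side length `ℓ` and edges parallel to the
coordinate axes. -/
def square (a : ℂ) (ℓ : ℝ) : Set ℂ :=
  Icc a.re (a.re + ℓ) ×ℂ Icc a.im (a.im + ℓ)

/-- The Campanato seminorm: the supremum over all squares `Q`, of side length `ℓ > 0`, of
`1 / ω ℓ * 1 / |Q| * ∫_{Q ∩ Ω} |f - f_{Q|Ω}| dA`, where `f_{Q|Ω}` is the mean of `f`
over `Q ∩ Ω`. -/
def campanatoSeminorm (ω : ℝ → ℝ) (Ω : Set ℂ) (f : ℂ → ℂ) : ℝ≥0∞ :=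
  ⨆ (a : ℂ) (ℓ : ℝ) (_ : 0 < ℓ),
    (ENNReal.ofReal (ω ℓ))⁻¹ * (ENNReal.ofReal (ℓ ^ 2))⁻¹ *
      ∫⁻ z in square a ℓ ∩ Ω, ‖f z - ⨍ w in square a ℓ ∩ Ω, f w‖ₑ

/-- `f` (restricted to `Ω`) belongs to `BMO_ω(Ω)`. -/
def MemCampanato (ω : ℝ → ℝ) (Ω : Set ℂ) (f : ℂ → ℂ) : Prop :=
  MemLp f ∞ (volume.restrict Ω) ∧ campanatoSeminorm ω Ω f < ∞

/-- The norm of `BMO_ω(Ω) ⊆ L^∞(Ω)`: the sum of the `L^∞(Ω)` norm and the Campanato seminorm. -/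
def campanatoNorm (ω : ℝ → ℝ) (Ω : Set ℂ) (f : ℂ → ℂ) : ℝ≥0∞ :=
  eLpNorm f ∞ (volume.restrict Ω) + campanatoSeminorm ω Ω f

/-- The truncated Beurling integral `-(1/π) ∫_{|w| > δ} f(z - w) / w² dA(w)`. -/
def truncatedBeurling (f : ℂ → ℂ) (δ : ℝ) (z : ℂ) : ℂ :=
  -(1 / (Real.pi : ℂ)) * ∫ w in {w : ℂ | δ < ‖w‖}, f (z - w) * (1 / w ^ 2)

/-- The Beurling transform: the limit, as `δ → 0+`, of the truncated integrals
(meaningful where the limit exists). -/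
def beurling (f : ℂ → ℂ) (z : ℂ) : ℂ :=
  limUnder (𝓝[>] (0 : ℝ)) (fun δ : ℝ => truncatedBeurling f δ z)

/-- The restricted Beurling transform `B(χ_Ω f)`, to be considered on `Ω` only. -/
def restrictedBeurling (Ω : Set ℂ) (f : ℂ → ℂ) (z : ℂ) : ℂ :=
  beurling (Ω.indicator f) z

end BeurlingCampanato

end

/-!
The Beurling transform of a Campanato function `f` on `Ω` splits, near a disc of radius `ρ` centred
at `z ∈ Ω`, into a multiple of the transform of the characteristic function of `Ω`, a local part and
a far part. All three have mean oscillation `O(ω(ρ))` on the disc.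

* The local part is bounded in `L²` by the `L²` bound for the truncated transforms
  (`exists_lintegral_sq_truncatedBeurling_le`), after the `L¹` oscillation of `f` has been improved
  to an `L²` oscillation by a John–Nirenberg argument (`exists_sqOscBound`). The `L²` bound itself
  needs no Fourier transform: the truncated kernel differs by an integrable kernel from `-∂u` with
  `u(w) = conj w / (1 + |w|²)`, and convolution with `∂u` has the same `L²` norm as convolution with
  the integrable function `∂̄u`, by integration by parts.
* The far part is a sum over dyadic annuli of oscillations of `f`, each weighted by the decay of the
  difference of the kernels. It converges because `ω(t) / t^ε` is almost decreasing for some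
  `ε < 1`.
* The transform `F` of the characteristic function is where the smoothness of the boundary enters.
  The kernel has mean zero on annuli, so a difference of values of `F` is an integral of a
  difference of kernels over the complement of `Ω` (`beurling_sub_eq`). The same integral over the
  complement of a tangent half-plane vanishes (`setIntegral_halfPlane_kernelDiff`), and the two
  sets differ by a region of thickness `|x| ω(|x|)` at distance `|x|` from the point of tangency.
  So `F` varies by `O(ω(t))` at the scale `t` of the distance to the boundary
  (`exists_beurling_sub_le`). Chaining these estimates towards the boundary bounds the mean
  oscillation of `F` (`exists_oscillation_beurling_indicator_one`).

Principal values exist, and the transform is bounded, because the Dini condition makes the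
oscillations of `f` over dyadic discs summable (`OscData.tendsto_beurling`,
`beurling_bounded_of_oscillation`). Every disc centred in `Ω` meets `Ω` in a set of comparable area
(`exists_hasDensity`), which allows the passage between means over discs of different sizes.
-/

namespace BeurlingCampanato

/-! ### Moduli of continuity -/

theorem IsModulus.nonneg {ω : ℝ → ℝ} (hω : IsModulus ω) {t : ℝ} (ht : 0 ≤ t) : 0 ≤ ω t := by
  rcases ht.eq_or_lt with h | h
  · rw [← h, hω.map_zero]
  · exact (hω.pos t h).le

theorem IsModulus.mono {ω : ℝ → ℝ} (hω : IsModulus ω) {s t : ℝ} (hs : 0 ≤ s) (hst : s ≤ t) :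
    ω s ≤ ω t :=
  hω.monotoneOn hs (hs.trans hst) hst

theorem IsModulus.exists_le {ω : ℝ → ℝ} (hω : IsModulus ω) {η : ℝ} (hη : 0 < η) :
    ∃ t₁ : ℝ, 0 < t₁ ∧ ∀ t, 0 ≤ t → t ≤ t₁ → ω t ≤ η := by
  have h := hω.continuousOn 0 self_mem_Ici
  rw [ContinuousWithinAt, hω.map_zero] at h
  have h2 : ∀ᶠ t in 𝓝[Ici 0] (0 : ℝ), ω t < η := h.eventually_lt_const hη
  rw [Metric.nhdsWithin_basis_ball.eventually_iff] at h2
  obtain ⟨r, hr, h2⟩ := h2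
  refine ⟨r / 2, by positivity, fun t ht0 ht => (h2 ⟨?_, ht0⟩).le⟩
  rw [Metric.mem_ball, Real.dist_eq, sub_zero, abs_of_nonneg ht0]
  linarith

/-- The almost decrease of `ω t / t ^ ε` in multiplicative form. -/
theorem IsRegularModulus.exists_dilation {ω : ℝ → ℝ} (hω : IsRegularModulus ω) :
    ∃ ε C : ℝ, 0 < ε ∧ ε < 1 ∧ 1 ≤ C ∧
      ∀ t lam : ℝ, 0 < t → 1 ≤ lam → ω (lam * t) ≤ C * lam ^ ε * ω t := by
  obtain ⟨ε, hε0, hε1, C, hC, h⟩ := hω.almostDecreasing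
  refine ⟨ε, max C 1, hε0, hε1, le_max_right _ _, fun t lam ht hlam => ?_⟩
  have hpos := hω.pos t ht
  rcases hlam.eq_or_lt with h1 | h1
  · rw [← h1, one_mul, Real.one_rpow, mul_one]
    nlinarith [le_max_right C 1]
  · have h2 := h t (lam * t) ht (by nlinarith)
    simp only at h2
    have hl0 : 0 < lam := by linarith
    rw [Real.mul_rpow hl0.le ht.le] at h2
    have ht' : 0 < t ^ ε := Real.rpow_pos_of_pos ht ε
    have hl' : 0 < lam ^ ε := Real.rpow_pos_of_pos hl0 ε
    rw [div_le_iff₀ (by positivity)] at h2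
    have h3 : C * (ω t / t ^ ε) * (lam ^ ε * t ^ ε) = C * lam ^ ε * ω t := by
      field_simp
    rw [h3] at h2
    refine h2.trans ?_
    gcongr
    exact le_max_left _ _

theorem IsRegularModulus.exists_dilation_const {ω : ℝ → ℝ} (hω : IsRegularModulus ω) {lam : ℝ}
    (hlam : 0 ≤ lam) : ∃ C : ℝ, 1 ≤ C ∧ ∀ t : ℝ, 0 < t → ω (lam * t) ≤ C * ω t := by
  obtain ⟨ε, C, hε0, hε1, hC, h⟩ := hω.exists_dilation
  refine ⟨C * (max lam 1) ^ ε, ?_, fun t ht => ?_⟩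
  · have : (1 : ℝ) ≤ (max lam 1) ^ ε := Real.one_le_rpow (le_max_right _ _) hε0.le
    nlinarith
  · refine le_trans (hω.mono (by positivity) ?_) (h t (max lam 1) ht (le_max_right _ _))
    gcongr
    exact le_max_left _ _

/-- The quotient `ω t / t` is almost decreasing. -/
theorem IsRegularModulus.exists_div_le {ω : ℝ → ℝ} (hω : IsRegularModulus ω) :
    ∃ C : ℝ, 1 ≤ C ∧ ∀ t s : ℝ, 0 < t → t ≤ s → t * ω s ≤ C * (s * ω t) := by
  obtain ⟨ε, C, hε0, hε1, hC, h⟩ := hω.exists_dilation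
  refine ⟨C, hC, fun t s ht hts => ?_⟩
  have h1 : 1 ≤ s / t := by rwa [one_le_div ht]
  have h2 := h t (s / t) ht h1
  rw [div_mul_cancel₀ _ ht.ne'] at h2
  have h3 : (s / t) ^ ε ≤ s / t := by
    simpa using Real.rpow_le_rpow_of_exponent_le h1 hε1.le
  have h4 : ω s ≤ C * (s / t) * ω t := by
    refine h2.trans ?_
    have := hω.pos t ht
    gcongr
  calc t * ω s ≤ t * (C * (s / t) * ω t) := by gcongr
    _ = C * (s * ω t) := by field_simp

theorem IsRegularModulus.exists_mul_le {ω : ℝ → ℝ} (hω : IsRegularModulus ω) {D : ℝ}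
    (hD : 0 < D) : ∃ C : ℝ, 0 < C ∧ ∀ t : ℝ, 0 < t → t ≤ D → t ≤ C * ω t := by
  obtain ⟨C, hC, h⟩ := hω.exists_div_le
  have hp := hω.pos D hD
  refine ⟨C * D / ω D, by positivity, fun t ht htD => ?_⟩
  have := h t D ht htD
  rw [div_mul_eq_mul_div, le_div_iff₀ hp]
  linarith

theorem IsRegularModulus.summable_dyadic {ω : ℝ → ℝ} (hω : IsRegularModulus ω) {ρ : ℝ}
    (hρ : 0 < ρ) : Summable (fun k : ℕ => ω ((1 / 2) ^ k * ρ)) := by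
  have key : Summable (fun k : ℕ => ω ((1 / 2) ^ (k + 1))) := by
    set a : ℕ → ℝ := fun k => (1 / 2 : ℝ) ^ k with ha
    have hanti : Antitone a := fun m n hmn =>
      pow_le_pow_of_le_one (by norm_num) (by norm_num) hmn
    have hsub : ∀ k, Ioc (a (k + 1)) (a k) ⊆ Ioc 0 1 := fun k x hx =>
      ⟨lt_trans (by positivity) hx.1, hx.2.trans (pow_le_one₀ (by norm_num) (by norm_num))⟩
    have hsum := (hasSum_integral_iUnion (f := fun t => ω t / t) (μ := volume)
      (fun k => measurableSet_Ioc (a := a (k + 1)) (b := a k))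
      hanti.pairwise_disjoint_on_Ioc_succ
      (hω.dini.mono_set (iUnion_subset hsub))).summable
    refine Summable.of_nonneg_of_le (fun k => hω.nonneg (by positivity)) (fun k => ?_)
      (hsum.mul_left 2)
    have hlen : a k - a (k + 1) = a k / 2 := by simp only [ha, pow_succ]; ring
    have hak : 0 < a k := by positivity
    have h1 : ∫ t in Ioc (a (k + 1)) (a k), ω (a (k + 1)) / a k ≤
        ∫ t in Ioc (a (k + 1)) (a k), ω t / t := by
      refine setIntegral_mono_on (by simp) (hω.dini.mono_set (hsub k)) measurableSet_Ioc
        fun t ht => ?_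
      have ht0 : 0 < t := (hsub k ht).1
      have : ω (a (k + 1)) ≤ ω t := hω.mono (by positivity) ht.1.le
      have h0 : 0 ≤ ω t := hω.nonneg ht0.le
      gcongr
      exact ht.2
    rw [setIntegral_const, measureReal_def, Real.volume_Ioc, ENNReal.toReal_ofReal
      (by rw [hlen]; positivity), hlen, smul_eq_mul] at h1
    have : a k / 2 * (ω (a (k + 1)) / a k) = ω (a (k + 1)) / 2 := by field_simp
    rw [this] at h1
    change ω (a (k + 1)) ≤ _
    linarith
  obtain ⟨C, hC, h⟩ := hω.exists_dilation_const hρ.le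
  refine (summable_nat_add_iff 1).1 (Summable.of_nonneg_of_le
    (fun k => hω.nonneg (by positivity)) (fun k => ?_) (key.mul_left C))
  rw [mul_comm]
  exact h _ (by positivity)

/-- A function on the positive axis whose variation over dyadic intervals is controlled by a
Dini modulus has a limit at the origin. -/
theorem IsRegularModulus.exists_tendsto_of_dyadic {ω : ℝ → ℝ} (hω : IsRegularModulus ω)
    {ρ A : ℝ} (hρ : 0 < ρ) {G : ℝ → ℂ}
    (hG : ∀ s s' : ℝ, 0 < s' → s' ≤ s → s ≤ 2 * s' → s ≤ ρ → ‖G s' - G s‖ ≤ A * ω s) :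
    ∃ L : ℂ, Tendsto G (𝓝[>] 0) (𝓝 L) := by
  have hs := hω.summable_dyadic hρ
  have hcau : CauchySeq (fun k : ℕ => G ((1 / 2) ^ k * ρ)) := by
    refine cauchySeq_of_summable_dist (Summable.of_nonneg_of_le (fun _ => dist_nonneg)
      (fun k => ?_) (hs.mul_left A))
    rw [dist_comm, dist_eq_norm]
    have hp : 0 < (1 / 2 : ℝ) ^ k * ρ := by positivity
    have h1 : (1 / 2 : ℝ) ^ (k + 1) * ρ = (1 / 2) ^ k * ρ / 2 := by rw [pow_succ]; ring
    refine hG _ _ (by positivity) (by rw [h1]; linarith) (by rw [h1]; linarith) ?_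
    have : (1 / 2 : ℝ) ^ k ≤ 1 := pow_le_one₀ (by norm_num) (by norm_num)
    nlinarith
  obtain ⟨L, hL⟩ := cauchySeq_tendsto_of_complete hcau
  refine ⟨L, ?_⟩
  rw [Metric.tendsto_nhdsWithin_nhds]
  intro e he
  have h0 : Tendsto (fun k : ℕ => A * ω ((1 / 2) ^ k * ρ)) atTop (𝓝 0) := by
    simpa using hs.tendsto_atTop_zero.const_mul A
  obtain ⟨N, hN⟩ := eventually_atTop.1
    ((h0.eventually_lt_const (half_pos he)).and (Metric.tendsto_nhds.1 hL _ (half_pos he)))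
  refine ⟨(1 / 2) ^ N * ρ, by positivity, fun {t} ht0 htN => ?_⟩
  rw [mem_Ioi] at ht0
  rw [Real.dist_eq, sub_zero, abs_of_pos ht0] at htN
  have htρ : t ≤ ρ := by
    have : (1 / 2 : ℝ) ^ N ≤ 1 := pow_le_one₀ (by norm_num) (by norm_num)
    nlinarith
  obtain ⟨k, hk1, hk2⟩ := exists_nat_pow_near_of_lt_one (x := t / ρ) (y := 1 / 2)
    (by positivity) (by rwa [div_le_one hρ]) (by norm_num) (by norm_num)
  rw [lt_div_iff₀ hρ] at hk1
  rw [div_le_iff₀ hρ] at hk2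
  have hNk : N ≤ k := by
    by_contra hlt
    have h2 : (1 / 2 : ℝ) ^ N ≤ (1 / 2) ^ (k + 1) :=
      pow_le_pow_of_le_one (by norm_num) (by norm_num) (by omega)
    nlinarith
  obtain ⟨h3, h4⟩ := hN k hNk
  have h5 : (1 / 2 : ℝ) ^ k ≤ 1 := pow_le_one₀ (by norm_num) (by norm_num)
  have h6 : ‖G t - G ((1 / 2) ^ k * ρ)‖ ≤ A * ω ((1 / 2) ^ k * ρ) := by
    refine hG _ _ ht0 hk2 ?_ (by nlinarith)
    rw [pow_succ] at hk1
    linarith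
  calc dist (G t) L ≤ dist (G t) (G ((1 / 2) ^ k * ρ)) + dist (G ((1 / 2) ^ k * ρ)) L :=
        dist_triangle _ _ _
    _ < e / 2 + e / 2 := by
        rw [dist_eq_norm (G t)]
        exact add_lt_add (h6.trans_lt h3) h4
    _ = e := by ring

/-! ### The kernel -/

/-- The rotation by a right angle changes the sign of the kernel. -/
theorem setIntegral_annulus_inv_sq (δ R : ℝ) :
    ∫ w in {w : ℂ | δ < ‖w‖ ∧ ‖w‖ ≤ R}, 1 / w ^ 2 = 0 := by
  set S := {w : ℂ | δ < ‖w‖ ∧ ‖w‖ ≤ R}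
  let e : ℂ ≃ₗᵢ[ℝ] ℂ := rotation ⟨Complex.I, by simp [Submonoid.unitSphere]⟩
  have he : ∀ w, e w = Complex.I * w := fun w => rfl
  have hmp := e.measurePreserving
  have h1 := hmp.setIntegral_preimage_emb e.toHomeomorph.measurableEmbedding
    (fun w : ℂ => 1 / w ^ 2) S
  have hpre : e ⁻¹' S = S := by
    ext w
    simp [S, he]
  rw [hpre] at h1
  have h2 : (fun w => 1 / (e w) ^ 2) = fun w : ℂ => -(1 / w ^ 2) := by
    funext w
    rw [he, mul_pow, Complex.I_sq]
    ring
  rw [h2, integral_neg] at h1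
  linear_combination (-1 / 2 : ℂ) * h1

theorem truncatedBeurling_eq (g : ℂ → ℂ) (δ : ℝ) (z : ℂ) :
    truncatedBeurling g δ z =
      -(1 / (Real.pi : ℂ)) * ∫ u in {u : ℂ | δ < ‖z - u‖}, g u * (1 / (z - u) ^ 2) := by
  unfold truncatedBeurling
  have hm : MeasurableSet {w : ℂ | δ < ‖w‖} := measurableSet_lt measurable_const measurable_norm
  have hm' : MeasurableSet {u : ℂ | δ < ‖z - u‖} :=
    measurableSet_lt measurable_const (by fun_prop)
  rw [← integral_indicator hm, ← integral_indicator hm']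
  congr 1
  rw [← integral_sub_left_eq_self (fun u => indicator {u : ℂ | δ < ‖z - u‖}
    (fun u => g u * (1 / (z - u) ^ 2)) u) volume z]
  congr 1
  funext w
  simp [indicator]

/-- The mean value estimate for `1 / p ^ 2`, by the factorization of the difference. -/
theorem norm_inv_sq_sub_inv_sq_le {p q : ℂ} {r C : ℝ} (hr : 0 < r)
    (hp : r ≤ C * ‖p‖) (hq : r ≤ C * ‖q‖) :
    ‖1 / p ^ 2 - 1 / q ^ 2‖ ≤ 2 * C ^ 3 * ‖p - q‖ / r ^ 3 := by
  have hC : 0 < C := by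
    by_contra h
    nlinarith [norm_nonneg p]
  have hp0 : 0 < ‖p‖ := by
    by_contra h
    have : ‖p‖ = 0 := le_antisymm (not_lt.1 h) (norm_nonneg _)
    rw [this] at hp; linarith
  have hq0 : 0 < ‖q‖ := by
    by_contra h
    have : ‖q‖ = 0 := le_antisymm (not_lt.1 h) (norm_nonneg _)
    rw [this] at hq; linarith
  have hpn : p ≠ 0 := norm_pos_iff.1 hp0
  have hqn : q ≠ 0 := norm_pos_iff.1 hq0
  have hid : 1 / p ^ 2 - 1 / q ^ 2 = -(p - q) * (1 / (p * q ^ 2) + 1 / (p ^ 2 * q)) := by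
    field_simp
    ring
  have h1 : r / C ≤ ‖p‖ := by rwa [div_le_iff₀' hC]
  have h2 : r / C ≤ ‖q‖ := by rwa [div_le_iff₀' hC]
  have hrC : 0 < r / C := by positivity
  have h3 : ‖1 / (p * q ^ 2)‖ ≤ 1 / (r / C) ^ 3 := by
    rw [norm_div, norm_one, norm_mul, norm_pow]
    apply one_div_le_one_div_of_le (by positivity)
    calc (r / C) ^ 3 = (r / C) * (r / C) ^ 2 := by ring
      _ ≤ _ := by gcongr
  have h4 : ‖1 / (p ^ 2 * q)‖ ≤ 1 / (r / C) ^ 3 := by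
    rw [norm_div, norm_one, norm_mul, norm_pow]
    apply one_div_le_one_div_of_le (by positivity)
    calc (r / C) ^ 3 = (r / C) ^ 2 * (r / C) := by ring
      _ ≤ _ := by gcongr
  rw [hid, norm_mul, norm_neg]
  calc ‖p - q‖ * ‖1 / (p * q ^ 2) + 1 / (p ^ 2 * q)‖
      ≤ ‖p - q‖ * (1 / (r / C) ^ 3 + 1 / (r / C) ^ 3) := by
        gcongr
        exact (norm_add_le _ _).trans (add_le_add h3 h4)
    _ = _ := by field_simp; ring

/-! ### The square-integrable estimate -/

/-- The bracket `√(1 + |w|²)`. -/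
noncomputable def bracket (w : ℂ) : ℝ := Real.sqrt (1 + ‖w‖ ^ 2)

theorem bracket_sq (w : ℂ) : bracket w ^ 2 = 1 + ‖w‖ ^ 2 := Real.sq_sqrt (by positivity)

theorem one_le_bracket (w : ℂ) : 1 ≤ bracket w := by
  unfold bracket
  rw [Real.one_le_sqrt]
  nlinarith [norm_nonneg w]

theorem bracket_pos (w : ℂ) : 0 < bracket w := zero_lt_one.trans_le (one_le_bracket w)

theorem norm_le_bracket (w : ℂ) : ‖w‖ ≤ bracket w := by
  apply Real.le_sqrt_of_sq_le
  linarith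

theorem bracket_le (z x : ℂ) : bracket z ≤ (1 + ‖x‖) * bracket (z - x) := by
  have h1 : bracket z ≤ bracket (z - x) + ‖x‖ := by
    apply Real.sqrt_le_iff.2
    have h2 : ‖z‖ ≤ ‖z - x‖ + ‖x‖ := by simpa using norm_add_le (z - x) x
    have h3 := bracket_sq (z - x)
    have h4 := norm_le_bracket (z - x)
    refine ⟨by have := bracket_pos (z - x); positivity, ?_⟩
    have h5 : ‖z‖ ^ 2 ≤ (‖z - x‖ + ‖x‖) ^ 2 := by gcongr
    nlinarith [norm_nonneg x]
  nlinarith [norm_nonneg x, one_le_bracket (z - x)]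

@[fun_prop]
theorem continuous_bracket : Continuous bracket := by
  unfold bracket; fun_prop

theorem bracket_sq_eq (w : ℂ) : ((bracket w : ℝ) : ℂ) ^ 2 = 1 + w * (starRingEnd ℂ) w := by
  rw [Complex.mul_conj, Complex.normSq_eq_norm_sq]
  exact_mod_cast bracket_sq w

theorem one_add_mul_conj_ne_zero (w : ℂ) : 1 + w * (starRingEnd ℂ) w ≠ 0 := by
  rw [← bracket_sq_eq]
  have := bracket_pos w
  exact pow_ne_zero _ (by exact_mod_cast this.ne')

theorem norm_one_add_mul_conj (w : ℂ) : ‖1 + w * (starRingEnd ℂ) w‖ = bracket w ^ 2 := by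
  rw [← bracket_sq_eq, norm_pow, Complex.norm_real, Real.norm_of_nonneg (bracket_pos w).le]

theorem integrable_bracket_pow {n : ℕ} (hn : 3 ≤ n) :
    Integrable (fun w : ℂ => (bracket w ^ n)⁻¹) := by
  have h3 : Integrable (fun w : ℂ => (bracket w ^ 3)⁻¹) := by
    have := integrable_rpow_neg_one_add_norm_sq (E := ℂ) (μ := volume) (r := 3)
      (by rw [Complex.finrank_real_complex]; norm_num)
    refine this.congr (Eventually.of_forall fun w => ?_)
    simp only
    rw [← bracket_sq, ← Real.rpow_natCast, ← Real.rpow_natCast, ← Real.rpow_mul (bracket_pos w).le,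
      ← Real.rpow_neg (bracket_pos w).le]
    norm_num
  refine h3.mono' (by
    apply Measurable.aestronglyMeasurable
    have : Measurable bracket := continuous_bracket.measurable
    fun_prop) (Eventually.of_forall fun w => ?_)
  have := one_le_bracket w
  have := bracket_pos w
  rw [Real.norm_of_nonneg (by positivity)]
  gcongr

/-- A regularized Cauchy kernel: its derivatives in `z` and in the conjugate variable are a
regularized Beurling kernel and a multiple of an approximate identity. -/
noncomputable def cauchyReg (w : ℂ) : ℂ := (starRingEnd ℂ) w / (1 + w * (starRingEnd ℂ) w)

/-- The derivative of `cauchyReg` in the direction `v`. -/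
noncomputable def cauchyRegDeriv (v w : ℂ) : ℂ :=
  (starRingEnd ℂ) v / (1 + w * (starRingEnd ℂ) w) -
    (starRingEnd ℂ) w * (v * (starRingEnd ℂ) w + w * (starRingEnd ℂ) v) /
      (1 + w * (starRingEnd ℂ) w) ^ 2

/-- The second derivative of `cauchyReg` in the directions `v` and `v'`. -/
noncomputable def cauchyRegDeriv₂ (v v' w : ℂ) : ℂ :=
  -((starRingEnd ℂ) v * (v' * (starRingEnd ℂ) w + w * (starRingEnd ℂ) v') +
      (starRingEnd ℂ) v' * (v * (starRingEnd ℂ) w + w * (starRingEnd ℂ) v) +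
      (starRingEnd ℂ) w * (v * (starRingEnd ℂ) v' + v' * (starRingEnd ℂ) v)) /
      (1 + w * (starRingEnd ℂ) w) ^ 2 +
    2 * (starRingEnd ℂ) w * (v * (starRingEnd ℂ) w + w * (starRingEnd ℂ) v) *
      (v' * (starRingEnd ℂ) w + w * (starRingEnd ℂ) v') / (1 + w * (starRingEnd ℂ) w) ^ 3

theorem hasDerivAt_line (a b : ℂ) : HasDerivAt (fun t : ℝ => a + (t : ℂ) * b) b 0 := by
  have h : HasDerivAt (fun t : ℝ => (t : ℂ)) 1 0 := Complex.ofRealCLM.hasDerivAt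
  simpa using (h.mul_const b).const_add a

theorem hasLineDerivAt_cauchyReg (v w : ℂ) :
    HasLineDerivAt ℝ cauchyReg (cauchyRegDeriv v w) w v := by
  unfold HasLineDerivAt cauchyReg
  have h1 := hasDerivAt_line w v
  have h2 := hasDerivAt_line ((starRingEnd ℂ) w) ((starRingEnd ℂ) v)
  have h3 := (h1.mul h2).const_add 1
  have h4 := h2.div h3 (by simpa using one_add_mul_conj_ne_zero w)
  have hne := one_add_mul_conj_ne_zero w
  refine HasDerivAt.congr_deriv (h4.congr_of_eventuallyEq
    (Eventually.of_forall fun t => ?_)) ?_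
  · simp
  · simp only [cauchyRegDeriv, Pi.mul_apply, Complex.ofReal_zero, zero_mul, add_zero]
    field_simp

theorem hasLineDerivAt_cauchyRegDeriv (v v' w : ℂ) :
    HasLineDerivAt ℝ (cauchyRegDeriv v) (cauchyRegDeriv₂ v v' w) w v' := by
  unfold HasLineDerivAt cauchyRegDeriv
  have h1 := hasDerivAt_line w v'
  have h2 := hasDerivAt_line ((starRingEnd ℂ) w) ((starRingEnd ℂ) v')
  have h3 := (h1.mul h2).const_add 1
  have hne := one_add_mul_conj_ne_zero w
  have h4 := (hasDerivAt_const (0 : ℝ) ((starRingEnd ℂ) v)).div h3 (by simpa using hne)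
  have h5 := (h2.mul ((h2.const_mul v).add (h1.mul_const ((starRingEnd ℂ) v)))).div (h3.pow 2)
    (by simpa using hne)
  refine HasDerivAt.congr_deriv ((h4.sub h5).congr_of_eventuallyEq
    (Eventually.of_forall fun t => ?_)) ?_
  · simp
  · simp only [cauchyRegDeriv₂, Pi.mul_apply, Pi.add_apply, Pi.pow_apply, Complex.ofReal_zero,
      zero_mul, add_zero, Nat.cast_ofNat, zero_sub, Nat.add_one_sub_one, pow_one]
    generalize 1 + w * (starRingEnd ℂ) w = Q at hne ⊢
    field_simp
    ring

theorem norm_cauchyReg_le (w : ℂ) : ‖cauchyReg w‖ ≤ (bracket w)⁻¹ := by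
  have := bracket_pos w
  rw [cauchyReg, norm_div, norm_one_add_mul_conj, RCLike.norm_conj, div_le_iff₀ (by positivity)]
  refine (norm_le_bracket w).trans (le_of_eq ?_)
  field_simp

theorem norm_cauchyRegDeriv_le {v : ℂ} (hv : ‖v‖ = 1) (w : ℂ) :
    ‖cauchyRegDeriv v w‖ ≤ 3 * (bracket w ^ 2)⁻¹ := by
  have hb := bracket_pos w
  have hw := norm_le_bracket w
  unfold cauchyRegDeriv
  refine (norm_sub_le _ _).trans ?_
  have h1 : ‖(starRingEnd ℂ) v / (1 + w * (starRingEnd ℂ) w)‖ ≤ (bracket w ^ 2)⁻¹ := by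
    rw [norm_div, norm_one_add_mul_conj, RCLike.norm_conj, hv, one_div]
  have h2 : ‖(starRingEnd ℂ) w * (v * (starRingEnd ℂ) w + w * (starRingEnd ℂ) v) /
      (1 + w * (starRingEnd ℂ) w) ^ 2‖ ≤ 2 * (bracket w ^ 2)⁻¹ := by
    rw [norm_div, norm_pow, norm_one_add_mul_conj, norm_mul, RCLike.norm_conj,
      div_le_iff₀ (by positivity)]
    have h3 : ‖v * (starRingEnd ℂ) w + w * (starRingEnd ℂ) v‖ ≤ 2 * bracket w := by
      refine (norm_add_le _ _).trans ?_
      rw [norm_mul, norm_mul, RCLike.norm_conj, RCLike.norm_conj, hv]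
      linarith
    calc ‖w‖ * ‖v * (starRingEnd ℂ) w + w * (starRingEnd ℂ) v‖
        ≤ bracket w * (2 * bracket w) := by gcongr
      _ = _ := by field_simp
  linarith

theorem norm_cauchyRegDeriv₂_le {v v' : ℂ} (hv : ‖v‖ = 1) (hv' : ‖v'‖ = 1) (w : ℂ) :
    ‖cauchyRegDeriv₂ v v' w‖ ≤ 14 * (bracket w ^ 3)⁻¹ := by
  have hb := bracket_pos w
  have hw := norm_le_bracket w
  have h3 : ∀ v : ℂ, ‖v‖ = 1 →
      ‖v * (starRingEnd ℂ) w + w * (starRingEnd ℂ) v‖ ≤ 2 * bracket w := by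
    intro v hv
    refine (norm_add_le _ _).trans ?_
    rw [norm_mul, norm_mul, RCLike.norm_conj, RCLike.norm_conj, hv]
    linarith
  have h4 : ‖v * (starRingEnd ℂ) v' + v' * (starRingEnd ℂ) v‖ ≤ 2 := by
    refine (norm_add_le _ _).trans ?_
    rw [norm_mul, norm_mul, RCLike.norm_conj, RCLike.norm_conj, hv, hv']
    norm_num
  unfold cauchyRegDeriv₂
  refine (norm_add_le _ _).trans ?_
  have h1 : ‖-((starRingEnd ℂ) v * (v' * (starRingEnd ℂ) w + w * (starRingEnd ℂ) v') +
      (starRingEnd ℂ) v' * (v * (starRingEnd ℂ) w + w * (starRingEnd ℂ) v) +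
      (starRingEnd ℂ) w * (v * (starRingEnd ℂ) v' + v' * (starRingEnd ℂ) v)) /
      (1 + w * (starRingEnd ℂ) w) ^ 2‖ ≤ 6 * (bracket w ^ 3)⁻¹ := by
    rw [norm_div, norm_pow, norm_one_add_mul_conj, norm_neg, div_le_iff₀ (by positivity)]
    calc _ ≤ ‖(starRingEnd ℂ) v‖ * ‖v' * (starRingEnd ℂ) w + w * (starRingEnd ℂ) v'‖ +
        ‖(starRingEnd ℂ) v'‖ * ‖v * (starRingEnd ℂ) w + w * (starRingEnd ℂ) v‖ +
        ‖(starRingEnd ℂ) w‖ * ‖v * (starRingEnd ℂ) v' + v' * (starRingEnd ℂ) v‖ := by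
          refine (norm_add_le _ _).trans ?_
          rw [norm_mul]
          gcongr
          refine (norm_add_le _ _).trans ?_
          rw [norm_mul, norm_mul]
      _ ≤ 1 * (2 * bracket w) + 1 * (2 * bracket w) + bracket w * 2 := by
          rw [RCLike.norm_conj, RCLike.norm_conj, RCLike.norm_conj, hv, hv']
          gcongr
          · exact h3 v' hv'
          · exact h3 v hv
      _ = _ := by field_simp; ring
  have h2 : ‖2 * (starRingEnd ℂ) w * (v * (starRingEnd ℂ) w + w * (starRingEnd ℂ) v) *
      (v' * (starRingEnd ℂ) w + w * (starRingEnd ℂ) v') / (1 + w * (starRingEnd ℂ) w) ^ 3‖ ≤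
      8 * (bracket w ^ 3)⁻¹ := by
    rw [norm_div, norm_pow, norm_one_add_mul_conj, div_le_iff₀ (by positivity), norm_mul, norm_mul,
      norm_mul, RCLike.norm_conj, Complex.norm_ofNat]
    calc _ ≤ 2 * bracket w * (2 * bracket w) * (2 * bracket w) := by
          gcongr
          · exact h3 v hv
          · exact h3 v' hv'
      _ = _ := by field_simp; ring
  linarith

theorem continuous_cauchyReg : Continuous cauchyReg := by
  unfold cauchyReg
  have := one_add_mul_conj_ne_zero
  fun_prop (disch := assumption)

theorem continuous_cauchyRegDeriv (v : ℂ) : Continuous (cauchyRegDeriv v) := by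
  unfold cauchyRegDeriv
  have := one_add_mul_conj_ne_zero
  have h2 := fun w => pow_ne_zero 2 (this w)
  fun_prop (disch := assumption)

theorem continuous_cauchyRegDeriv₂ (v v' : ℂ) : Continuous (cauchyRegDeriv₂ v v') := by
  unfold cauchyRegDeriv₂
  have := one_add_mul_conj_ne_zero
  have h2 := fun w => pow_ne_zero 2 (this w)
  have h3 := fun w => pow_ne_zero 3 (this w)
  fun_prop (disch := assumption)

/-- Products of two translated kernels of total decay at least `3` are integrable. -/
theorem integrable_mul_conj_translate {k l : ℂ → ℂ} (hk : Continuous k) (hl : Continuous l)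
    {m n : ℕ} {A B : ℝ} (hkb : ∀ w, ‖k w‖ ≤ A * (bracket w ^ m)⁻¹)
    (hlb : ∀ w, ‖l w‖ ≤ B * (bracket w ^ n)⁻¹) (hmn : 3 ≤ m + n) (x y : ℂ) :
    Integrable (fun z => k (z - x) * (starRingEnd ℂ) (l (z - y))) := by
  have key : ∀ (f : ℂ → ℂ) (m : ℕ) (A : ℝ), (∀ w, ‖f w‖ ≤ A * (bracket w ^ m)⁻¹) →
      ∀ z x : ℂ, ‖f (z - x)‖ ≤ A * (1 + ‖x‖) ^ m * (bracket z ^ m)⁻¹ := by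
    intro f m A hf z x
    have hA : 0 ≤ A := by
      have h0 := (norm_nonneg _).trans (hf 0)
      have := bracket_pos 0
      by_contra hneg
      have : A * (bracket 0 ^ m)⁻¹ < 0 := mul_neg_of_neg_of_pos (not_le.1 hneg) (by positivity)
      linarith
    refine (hf _).trans ?_
    have h1 := bracket_pos (z - x)
    have h2 := bracket_pos z
    rw [mul_assoc]
    gcongr
    rw [inv_le_iff_one_le_mul₀ (by positivity), mul_assoc, mul_comm _ (bracket (z - x) ^ m),
      ← mul_assoc, ← mul_pow, ← div_eq_mul_inv, one_le_div (by positivity)]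
    gcongr
    exact bracket_le z x
  refine ((integrable_bracket_pow hmn).const_mul
    (A * (1 + ‖x‖) ^ m * (B * (1 + ‖y‖) ^ n))).mono' (by
      apply Continuous.aestronglyMeasurable
      have := Complex.continuous_conj
      fun_prop) (Eventually.of_forall fun z => ?_)
  rw [norm_mul, RCLike.norm_conj]
  have h1 := key k m A hkb z x
  have h2 := key l n B hlb z y
  calc _ ≤ A * (1 + ‖x‖) ^ m * (bracket z ^ m)⁻¹ * (B * (1 + ‖y‖) ^ n * (bracket z ^ n)⁻¹) :=
        mul_le_mul h1 h2 (norm_nonneg _) ((norm_nonneg _).trans h1)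
    _ = _ := by rw [pow_add, mul_inv]; ring

theorem HasLineDerivAt.comp_sub {f : ℂ → ℂ} {f' v x z : ℂ}
    (h : HasLineDerivAt ℝ f f' (z - x) v) : HasLineDerivAt ℝ (fun z => f (z - x)) f' z v := by
  unfold HasLineDerivAt at *
  refine h.congr_of_eventuallyEq (Eventually.of_forall fun t => ?_)
  simp only
  congr 1
  ring

theorem HasLineDerivAt.conj {f : ℂ → ℂ} {f' v z : ℂ} (h : HasLineDerivAt ℝ f f' z v) :
    HasLineDerivAt ℝ (fun z => (starRingEnd ℂ) (f z)) ((starRingEnd ℂ) f') z v := by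
  unfold HasLineDerivAt at *
  exact h.star

/-- Integration by parts, twice, moves the two directional derivatives around. -/
theorem integral_cauchyRegDeriv_comm (x y : ℂ) :
    ∫ z, cauchyRegDeriv 1 (z - x) * (starRingEnd ℂ) (cauchyRegDeriv Complex.I (z - y)) =
      ∫ z, cauchyRegDeriv Complex.I (z - x) * (starRingEnd ℂ) (cauchyRegDeriv 1 (z - y)) := by
  have h1 : ‖(1 : ℂ)‖ = 1 := norm_one
  have hI : ‖Complex.I‖ = 1 := Complex.norm_I
  have key : ∀ v v' : ℂ, ‖v‖ = 1 → ‖v'‖ = 1 →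
      ∫ z, cauchyReg (z - x) * (starRingEnd ℂ) (cauchyRegDeriv₂ v v' (z - y)) =
      -∫ z, cauchyRegDeriv v' (z - x) * (starRingEnd ℂ) (cauchyRegDeriv v (z - y)) := by
    intro v v' hv hv'
    have hu : ∀ w, ‖cauchyReg w‖ ≤ 1 * (bracket w ^ 1)⁻¹ := by
      simpa using norm_cauchyReg_le
    refine integral_bilinear_hasLineDerivAt_right_eq_neg_left_of_integrable
      (B := ContinuousLinearMap.mul ℝ ℂ) (f := fun z => cauchyReg (z - x))
      (f' := fun z => cauchyRegDeriv v' (z - x))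
      (g := fun z => (starRingEnd ℂ) (cauchyRegDeriv v (z - y)))
      (g' := fun z => (starRingEnd ℂ) (cauchyRegDeriv₂ v v' (z - y))) (v := v') ?_ ?_ ?_ ?_ ?_
    · exact integrable_mul_conj_translate (continuous_cauchyRegDeriv v')
        (continuous_cauchyRegDeriv v) (norm_cauchyRegDeriv_le hv') (norm_cauchyRegDeriv_le hv)
        (by norm_num) x y
    · exact integrable_mul_conj_translate continuous_cauchyReg
        (continuous_cauchyRegDeriv₂ v v') hu (norm_cauchyRegDeriv₂_le hv hv') (by norm_num) x y
    · exact integrable_mul_conj_translate continuous_cauchyReg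
        (continuous_cauchyRegDeriv v) hu (norm_cauchyRegDeriv_le hv) (by norm_num) x y
    · exact fun z _ => HasLineDerivAt.comp_sub (hasLineDerivAt_cauchyReg v' (z - x))
    · exact fun z _ => HasLineDerivAt.conj
        (HasLineDerivAt.comp_sub (hasLineDerivAt_cauchyRegDeriv v v' (z - y)))
  have hsymm : ∀ w, cauchyRegDeriv₂ 1 Complex.I w = cauchyRegDeriv₂ Complex.I 1 w := by
    intro w
    unfold cauchyRegDeriv₂
    ring
  have e1 := key Complex.I 1 hI h1
  have e2 := key 1 Complex.I h1 hI
  simp only [hsymm] at e2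
  rw [e1] at e2
  exact neg_injective e2

/-- The regularized Beurling kernel `∂u` for `u = cauchyReg`. -/
noncomputable def beurlingReg (w : ℂ) : ℂ :=
  -((starRingEnd ℂ) w) ^ 2 / (1 + w * (starRingEnd ℂ) w) ^ 2

/-- The integrable kernel `∂̄u` for `u = cauchyReg`, a multiple of an approximate identity. -/
noncomputable def poissonReg (w : ℂ) : ℂ := 1 / (1 + w * (starRingEnd ℂ) w) ^ 2

theorem beurlingReg_eq (w : ℂ) :
    beurlingReg w = (cauchyRegDeriv 1 w - Complex.I * cauchyRegDeriv Complex.I w) / 2 := by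
  have := one_add_mul_conj_ne_zero w
  unfold beurlingReg cauchyRegDeriv
  simp only [map_one, Complex.conj_I]
  field_simp
  ring_nf
  simp only [Complex.I_sq]
  ring

theorem poissonReg_eq (w : ℂ) :
    poissonReg w = (cauchyRegDeriv 1 w + Complex.I * cauchyRegDeriv Complex.I w) / 2 := by
  have := one_add_mul_conj_ne_zero w
  unfold poissonReg cauchyRegDeriv
  simp only [map_one, Complex.conj_I]
  field_simp
  ring_nf
  simp only [Complex.I_sq]
  ring

/-- The Beurling transform maps the approximate identity to the regularized Beurling kernel
isometrically: their autocorrelations agree. -/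
theorem integral_beurlingReg_eq (x y : ℂ) :
    ∫ z, beurlingReg (z - x) * (starRingEnd ℂ) (beurlingReg (z - y)) =
      ∫ z, poissonReg (z - x) * (starRingEnd ℂ) (poissonReg (z - y)) := by
  have h1 : ‖(1 : ℂ)‖ = 1 := norm_one
  have hI : ‖Complex.I‖ = 1 := Complex.norm_I
  have hint : ∀ v v' : ℂ, ‖v‖ = 1 → ‖v'‖ = 1 → Integrable (fun z => cauchyRegDeriv v (z - x) *
      (starRingEnd ℂ) (cauchyRegDeriv v' (z - y))) := fun v v' hv hv' =>
    integrable_mul_conj_translate (continuous_cauchyRegDeriv v) (continuous_cauchyRegDeriv v')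
      (norm_cauchyRegDeriv_le hv) (norm_cauchyRegDeriv_le hv') (by norm_num) x y
  have e : ∀ z, beurlingReg (z - x) * (starRingEnd ℂ) (beurlingReg (z - y)) =
      poissonReg (z - x) * (starRingEnd ℂ) (poissonReg (z - y)) +
      Complex.I / 2 * (cauchyRegDeriv 1 (z - x) *
        (starRingEnd ℂ) (cauchyRegDeriv Complex.I (z - y)) - cauchyRegDeriv Complex.I (z - x) *
        (starRingEnd ℂ) (cauchyRegDeriv 1 (z - y))) := by
    intro z
    simp only [beurlingReg_eq, poissonReg_eq, map_div₀, map_sub, map_add, map_mul, Complex.conj_I,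
      map_ofNat]
    ring
  simp only [e]
  rw [integral_add, integral_const_mul, integral_sub (hint _ _ h1 hI) (hint _ _ hI h1),
    integral_cauchyRegDeriv_comm, sub_self, mul_zero, add_zero]
  · simp only [poissonReg_eq, map_div₀, map_add, map_mul, Complex.conj_I, map_ofNat]
    have := (((hint _ _ h1 h1).add ((hint _ _ hI hI))).add (((hint _ _ hI h1).sub
      (hint _ _ h1 hI)).const_mul Complex.I)).div_const 4
    refine this.congr (Eventually.of_forall fun z => ?_)
    simp only [Pi.add_apply, Pi.sub_apply]
    ring_nf
    simp only [Complex.I_sq]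
    ring
  · exact ((hint _ _ h1 hI).sub (hint _ _ hI h1)).const_mul _

/-- The Cauchy–Schwarz inequality with a weight. -/
theorem sq_lintegral_mul_le {α : Type*} [MeasurableSpace α] {μ : Measure α} {k h : α → ℝ≥0∞}
    (hk : AEMeasurable k μ) (hh : AEMeasurable h μ) :
    (∫⁻ x, k x * h x ∂μ) ^ 2 ≤ (∫⁻ x, k x ∂μ) * ∫⁻ x, k x * h x ^ 2 ∂μ := by
  have hpq : (2 : ℝ).HolderConjugate 2 := by
    rw [Real.holderConjugate_iff]; norm_num
  have h1 := ENNReal.lintegral_mul_le_Lp_mul_Lq μ hpq (f := fun x => k x ^ (1 / 2 : ℝ))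
    (g := fun x => k x ^ (1 / 2 : ℝ) * h x) (hk.pow_const _) ((hk.pow_const _).mul hh)
  have e1 : ∀ x, (k x ^ (1 / 2 : ℝ)) ^ (2 : ℝ) = k x := fun x => by
    rw [← ENNReal.rpow_mul]; norm_num
  have e2 : ∀ x, ((fun x => k x ^ (1 / 2 : ℝ)) * fun x => k x ^ (1 / 2 : ℝ) * h x) x =
      k x * h x := fun x => by
    simp only [Pi.mul_apply]
    rw [← mul_assoc, ← ENNReal.rpow_add_of_nonneg _ _ (by norm_num) (by norm_num)]
    norm_num
  simp only [e2, ENNReal.mul_rpow_of_nonneg _ _ (zero_le_two (α := ℝ)), e1] at h1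
  have h2 := pow_le_pow_left' h1 2
  refine h2.trans (le_of_eq ?_)
  rw [mul_pow, ← ENNReal.rpow_natCast, ← ENNReal.rpow_natCast, ← ENNReal.rpow_mul,
    ← ENNReal.rpow_mul]
  norm_num

/-- Young's inequality for the convolution of an integrable and a square integrable function. -/
theorem lintegral_sq_convolution_le {k h : ℂ → ℂ} (hk : Measurable k) (hh : Measurable h) :
    ∫⁻ z, ‖∫ x, k (z - x) * h x‖ₑ ^ 2 ≤ (∫⁻ w, ‖k w‖ₑ) ^ 2 * ∫⁻ x, ‖h x‖ₑ ^ 2 := by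
  have h1 : ∀ z, ‖∫ x, k (z - x) * h x‖ₑ ^ 2 ≤
      (∫⁻ w, ‖k w‖ₑ) * ∫⁻ x, ‖k (z - x)‖ₑ * ‖h x‖ₑ ^ 2 := by
    intro z
    have h2 : ‖∫ x, k (z - x) * h x‖ₑ ≤ ∫⁻ x, ‖k (z - x)‖ₑ * ‖h x‖ₑ := by
      refine (enorm_integral_le_lintegral_enorm _).trans (le_of_eq ?_)
      simp_rw [enorm_mul]
    refine (pow_le_pow_left' h2 2).trans ((sq_lintegral_mul_le (by fun_prop)
      (by fun_prop)).trans (le_of_eq ?_))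
    rw [lintegral_sub_left_eq_self (fun w => ‖k w‖ₑ) z]
  refine (lintegral_mono h1).trans ?_
  rw [lintegral_const_mul _ (by fun_prop), lintegral_lintegral_swap (by fun_prop), sq, mul_assoc]
  gcongr
  rw [← lintegral_const_mul _ (by fun_prop)]
  refine lintegral_mono fun x => ?_
  rw [lintegral_mul_const _ (by fun_prop), lintegral_sub_right_eq_self (fun w => ‖k w‖ₑ) x]

/-- The square integral of a convolution in terms of the autocorrelation of the kernel. -/
theorem integral_sq_convolution_eq {k h : ℂ → ℂ} (hk : Continuous k) (hh : Measurable h)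
    {A N R : ℝ} (hkb : ∀ w, ‖k w‖ ≤ A * (bracket w ^ 2)⁻¹) (hN : ∀ x, ‖h x‖ ≤ N)
    (hR : ∀ x, h x ≠ 0 → ‖x‖ ≤ R) :
    Integrable (fun z => (∫ x, k (z - x) * h x) * (starRingEnd ℂ) (∫ x, k (z - x) * h x)) ∧
    ∫ z, (∫ x, k (z - x) * h x) * (starRingEnd ℂ) (∫ x, k (z - x) * h x) =
      ∫ p : ℂ × ℂ, (h p.1 * (starRingEnd ℂ) (h p.2)) *
        ∫ z, k (z - p.1) * (starRingEnd ℂ) (k (z - p.2)) := by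
  have hA : 0 ≤ A := by
    have h0 := (norm_nonneg _).trans (hkb 0)
    have := bracket_pos 0
    by_contra hneg
    have : A * (bracket 0 ^ 2)⁻¹ < 0 := mul_neg_of_neg_of_pos (not_le.1 hneg) (by positivity)
    linarith
  have hN0 : 0 ≤ N := (norm_nonneg _).trans (hN 0)
  set B := Metric.closedBall (0 : ℂ) R
  set M := A * (1 + |R|) ^ 2 * N with hM
  have hM0 : 0 ≤ M := by positivity
  have hbound : ∀ z x : ℂ, ‖k (z - x) * h x‖ ≤
      M * (bracket z ^ 2)⁻¹ * B.indicator (fun _ => (1 : ℝ)) x := by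
    intro z x
    have hbz := bracket_pos z
    by_cases hx : h x = 0
    · rw [hx, mul_zero, norm_zero]
      exact mul_nonneg (by positivity) (indicator_nonneg (fun _ _ => zero_le_one) _)
    · have hxR := hR x hx
      have hxB : x ∈ B := by simpa [B] using hxR
      rw [indicator_of_mem hxB, mul_one, norm_mul]
      have h1 := bracket_pos (z - x)
      have h2 : bracket z ≤ (1 + |R|) * bracket (z - x) := by
        refine (bracket_le z x).trans ?_
        gcongr
        exact hxR.trans (le_abs_self R)
      have h3 : (bracket (z - x) ^ 2)⁻¹ ≤ (1 + |R|) ^ 2 * (bracket z ^ 2)⁻¹ := by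
        rw [inv_le_iff_one_le_mul₀ (by positivity), mul_assoc, mul_comm _ (bracket (z - x) ^ 2),
          ← mul_assoc, ← mul_pow, ← div_eq_mul_inv, one_le_div (by positivity)]
        gcongr
      calc ‖k (z - x)‖ * ‖h x‖ ≤ (A * (bracket (z - x) ^ 2)⁻¹) * N := by
            gcongr
            exacts [hkb _, hN x]
        _ ≤ (A * ((1 + |R|) ^ 2 * (bracket z ^ 2)⁻¹)) * N := by gcongr
        _ = _ := by rw [hM]; ring
  have hB : Integrable (B.indicator (fun _ => (1 : ℝ))) :=
    (integrable_indicator_iff measurableSet_closedBall).2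
      (integrableOn_const (measure_closedBall_lt_top.ne))
  have hint : Integrable (fun q : ℂ × (ℂ × ℂ) => (k (q.1 - q.2.1) * h q.2.1) *
      (starRingEnd ℂ) (k (q.1 - q.2.2) * h q.2.2)) (volume.prod (volume.prod volume)) := by
    have hdom := ((integrable_bracket_pow (n := 4) (by norm_num)).const_mul (M ^ 2)).mul_prod
      (hB.mul_prod hB)
    refine hdom.mono' (by
      apply Measurable.aestronglyMeasurable
      have := hk.measurable
      have := Complex.continuous_conj.measurable
      fun_prop) (Eventually.of_forall fun q => ?_)
    rw [norm_mul, RCLike.norm_conj]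
    calc _ ≤ _ := mul_le_mul (hbound q.1 q.2.1) (hbound q.1 q.2.2) (norm_nonneg _)
            ((norm_nonneg _).trans (hbound q.1 q.2.1))
      _ = _ := by
        have e : (bracket q.1 ^ 4)⁻¹ = (bracket q.1 ^ 2)⁻¹ * (bracket q.1 ^ 2)⁻¹ := by
          rw [← mul_inv, ← pow_add]
        rw [e]
        ring
  have e1 : ∀ z, ∫ p : ℂ × ℂ, (k (z - p.1) * h p.1) * (starRingEnd ℂ) (k (z - p.2) * h p.2) =
      (∫ x, k (z - x) * h x) * (starRingEnd ℂ) (∫ x, k (z - x) * h x) := by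
    intro z
    rw [← integral_conj]
    exact integral_prod_mul (fun x => k (z - x) * h x)
      (fun x => (starRingEnd ℂ) (k (z - x) * h x))
  simp only [← e1]
  refine ⟨hint.integral_prod_left, ?_⟩
  rw [integral_integral_swap hint]
  congr 1
  funext p
  rw [← integral_const_mul]
  congr 1
  funext z
  simp only [map_mul]
  ring

theorem norm_beurlingReg_le (w : ℂ) : ‖beurlingReg w‖ ≤ 1 * (bracket w ^ 2)⁻¹ := by
  have h := bracket_pos w
  rw [beurlingReg, norm_div, norm_pow, norm_one_add_mul_conj, norm_neg, norm_pow, RCLike.norm_conj,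
    div_le_iff₀ (by positivity)]
  have := norm_le_bracket w
  calc ‖w‖ ^ 2 ≤ bracket w ^ 2 := by gcongr
    _ = _ := by field_simp

theorem norm_poissonReg (w : ℂ) : ‖poissonReg w‖ = (bracket w ^ 4)⁻¹ := by
  rw [poissonReg, norm_div, norm_pow, norm_one_add_mul_conj, norm_one, one_div, ← pow_mul]

theorem norm_poissonReg_le (w : ℂ) : ‖poissonReg w‖ ≤ 1 * (bracket w ^ 2)⁻¹ := by
  rw [norm_poissonReg, one_mul]
  have := bracket_pos w
  have := one_le_bracket w
  gcongr
  norm_num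

theorem continuous_beurlingReg : Continuous beurlingReg := by
  unfold beurlingReg
  have h2 := fun w => pow_ne_zero 2 (one_add_mul_conj_ne_zero w)
  fun_prop (disch := assumption)

theorem continuous_poissonReg : Continuous poissonReg := by
  unfold poissonReg
  have h2 := fun w => pow_ne_zero 2 (one_add_mul_conj_ne_zero w)
  fun_prop (disch := assumption)

theorem lintegral_sq_beurlingReg_eq {h : ℂ → ℂ} (hh : Measurable h)
    {N R : ℝ} (hN : ∀ x, ‖h x‖ ≤ N) (hR : ∀ x, h x ≠ 0 → ‖x‖ ≤ R) :
    ∫⁻ z, ‖∫ x, beurlingReg (z - x) * h x‖ₑ ^ 2 = ∫⁻ z, ‖∫ x, poissonReg (z - x) * h x‖ₑ ^ 2 := by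
  obtain ⟨i1, e1⟩ := integral_sq_convolution_eq continuous_beurlingReg hh norm_beurlingReg_le hN hR
  obtain ⟨i2, e2⟩ := integral_sq_convolution_eq continuous_poissonReg hh norm_poissonReg_le hN hR
  have e3 : (∫ z, (∫ x, beurlingReg (z - x) * h x) *
      (starRingEnd ℂ) (∫ x, beurlingReg (z - x) * h x)) =
      ∫ z, (∫ x, poissonReg (z - x) * h x) * (starRingEnd ℂ) (∫ x, poissonReg (z - x) * h x) := by
    rw [e1, e2]
    simp only [integral_beurlingReg_eq]
  have key : ∀ G : ℂ → ℂ, Integrable (fun z => G z * (starRingEnd ℂ) (G z)) →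
      ∫⁻ z, ‖G z‖ₑ ^ 2 = ENNReal.ofReal (∫ z, G z * (starRingEnd ℂ) (G z)).re := by
    intro G hG
    have h1 : ∀ z, G z * (starRingEnd ℂ) (G z) = ((‖G z‖ ^ 2 : ℝ) : ℂ) := fun z => by
      rw [Complex.mul_conj, Complex.normSq_eq_norm_sq]
    simp only [h1] at hG ⊢
    rw [integral_complex_ofReal, Complex.ofReal_re,
      ofReal_integral_eq_lintegral_ofReal]
    · refine lintegral_congr fun z => ?_
      rw [ENNReal.ofReal_pow (norm_nonneg _), ofReal_norm]
    · exact hG.re.congr (Eventually.of_forall fun z => Complex.ofReal_re _)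
    · exact Eventually.of_forall fun z => by positivity
  rw [key _ i1, key _ i2, e3]

/-- The sharp truncation differs from the regularized kernel by an integrable kernel. -/
theorem norm_indicator_add_beurlingReg_le (w : ℂ) :
    ‖{w : ℂ | 1 < ‖w‖}.indicator (fun w => 1 / w ^ 2) w + beurlingReg w‖ ≤
      4 * (bracket w ^ 4)⁻¹ := by
  have hb := bracket_pos w
  have hb2 := bracket_sq w
  have hb4 : bracket w ^ 4 = (1 + ‖w‖ ^ 2) ^ 2 := by rw [← hb2]; ring
  have hne := one_add_mul_conj_ne_zero w
  by_cases hw : 1 < ‖w‖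
  · rw [indicator_of_mem (by exact hw)]
    have hw0 : w ≠ 0 := norm_pos_iff.1 (by linarith)
    have hid : 1 / w ^ 2 + beurlingReg w = (1 + 2 * (w * (starRingEnd ℂ) w)) /
        (w ^ 2 * (1 + w * (starRingEnd ℂ) w) ^ 2) := by
      unfold beurlingReg
      field_simp
      ring
    rw [hid, norm_div, norm_mul, norm_pow, norm_pow, norm_one_add_mul_conj, ← div_eq_mul_inv]
    have h1 : ‖1 + 2 * (w * (starRingEnd ℂ) w)‖ ≤ 1 + 2 * ‖w‖ ^ 2 := by
      refine (norm_add_le _ _).trans ?_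
      rw [norm_one, norm_mul, norm_mul, RCLike.norm_conj, Complex.norm_ofNat]
      linarith [sq ‖w‖]
    rw [div_le_div_iff₀ (by positivity) (by positivity)]
    calc ‖1 + 2 * (w * (starRingEnd ℂ) w)‖ * bracket w ^ 4
        ≤ (4 * ‖w‖ ^ 2) * bracket w ^ 4 := by
          gcongr
          nlinarith
      _ = _ := by ring
  · have hw' := not_lt.1 hw
    rw [indicator_of_notMem (by exact hw), zero_add]
    rw [beurlingReg, norm_div, norm_pow, norm_one_add_mul_conj, norm_neg, norm_pow,
      RCLike.norm_conj, ← pow_mul, ← div_eq_mul_inv]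
    gcongr
    nlinarith [norm_nonneg w]

/-- The `L²` bound at truncation radius `1`, to which the others reduce by scaling. -/
theorem exists_lintegral_sq_truncatedBeurling_one_le :
    ∃ C : ℝ≥0, ∀ h : ℂ → ℂ, Measurable h → ∀ N R : ℝ, (∀ x, ‖h x‖ ≤ N) →
      (∀ x, h x ≠ 0 → ‖x‖ ≤ R) →
      ∫⁻ z, ‖truncatedBeurling h 1 z‖ₑ ^ 2 ≤ C * ∫⁻ x, ‖h x‖ₑ ^ 2 := by
  have hP : ∫⁻ w : ℂ, ENNReal.ofReal ((bracket w ^ 4)⁻¹) < ∞ := by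
    have := (integrable_bracket_pow (n := 4) (by norm_num)).hasFiniteIntegral
    rw [hasFiniteIntegral_iff_norm] at this
    refine lt_of_le_of_lt (lintegral_mono fun w => ?_) this
    exact ENNReal.ofReal_le_ofReal (le_abs_self _)
  set P := ∫⁻ w : ℂ, ENNReal.ofReal ((bracket w ^ 4)⁻¹)
  refine ⟨(2 * P ^ 2 + 2 * (4 * P) ^ 2).toNNReal, fun h hh N R hN hR => ?_⟩
  rw [ENNReal.coe_toNNReal (by finiteness)]
  set K : ℂ → ℂ := fun w => {w : ℂ | 1 < ‖w‖}.indicator (fun w => 1 / w ^ 2) w + beurlingReg w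
  have hKm : Measurable K := by
    have h1 : MeasurableSet {w : ℂ | 1 < ‖w‖} := measurableSet_lt measurable_const measurable_norm
    exact (Measurable.indicator (by fun_prop) h1).add continuous_beurlingReg.measurable
  have hconv1 : ∫⁻ z, ‖∫ x, beurlingReg (z - x) * h x‖ₑ ^ 2 ≤ P ^ 2 * ∫⁻ x, ‖h x‖ₑ ^ 2 := by
    rw [lintegral_sq_beurlingReg_eq hh hN hR]
    refine (lintegral_sq_convolution_le continuous_poissonReg.measurable hh).trans (le_of_eq ?_)
    congr 3
    funext w
    rw [← norm_poissonReg, ofReal_norm]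
  have hconv2 : ∫⁻ z, ‖∫ x, K (z - x) * h x‖ₑ ^ 2 ≤ (4 * P) ^ 2 * ∫⁻ x, ‖h x‖ₑ ^ 2 := by
    refine (lintegral_sq_convolution_le hKm hh).trans ?_
    gcongr
    rw [← lintegral_const_mul' _ _ (by norm_num)]
    refine lintegral_mono fun w => ?_
    rw [← ofReal_norm, ← ENNReal.ofReal_ofNat 4, ← ENNReal.ofReal_mul (by norm_num)]
    exact ENNReal.ofReal_le_ofReal (norm_indicator_add_beurlingReg_le w)
  have hhint : Integrable h := by
    have : Integrable ((Metric.closedBall (0 : ℂ) R).indicator fun _ => N) :=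
      (integrable_indicator_iff measurableSet_closedBall).2
        (integrableOn_const (measure_closedBall_lt_top.ne))
    refine this.mono' hh.aestronglyMeasurable (Eventually.of_forall fun x => ?_)
    by_cases hx : h x = 0
    · rw [hx, norm_zero]
      exact indicator_nonneg (fun _ _ => (norm_nonneg _).trans (hN 0)) _
    · rw [indicator_of_mem (by simpa using hR x hx)]
      exact hN x
  have hint : ∀ (k : ℂ → ℂ) (A : ℝ), Measurable k → (∀ w, ‖k w‖ ≤ A) → ∀ z,
      Integrable (fun x => k (z - x) * h x) := fun k A hk hkA z =>
    hhint.bdd_mul (c := A) (hk.comp (measurable_const.sub measurable_id)).aestronglyMeasurable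
      (Eventually.of_forall fun x => hkA _)
  have hinv : ∀ n (w : ℂ), (bracket w ^ n)⁻¹ ≤ 1 := fun n w => by
    have := one_le_bracket w
    exact inv_le_one_of_one_le₀ (one_le_pow₀ this)
  have hsplit : ∀ z, truncatedBeurling h 1 z = -(1 / (Real.pi : ℂ)) *
      ((∫ x, K (z - x) * h x) - ∫ x, beurlingReg (z - x) * h x) := by
    intro z
    rw [truncatedBeurling_eq, ← integral_sub
      (hint K 4 hKm (fun w => (norm_indicator_add_beurlingReg_le w).trans (by linarith [hinv 4 w]))
        z)
      (hint beurlingReg 1 continuous_beurlingReg.measurable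
        (fun w => (norm_beurlingReg_le w).trans (by linarith [hinv 2 w])) z),
      ← integral_indicator (measurableSet_lt measurable_const (by fun_prop))]
    congr 2
    funext x
    simp only [K, indicator, mem_ofPred_eq]
    split_ifs <;> ring
  have hpi : ‖(-(1 / (Real.pi : ℂ)))‖ₑ ≤ 1 := by
    rw [← ofReal_norm, norm_neg, norm_div, norm_one, Complex.norm_real,
      Real.norm_of_nonneg Real.pi_pos.le, ENNReal.ofReal_le_one]
    rw [div_le_one Real.pi_pos]
    linarith [Real.pi_gt_three]
  have hpt : ∀ z, ‖truncatedBeurling h 1 z‖ₑ ^ 2 ≤ 2 * ‖∫ x, K (z - x) * h x‖ₑ ^ 2 +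
      2 * ‖∫ x, beurlingReg (z - x) * h x‖ₑ ^ 2 := by
    intro z
    have h1 : ‖truncatedBeurling h 1 z‖ₑ ≤
        ‖∫ x, K (z - x) * h x‖ₑ + ‖∫ x, beurlingReg (z - x) * h x‖ₑ := by
      rw [hsplit, enorm_mul]
      calc _ ≤ 1 * ‖(∫ x, K (z - x) * h x) - ∫ x, beurlingReg (z - x) * h x‖ₑ := by gcongr
        _ ≤ _ := by rw [one_mul]; exact enorm_sub_le
    refine (pow_le_pow_left' h1 2).trans ?_
    rw [← mul_add]
    have := ENNReal.rpow_add_le_mul_rpow_add_rpow ‖∫ x, K (z - x) * h x‖ₑ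
      ‖∫ x, beurlingReg (z - x) * h x‖ₑ (p := 2) (by norm_num)
    norm_num at this
    simpa using this
  have hmeas : ∀ k : ℂ → ℂ, Measurable k →
      Measurable (fun z => ‖∫ x, k (z - x) * h x‖ₑ ^ 2) := by
    intro k hk
    have : StronglyMeasurable (fun z => ∫ x, k (z - x) * h x) := by
      apply StronglyMeasurable.integral_prod_right (f := fun z x => k (z - x) * h x)
      apply Measurable.stronglyMeasurable
      fun_prop
    exact this.measurable.enorm.pow_const 2
  refine (lintegral_mono hpt).trans ?_
  rw [lintegral_add_left ((hmeas K hKm).const_mul 2), lintegral_const_mul _ (hmeas K hKm),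
    lintegral_const_mul _ (hmeas _ continuous_beurlingReg.measurable)]
  calc _ ≤ 2 * ((4 * P) ^ 2 * ∫⁻ x, ‖h x‖ₑ ^ 2) + 2 * (P ^ 2 * ∫⁻ x, ‖h x‖ₑ ^ 2) := by gcongr
    _ = _ := by ring

/-- The truncated transforms are bounded on `L²`, uniformly in the truncation. -/
theorem exists_lintegral_sq_truncatedBeurling_le :
    ∃ C : ℝ≥0, ∀ h : ℂ → ℂ, Measurable h → ∀ N R : ℝ, (∀ x, ‖h x‖ ≤ N) →
      (∀ x, h x ≠ 0 → ‖x‖ ≤ R) → ∀ δ : ℝ, 0 < δ →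
      ∫⁻ z, ‖truncatedBeurling h δ z‖ₑ ^ 2 ≤ C * ∫⁻ x, ‖h x‖ₑ ^ 2 := by
  obtain ⟨C, hC⟩ := exists_lintegral_sq_truncatedBeurling_one_le
  refine ⟨C, fun h hh N R hN hR δ hδ => ?_⟩
  have hδ0 : δ ≠ 0 := hδ.ne'
  have hscale : ∀ f : ℂ → ℝ≥0∞, ∫⁻ z, f (δ • z) = ENNReal.ofReal ((δ ^ 2)⁻¹) * ∫⁻ z, f z := by
    intro f
    have h1 := Measure.map_addHaar_smul (volume : Measure ℂ) hδ0
    rw [Complex.finrank_real_complex] at h1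
    have h2 : ∫⁻ z, f z ∂(Measure.map (δ • ·) (volume : Measure ℂ)) = ∫⁻ z, f (δ • z) :=
      (Homeomorph.smulOfNeZero δ hδ0).measurableEmbedding.lintegral_map f
    rw [← h2, h1, lintegral_smul_measure, abs_of_nonneg (by positivity), smul_eq_mul]
  have hT : ∀ z, truncatedBeurling h δ (δ • z) = truncatedBeurling (fun x => h (δ • x)) 1 z := by
    intro z
    unfold truncatedBeurling
    congr 1
    have hm : ∀ δ : ℝ, MeasurableSet {w : ℂ | δ < ‖w‖} := fun δ =>
      measurableSet_lt measurable_const measurable_norm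
    rw [← integral_indicator (hm δ), ← integral_indicator (hm 1)]
    have := Measure.integral_comp_smul (volume : Measure ℂ)
      ({w : ℂ | δ < ‖w‖}.indicator fun w => h (δ • z - w) * (1 / w ^ 2)) δ
    rw [Complex.finrank_real_complex, abs_of_nonneg (by positivity)] at this
    have h3 : ∀ w : ℂ, {w : ℂ | δ < ‖w‖}.indicator (fun w => h (δ • z - w) * (1 / w ^ 2)) (δ • w) =
        (δ ^ 2)⁻¹ • {w : ℂ | 1 < ‖w‖}.indicator (fun w => h (δ • (z - w)) * (1 / w ^ 2)) w := by
      intro w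
      have hiff : δ < ‖δ • w‖ ↔ 1 < ‖w‖ := by
        rw [norm_smul, Real.norm_of_nonneg hδ.le]
        exact lt_mul_iff_one_lt_right hδ
      simp only [indicator, mem_ofPred_eq, hiff]
      split_ifs
      · rw [← smul_sub, Complex.real_smul, Complex.real_smul, Complex.real_smul]
        push_cast
        rw [mul_pow]
        have : (δ : ℂ) ≠ 0 := by exact_mod_cast hδ0
        by_cases hw : w = 0
        · simp [hw]
        field_simp
      · simp
    simp only [h3] at this
    rw [integral_smul] at this
    exact (smul_right_injective ℂ (r := (δ ^ 2)⁻¹) (by positivity) this).symm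
  have h1 := hC (fun x => h (δ • x)) (by fun_prop) N (R / δ) (fun x => hN _) (fun x hx => by
    have := hR _ hx
    rw [norm_smul, Real.norm_of_nonneg hδ.le] at this
    rwa [le_div_iff₀' hδ])
  simp only [← hT] at h1
  rw [hscale (fun z => ‖truncatedBeurling h δ z‖ₑ ^ 2), hscale (fun z => ‖h z‖ₑ ^ 2),
    mul_left_comm] at h1
  rwa [ENNReal.mul_le_mul_iff_right (by simpa using hδ0) (by finiteness)] at h1

/-! ### Square-integrable oscillation -/

theorem volume_closedBall_eq (z : ℂ) {r : ℝ} (hr : 0 ≤ r) :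
    volume (Metric.closedBall z r) = ENNReal.ofReal (Real.pi * r ^ 2) := by
  rw [Complex.volume_closedBall, ENNReal.ofReal_mul Real.pi_pos.le, ENNReal.ofReal_pow hr, mul_comm]
  congr 1
  rw [← NNReal.coe_real_pi, ENNReal.ofReal_coe_nnreal]

theorem volume_closedBall_le (z : ℂ) {r : ℝ} (hr : 0 ≤ r) :
    volume (Metric.closedBall z r) ≤ ENNReal.ofReal (4 * r ^ 2) := by
  rw [volume_closedBall_eq z hr]
  apply ENNReal.ofReal_le_ofReal
  gcongr
  exact Real.pi_le_four

/-- Two constants which approximate the same function in the mean are close to each other. -/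
theorem norm_sub_le_of_lintegral_le {g : ℂ → ℂ} {S : Set ℂ}
    (hg : AEMeasurable g (volume.restrict S)) {V X Y : ℝ}
    (hV : 0 < V) (hX : 0 ≤ X) (hY : 0 ≤ Y) (hS : ENNReal.ofReal V ≤ volume S) {c c' : ℂ}
    (hc : ∫⁻ x in S, ‖g x - c‖ₑ ≤ ENNReal.ofReal X)
    (hc' : ∫⁻ x in S, ‖g x - c'‖ₑ ≤ ENNReal.ofReal Y) : ‖c - c'‖ ≤ (X + Y) / V := by
  have h1 : ENNReal.ofReal (‖c - c'‖ * V) ≤ ENNReal.ofReal (X + Y) := by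
    calc ENNReal.ofReal (‖c - c'‖ * V) = ‖c - c'‖ₑ * ENNReal.ofReal V := by
          rw [ENNReal.ofReal_mul (norm_nonneg _), ofReal_norm]
      _ ≤ ‖c - c'‖ₑ * volume S := by gcongr
      _ = ∫⁻ _ in S, ‖c - c'‖ₑ := by rw [setLIntegral_const]
      _ ≤ ∫⁻ x in S, (‖g x - c‖ₑ + ‖g x - c'‖ₑ) := by
          refine lintegral_mono fun x => ?_
          have : c - c' = (g x - c') - (g x - c) := by ring
          rw [this, add_comm]
          exact enorm_sub_le
      _ = (∫⁻ x in S, ‖g x - c‖ₑ) + ∫⁻ x in S, ‖g x - c'‖ₑ :=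
          lintegral_add_left' (hg.sub_const c).enorm _
      _ ≤ ENNReal.ofReal X + ENNReal.ofReal Y := add_le_add hc hc'
      _ = _ := (ENNReal.ofReal_add hX hY).symm
  rw [ENNReal.ofReal_le_ofReal_iff (by positivity)] at h1
  rwa [le_div_iff₀ hV]

theorem enorm_sub_sq_le (a b c : ℂ) : ‖a - b‖ₑ ^ 2 ≤ 2 * ‖a - c‖ₑ ^ 2 + 2 * ‖c - b‖ₑ ^ 2 := by
  have h1 : ‖a - b‖ₑ ≤ ‖a - c‖ₑ + ‖c - b‖ₑ := by
    have : a - b = (a - c) + (c - b) := by ring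
    rw [this]
    exact enorm_add_le _ _
  refine (pow_le_pow_left' h1 2).trans ?_
  rw [← mul_add]
  have := ENNReal.rpow_add_le_mul_rpow_add_rpow ‖a - c‖ₑ ‖c - b‖ₑ (p := 2) (by norm_num)
  norm_num at this
  simpa using this

/-- The balls with centres in `Ω` and radii up to `D` meet `Ω` in a fixed fraction of their
area. -/
def HasDensity (Ω : Set ℂ) (κ D : ℝ) : Prop :=
  ∀ z ∈ Ω, ∀ ρ : ℝ, 0 < ρ → ρ ≤ D →
    ENNReal.ofReal (κ * ρ ^ 2) ≤ volume (Metric.closedBall z ρ ∩ Ω)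

/-- The square-integrable oscillation of `g` on balls of radius at most `r₀`, about constants
adapted to `g` at the scale `a`, is at most `A`. -/
def SqOscBound (Ω : Set ℂ) (g : ℂ → ℂ) (N a r₀ A : ℝ) : Prop :=
  ∀ z ∈ Ω, ∀ ρ : ℝ, 0 < ρ → ρ ≤ r₀ → ∀ c : ℂ, ‖c‖ ≤ N →
    ∫⁻ x in Metric.closedBall z (2 * ρ) ∩ Ω, ‖g x - c‖ₑ ≤ ENNReal.ofReal (4 * a * ρ ^ 2) →
    ∫⁻ x in Metric.closedBall z ρ ∩ Ω, ‖g x - c‖ₑ ^ 2 ≤ ENNReal.ofReal (A * ρ ^ 2)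

/-- Lebesgue differentiation: small means at all dyadic scales bound the function. -/
theorem lebesgue_le_of_forall_le {Ω : Set ℂ} {G : ℂ → ℝ≥0∞} (hΩ : MeasurableSet Ω)
    (hG : Measurable G) {z : ℂ} {ρ : ℝ} (hρ : 0 < ρ) {b : ℝ} (hb : 0 ≤ b)
    (hfin : ∫⁻ x in Metric.closedBall z (2 * ρ) ∩ Ω, G x ≠ ∞) :
    ∀ᵐ x : ℂ, x ∈ Metric.closedBall z ρ ∩ Ω →
      (∀ k : ℕ, ∫⁻ y in Metric.closedBall x ((1 / 2) ^ k * ρ) ∩ Ω, G y ≤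
        ENNReal.ofReal (b * ((1 / 2) ^ k * ρ) ^ 2)) → G x ≤ ENNReal.ofReal b := by
  set S := Metric.closedBall z (2 * ρ) ∩ Ω with hS
  have hSm : MeasurableSet S := measurableSet_closedBall.inter hΩ
  have hfin' : ∫⁻ x, S.indicator G x ≠ ∞ := by rwa [lintegral_indicator hSm]
  filter_upwards [(Besicovitch.vitaliFamily (volume : Measure ℂ)).ae_tendsto_lintegral_div
    (hG.indicator hSm).aemeasurable hfin'] with x hx hxB hall
  have hxS : x ∈ S := ⟨Metric.closedBall_subset_closedBall (by linarith) hxB.1, hxB.2⟩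
  rw [indicator_of_mem hxS] at hx
  have hr : Tendsto (fun k : ℕ => (1 / 2 : ℝ) ^ k * ρ) atTop (𝓝[>] 0) := by
    rw [tendsto_nhdsWithin_iff]
    refine ⟨?_, Eventually.of_forall fun k => by simp only [mem_Ioi]; positivity⟩
    simpa using (tendsto_pow_atTop_nhds_zero_of_lt_one (r := (1 / 2 : ℝ)) (by norm_num)
      (by norm_num)).mul_const ρ
  have h1 := hx.comp ((Besicovitch.tendsto_filterAt volume x).comp hr)
  refine le_of_tendsto h1 (Eventually.of_forall fun k => ?_)
  simp only [Function.comp_apply]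
  have hrk : 0 < (1 / 2 : ℝ) ^ k * ρ := by positivity
  refine ENNReal.div_le_of_le_mul ?_
  calc ∫⁻ y in Metric.closedBall x ((1 / 2) ^ k * ρ), S.indicator G y
      ≤ ∫⁻ y in Metric.closedBall x ((1 / 2) ^ k * ρ), Ω.indicator G y := by
        refine lintegral_mono fun y => ?_
        exact indicator_le_indicator_of_subset inter_subset_right (fun _ => zero_le) y
    _ = ∫⁻ y in Metric.closedBall x ((1 / 2) ^ k * ρ) ∩ Ω, G y := by
        rw [lintegral_indicator hΩ, Measure.restrict_restrict hΩ, inter_comm]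
    _ ≤ _ := hall k
    _ ≤ _ := by
        rw [volume_closedBall_eq _ hrk.le, ← ENNReal.ofReal_mul hb]
        apply ENNReal.ofReal_le_ofReal
        gcongr
        have := Real.pi_gt_three
        nlinarith [sq_nonneg ((1 / 2 : ℝ) ^ k * ρ)]

/-- One step of the John–Nirenberg argument: a stopping-time selection of disjoint balls, on which
the oscillation is large, halves the bound up to an additive constant. -/
theorem SqOscBound.improve {Ω : Set ℂ} (hΩ : MeasurableSet Ω) {κ D : ℝ} (hκ : 0 < κ)
    (hdens : HasDensity Ω κ D) {g : ℂ → ℂ} (hg : Measurable g) {N a r₀ A : ℝ}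
    (ha : 0 < a) (hA : 0 ≤ A) (hr₀ : r₀ ≤ D)
    (hosc : ∀ z ∈ Ω, ∀ ρ : ℝ, 0 < ρ → ρ ≤ 2 * r₀ → ∃ c : ℂ, ‖c‖ ≤ N ∧
      ∫⁻ x in Metric.closedBall z ρ ∩ Ω, ‖g x - c‖ₑ ≤ ENNReal.ofReal (a * ρ ^ 2))
    (h : SqOscBound Ω g N a r₀ A) :
    SqOscBound Ω g N a r₀ (A / 2 + (4 * 256 ^ 2 + 2 * (260 / κ) ^ 2) * a ^ 2) := by
  intro z hz ρ hρ hρr c hcN hc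
  set G : ℂ → ℝ≥0∞ := fun x => ‖g x - c‖ₑ with hG
  have hGm : Measurable G := by fun_prop
  have hposk : ∀ k : ℕ, 0 < (1 / 2 : ℝ) ^ k * ρ := fun k => by positivity
  let bad : ℂ → ℕ → Prop := fun x k => ENNReal.ofReal (256 * a * ((1 / 2) ^ k * ρ) ^ 2) <
    ∫⁻ y in Metric.closedBall x ((1 / 2) ^ k * ρ) ∩ Ω, G y
  let E : Set ℂ := {x | x ∈ Metric.closedBall z ρ ∩ Ω ∧ ∃ k, bad x k}
  -- `k x` selects the largest bad radius at `x`
  classical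
  have hfirst : ∀ x, ∃ k, x ∈ E → bad x k ∧ ∀ j < k, ¬ bad x j := by
    intro x
    by_cases hx : x ∈ E
    · exact ⟨Nat.find hx.2, fun _ => ⟨Nat.find_spec hx.2, fun j hj => Nat.find_min hx.2 hj⟩⟩
    · exact ⟨0, fun h => absurd h hx⟩
  choose k hk using hfirst
  have hsub2 : ∀ x ∈ E, ∀ j : ℕ, Metric.closedBall x ((1 / 2) ^ j * ρ) ∩ Ω ⊆
      Metric.closedBall z (2 * ρ) ∩ Ω := by
    intro x hx j
    apply inter_subset_inter_left
    apply Metric.closedBall_subset_closedBall'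
    have h1 : dist x z ≤ ρ := hx.1.1
    have h2 : (1 / 2 : ℝ) ^ j ≤ 1 := pow_le_one₀ (by norm_num) (by norm_num)
    nlinarith
  -- the threshold `256` exceeds `4 * 4 ^ 2`, so that the three largest radii are never bad, and
  -- the fourfold enlargement of a selected disc is still good
  have hk3 : ∀ x ∈ E, 3 ≤ k x := by
    intro x hx
    by_contra hlt
    have hb := (hk x hx).1
    have h1 : (1 / 4 : ℝ) ≤ (1 / 2) ^ k x := by
      calc (1 / 4 : ℝ) = (1 / 2) ^ 2 := by norm_num
        _ ≤ _ := pow_le_pow_of_le_one (by norm_num) (by norm_num) (by omega)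
    have h2 := hb.trans_le ((lintegral_mono_set (hsub2 x hx (k x))).trans hc)
    rw [ENNReal.ofReal_lt_ofReal_iff (by positivity)] at h2
    have h3 : (1 / 4 * ρ) ^ 2 ≤ ((1 / 2) ^ k x * ρ) ^ 2 := by gcongr
    have h4 : 0 < a * ρ ^ 2 := by positivity
    nlinarith
  let r : ℂ → ℝ := fun x => (1 / 2) ^ k x * ρ
  have hrpos : ∀ x, 0 < r x := fun x => hposk _
  have hr8 : ∀ x ∈ E, 8 * r x ≤ ρ := by
    intro x hx
    have h1 : (1 / 2 : ℝ) ^ k x ≤ 1 / 8 := by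
      calc (1 / 2 : ℝ) ^ k x ≤ (1 / 2) ^ 3 :=
            pow_le_pow_of_le_one (by norm_num) (by norm_num) (hk3 x hx)
        _ = _ := by norm_num
    simp only [r]
    nlinarith
  have h4r : ∀ x ∈ E, ∫⁻ y in Metric.closedBall x (4 * r x) ∩ Ω, G y ≤
      ENNReal.ofReal (256 * a * (4 * r x) ^ 2) := by
    intro x hx
    have h3 := hk3 x hx
    have h1 := (hk x hx).2 (k x - 2) (by omega)
    have h2 : (1 / 2 : ℝ) ^ (k x - 2) * ρ = 4 * r x := by
      simp only [r]
      obtain ⟨m, hm⟩ := Nat.exists_eq_add_of_le h3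
      rw [hm, show 3 + m - 2 = m + 1 by omega]
      ring
    simp only [bad, h2, not_lt] at h1
    exact h1
  obtain ⟨u, huE, hudisj, hucov⟩ :=
    Vitali.exists_disjoint_subfamily_covering_enlargement_closedBall E (fun x => x) r ρ
      (fun x hx => by have := hr8 x hx; have := hrpos x; linarith) 4 (by norm_num)
  have hucount : u.Countable := by
    refine hudisj.countable_of_nonempty_interior fun x hx => ?_
    rw [interior_closedBall _ (hrpos x).ne']
    exact Metric.nonempty_ball.2 (hrpos x)
  have : Countable u := hucount.to_subtype
  -- the selected balls have small total area
  have hsumr : ∑' b : u, ENNReal.ofReal (r b ^ 2) ≤ ENNReal.ofReal (ρ ^ 2 / 64) := by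
    have h1 : ∑' b : u, ENNReal.ofReal (256 * a) * ENNReal.ofReal (r b ^ 2) ≤
        ENNReal.ofReal (4 * a * ρ ^ 2) := by
      calc ∑' b : u, ENNReal.ofReal (256 * a) * ENNReal.ofReal (r b ^ 2)
          ≤ ∑' b : u, ∫⁻ y in Metric.closedBall (b : ℂ) (r b) ∩ Ω, G y := by
            refine ENNReal.tsum_le_tsum fun b => ?_
            rw [← ENNReal.ofReal_mul (by positivity)]
            exact (hk b (huE b.2)).1.le
        _ = ∫⁻ y in ⋃ b : u, Metric.closedBall (b : ℂ) (r b) ∩ Ω, G y := by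
            rw [lintegral_iUnion (fun b => measurableSet_closedBall.inter hΩ)]
            intro b b' hbb'
            refine Disjoint.mono inter_subset_left inter_subset_left ?_
            exact hudisj b.2 b'.2 (fun h => hbb' (Subtype.ext h))
        _ ≤ ∫⁻ y in Metric.closedBall z (2 * ρ) ∩ Ω, G y :=
            lintegral_mono_set (iUnion_subset fun b => hsub2 b (huE b.2) (k b))
        _ ≤ _ := hc
    rw [ENNReal.tsum_mul_left] at h1
    have h2 : ENNReal.ofReal (4 * a * ρ ^ 2) =
        ENNReal.ofReal (256 * a) * ENNReal.ofReal (ρ ^ 2 / 64) := by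
      rw [← ENNReal.ofReal_mul (by positivity)]
      congr 1
      ring
    rw [h2] at h1
    rwa [ENNReal.mul_le_mul_iff_right (by simpa using ha) (by finiteness)] at h1
  set U : Set ℂ := ⋃ b : u, Metric.closedBall (b : ℂ) (4 * r b) ∩ Ω with hU
  have hUm : MeasurableSet U := MeasurableSet.iUnion fun b => measurableSet_closedBall.inter hΩ
  have hEU : E ⊆ U := by
    intro x hx
    obtain ⟨b, hb, hxb⟩ := hucov x hx
    exact mem_iUnion.2 ⟨⟨b, hb⟩, hxb (Metric.mem_closedBall_self (hrpos x).le), hx.1.2⟩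
  -- off the selected balls `G` is bounded
  have hgood : ∫⁻ x in (Metric.closedBall z ρ ∩ Ω) \ U, G x ^ 2 ≤
      ENNReal.ofReal (4 * 256 ^ 2 * a ^ 2 * ρ ^ 2) := by
    have hae := lebesgue_le_of_forall_le hΩ hGm hρ (b := 256 * a) (by positivity)
      (ne_top_of_le_ne_top ENNReal.ofReal_ne_top hc)
    calc ∫⁻ x in (Metric.closedBall z ρ ∩ Ω) \ U, G x ^ 2
        ≤ ∫⁻ x in (Metric.closedBall z ρ ∩ Ω) \ U, ENNReal.ofReal (256 * a) ^ 2 := by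
          refine setLIntegral_mono_ae measurable_const.aemeasurable ?_
          filter_upwards [hae] with x hx hxm
          refine pow_le_pow_left' (hx hxm.1 fun j => ?_) 2
          by_contra hbad
          exact hxm.2 (hEU ⟨hxm.1, j, not_le.1 hbad⟩)
      _ ≤ ENNReal.ofReal (256 * a) ^ 2 * volume (Metric.closedBall z ρ) := by
          rw [setLIntegral_const]
          gcongr
          exact sdiff_subset.trans inter_subset_left
      _ ≤ ENNReal.ofReal ((256 * a) ^ 2) * ENNReal.ofReal (4 * ρ ^ 2) := by
          rw [ENNReal.ofReal_pow (by positivity)]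
          gcongr
          exact volume_closedBall_le z hρ.le
      _ = _ := by
          rw [← ENNReal.ofReal_mul (by positivity)]
          congr 1
          ring
  have hball : ∀ b ∈ E, ∫⁻ x in Metric.closedBall b (4 * r b) ∩ Ω, G x ^ 2 ≤
      ENNReal.ofReal (32 * A + 128 * (260 / κ) ^ 2 * a ^ 2) * ENNReal.ofReal (r b ^ 2) := by
    intro b hb
    have hrb := hrpos b
    have hr8b := hr8 b hb
    obtain ⟨c', hc'N, hc'⟩ := hosc b hb.1.2 (2 * (4 * r b)) (by positivity) (by linarith)
    have h1 := h b hb.1.2 (4 * r b) (by positivity) (by linarith) c' hc'N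
      (hc'.trans (ENNReal.ofReal_le_ofReal (by nlinarith)))
    have h2 : ∫⁻ x in Metric.closedBall b (4 * r b) ∩ Ω, ‖g x - c'‖ₑ ≤
        ENNReal.ofReal (4 * a * (4 * r b) ^ 2) := by
      refine (lintegral_mono_set (inter_subset_inter_left _
        (Metric.closedBall_subset_closedBall (by linarith)))).trans (hc'.trans ?_)
      exact ENNReal.ofReal_le_ofReal (by nlinarith)
    have h3 := norm_sub_le_of_lintegral_le hg.aemeasurable (V := κ * (4 * r b) ^ 2) (by positivity)
      (by positivity) (by positivity)
      (hdens b hb.1.2 (4 * r b) (by positivity) (by linarith)) h2 (h4r b hb)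
    have h4 : (4 * a * (4 * r b) ^ 2 + 256 * a * (4 * r b) ^ 2) / (κ * (4 * r b) ^ 2) =
        260 / κ * a := by
      field_simp
      ring
    rw [h4] at h3
    have h5 : ‖c' - c‖ₑ ^ 2 ≤ ENNReal.ofReal ((260 / κ * a) ^ 2) := by
      rw [← ofReal_norm, ← ENNReal.ofReal_pow (norm_nonneg _)]
      apply ENNReal.ofReal_le_ofReal
      gcongr
    calc ∫⁻ x in Metric.closedBall b (4 * r b) ∩ Ω, G x ^ 2
        ≤ ∫⁻ x in Metric.closedBall b (4 * r b) ∩ Ω, (2 * ‖g x - c'‖ₑ ^ 2 + 2 * ‖c' - c‖ₑ ^ 2) :=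
          lintegral_mono fun x => enorm_sub_sq_le _ _ _
      _ = 2 * (∫⁻ x in Metric.closedBall b (4 * r b) ∩ Ω, ‖g x - c'‖ₑ ^ 2) +
          2 * ‖c' - c‖ₑ ^ 2 * volume (Metric.closedBall b (4 * r b) ∩ Ω) := by
          rw [lintegral_add_right _ measurable_const, lintegral_const_mul _ (by fun_prop),
            setLIntegral_const]
      _ ≤ 2 * ENNReal.ofReal (A * (4 * r b) ^ 2) +
          2 * ENNReal.ofReal ((260 / κ * a) ^ 2) * ENNReal.ofReal (4 * (4 * r b) ^ 2) := by
          gcongr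
          exact (measure_mono inter_subset_left).trans (volume_closedBall_le b (by positivity))
      _ = _ := by
          rw [← ENNReal.ofReal_ofNat 2, ← ENNReal.ofReal_mul (by norm_num),
            ← ENNReal.ofReal_mul (by norm_num), ← ENNReal.ofReal_mul (by positivity),
            ← ENNReal.ofReal_add (by positivity) (by positivity),
            ← ENNReal.ofReal_mul (by positivity)]
          congr 1
          ring
  have hbadint : ∫⁻ x in U, G x ^ 2 ≤
      ENNReal.ofReal ((A / 2 + 2 * (260 / κ) ^ 2 * a ^ 2) * ρ ^ 2) := by
    calc ∫⁻ x in U, G x ^ 2 ≤ ∑' b : u, ∫⁻ x in Metric.closedBall (b : ℂ) (4 * r b) ∩ Ω, G x ^ 2 :=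
          lintegral_iUnion_le _ _
      _ ≤ ∑' b : u, ENNReal.ofReal (32 * A + 128 * (260 / κ) ^ 2 * a ^ 2) *
            ENNReal.ofReal (r b ^ 2) := ENNReal.tsum_le_tsum fun b => hball b (huE b.2)
      _ ≤ ENNReal.ofReal (32 * A + 128 * (260 / κ) ^ 2 * a ^ 2) * ENNReal.ofReal (ρ ^ 2 / 64) := by
          rw [ENNReal.tsum_mul_left]
          gcongr
      _ = _ := by
          rw [← ENNReal.ofReal_mul (by positivity)]
          congr 1
          ring
  calc ∫⁻ x in Metric.closedBall z ρ ∩ Ω, G x ^ 2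
      ≤ ∫⁻ x in ((Metric.closedBall z ρ ∩ Ω) \ U) ∪ U, G x ^ 2 :=
        lintegral_mono_set (by rw [sdiff_union_self]; exact subset_union_left)
    _ ≤ _ := lintegral_union_le _ _ _
    _ ≤ _ := add_le_add hgood hbadint
    _ = _ := by
        rw [← ENNReal.ofReal_add (by positivity) (by positivity)]
        congr 1
        ring

/-- The John–Nirenberg inequality, in its square-integrable form. The boundedness of `g` only
serves to start the iteration and does not enter the constant. -/
theorem exists_sqOscBound {Ω : Set ℂ} (hΩ : MeasurableSet Ω) {κ D : ℝ} (hκ : 0 < κ)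
    (hdens : HasDensity Ω κ D) :
    ∃ C : ℝ, 0 < C ∧ ∀ g : ℂ → ℂ, Measurable g → ∀ N a r₀ : ℝ, 0 ≤ a → r₀ ≤ D →
      (∀ x, ‖g x‖ ≤ N) →
      (∀ z ∈ Ω, ∀ ρ : ℝ, 0 < ρ → ρ ≤ 2 * r₀ → ∃ c : ℂ, ‖c‖ ≤ N ∧
        ∫⁻ x in Metric.closedBall z ρ ∩ Ω, ‖g x - c‖ₑ ≤ ENNReal.ofReal (a * ρ ^ 2)) →
      SqOscBound Ω g N a r₀ (C * a ^ 2) := by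
  set K : ℝ := 4 * 256 ^ 2 + 2 * (260 / κ) ^ 2 with hK
  have hK0 : 0 < K := by positivity
  suffices hpos : ∀ g : ℂ → ℂ, Measurable g → ∀ N a r₀ : ℝ, 0 < a → r₀ ≤ D →
      (∀ x, ‖g x‖ ≤ N) →
      (∀ z ∈ Ω, ∀ ρ : ℝ, 0 < ρ → ρ ≤ 2 * r₀ → ∃ c : ℂ, ‖c‖ ≤ N ∧
        ∫⁻ x in Metric.closedBall z ρ ∩ Ω, ‖g x - c‖ₑ ≤ ENNReal.ofReal (a * ρ ^ 2)) →
      SqOscBound Ω g N a r₀ (3 * K * a ^ 2) by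
    refine ⟨3 * K, by positivity, fun g hg N a r₀ ha hr₀ hN hosc z hz ρ hρ hρr c hcN hc => ?_⟩
    have hlim : Tendsto (fun e : ℝ => ENNReal.ofReal (3 * K * (a + e) ^ 2 * ρ ^ 2)) (𝓝[>] 0)
        (𝓝 (ENNReal.ofReal (3 * K * a ^ 2 * ρ ^ 2))) := by
      have h : Continuous fun e : ℝ => ENNReal.ofReal (3 * K * (a + e) ^ 2 * ρ ^ 2) :=
        ENNReal.continuous_ofReal.comp (by fun_prop)
      simpa using (h.tendsto 0).mono_left nhdsWithin_le_nhds
    refine ge_of_tendsto hlim ?_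
    filter_upwards [self_mem_nhdsWithin] with e he
    have he0 : 0 < e := he
    refine hpos g hg N (a + e) r₀ (by positivity) hr₀ hN (fun z hz ρ hρ hρr => ?_) z hz ρ hρ hρr c
      hcN (hc.trans (ENNReal.ofReal_le_ofReal (by gcongr; linarith)))
    obtain ⟨c, hcN, hc⟩ := hosc z hz ρ hρ hρr
    exact ⟨c, hcN, hc.trans (ENNReal.ofReal_le_ofReal (by gcongr; linarith))⟩
  intro g hg N a r₀ ha hr₀ hN hosc
  have hN0 : 0 ≤ N := (norm_nonneg _).trans (hN 0)
  have hstart : SqOscBound Ω g N a r₀ (16 * N ^ 2) := by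
    intro z hz ρ hρ hρr c hcN _
    calc ∫⁻ x in Metric.closedBall z ρ ∩ Ω, ‖g x - c‖ₑ ^ 2
        ≤ ∫⁻ x in Metric.closedBall z ρ ∩ Ω, ENNReal.ofReal ((2 * N) ^ 2) := by
          refine lintegral_mono fun x => ?_
          rw [← ofReal_norm, ← ENNReal.ofReal_pow (norm_nonneg _)]
          apply ENNReal.ofReal_le_ofReal
          gcongr
          exact (norm_sub_le _ _).trans (by linarith [hN x])
      _ ≤ ENNReal.ofReal ((2 * N) ^ 2) * ENNReal.ofReal (4 * ρ ^ 2) := by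
          rw [setLIntegral_const]
          gcongr
          exact (measure_mono inter_subset_left).trans (volume_closedBall_le z hρ.le)
      _ = _ := by
          rw [← ENNReal.ofReal_mul (by positivity)]
          congr 1
          ring
  have hiter : ∀ n : ℕ, SqOscBound Ω g N a r₀ ((1 / 2) ^ n * (16 * N ^ 2) + 2 * (K * a ^ 2)) := by
    intro n
    induction n with
    | zero =>
      intro z hz ρ hρ hρr c hcN hc
      refine (hstart z hz ρ hρ hρr c hcN hc).trans (ENNReal.ofReal_le_ofReal ?_)
      have : 0 < K * a ^ 2 := by positivity
      gcongr
      rw [pow_zero, one_mul]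
      linarith
    | succ n ih =>
      have := ih.improve hΩ hκ hdens hg ha (by positivity) hr₀ hosc
      convert this using 1
      rw [← hK]
      ring
  obtain ⟨n, hn⟩ := exists_pow_lt_of_lt_one (x := K * a ^ 2 / (16 * N ^ 2 + 1)) (y := (1 / 2 : ℝ))
    (by positivity) (by norm_num)
  rw [lt_div_iff₀ (by positivity)] at hn
  intro z hz ρ hρ hρr c hcN hc
  refine (hiter n z hz ρ hρ hρr c hcN hc).trans (ENNReal.ofReal_le_ofReal ?_)
  gcongr
  have : 0 < (1 / 2 : ℝ) ^ n := by positivity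
  nlinarith

/-! ### Principal values -/

/-- A bounded function supported in `Ω`, defined everywhere, whose mean oscillation over the
discs centred in `Ω` is controlled by `A ω`. -/
structure OscData (ω : ℝ → ℝ) (Ω : Set ℂ) (g : ℂ → ℂ) (N A : ℝ) : Prop where
  measurable : Measurable g
  bound : ∀ x, ‖g x‖ ≤ N
  supp : ∀ x, x ∉ Ω → g x = 0
  nonneg : 0 ≤ A
  osc : ∀ z ∈ Ω, ∀ r : ℝ, 0 < r → ∃ c : ℂ, ‖c‖ ≤ N ∧
    ∫⁻ x in Metric.closedBall z r ∩ Ω, ‖g x - c‖ₑ ≤ ENNReal.ofReal (A * ω r * r ^ 2)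

theorem OscData.integrable {ω : ℝ → ℝ} {Ω : Set ℂ} {g : ℂ → ℂ} {N A : ℝ}
    (h : OscData ω Ω g N A) (hΩ : Bornology.IsBounded Ω) : Integrable g := by
  obtain ⟨R, hR⟩ := hΩ.subset_closedBall 0
  have : Integrable ((Metric.closedBall (0 : ℂ) R).indicator fun _ => N) :=
    (integrable_indicator_iff measurableSet_closedBall).2
      (integrableOn_const (measure_closedBall_lt_top.ne))
  refine this.mono' h.measurable.aestronglyMeasurable (Eventually.of_forall fun x => ?_)
  by_cases hx : x ∈ Ω
  · rw [indicator_of_mem (hR hx)]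
    exact h.bound x
  · rw [h.supp x hx, norm_zero]
    exact indicator_nonneg (fun _ _ => (norm_nonneg _).trans (h.bound 0)) _

theorem oscData_indicator_one {ω : ℝ → ℝ} {Ω : Set ℂ} (hΩ : MeasurableSet Ω) :
    OscData ω Ω (Ω.indicator fun _ => (1 : ℂ)) 1 0 where
  measurable := measurable_const.indicator hΩ
  bound x := by
    by_cases hx : x ∈ Ω <;> simp [hx]
  supp x hx := indicator_of_notMem hx _
  nonneg := le_rfl
  osc z _ r _ := by
    refine ⟨1, by simp, ?_⟩
    rw [zero_mul, zero_mul, ENNReal.ofReal_zero, nonpos_iff_eq_zero,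
      setLIntegral_congr_fun (g := fun _ => 0) (measurableSet_closedBall.inter hΩ)
        (fun x hx => by simp [indicator_of_mem hx.2])]
    simp

theorem measurableSet_lt_norm_sub (z : ℂ) (δ : ℝ) : MeasurableSet {u : ℂ | δ < ‖z - u‖} :=
  measurableSet_lt measurable_const (measurable_const.sub measurable_id).norm

theorem measurableSet_annulus (z : ℂ) (δ' δ : ℝ) :
    MeasurableSet {u : ℂ | δ' < ‖z - u‖ ∧ ‖z - u‖ ≤ δ} :=
  (measurableSet_lt_norm_sub z δ').inter
    (measurableSet_le (measurable_const.sub measurable_id).norm measurable_const)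

theorem integrableOn_mul_inv_sq {g : ℂ → ℂ} (hg : Integrable g) (z : ℂ) {δ : ℝ} (hδ : 0 < δ) :
    IntegrableOn (fun u => g u * (1 / (z - u) ^ 2)) {u : ℂ | δ < ‖z - u‖} := by
  have hm : Measurable fun u : ℂ => 1 / (z - u) ^ 2 := by fun_prop
  refine hg.integrableOn.mul_bdd (c := 1 / δ ^ 2) hm.aestronglyMeasurable ?_
  refine (ae_restrict_iff' (measurableSet_lt_norm_sub z δ)).2 (Eventually.of_forall fun u hu => ?_)
  rw [norm_div, norm_one, norm_pow]
  have : δ < ‖z - u‖ := hu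
  gcongr

theorem integrableOn_annulus_inv_sq (z : ℂ) {δ' δ : ℝ} (hδ' : 0 < δ') :
    IntegrableOn (fun u => 1 / (z - u) ^ 2) {u : ℂ | δ' < ‖z - u‖ ∧ ‖z - u‖ ≤ δ} := by
  have h1 : IntegrableOn (fun _ : ℂ => 1 / δ' ^ 2) {u : ℂ | δ' < ‖z - u‖ ∧ ‖z - u‖ ≤ δ} := by
    refine integrableOn_const (ne_top_of_le_ne_top
      (measure_closedBall_lt_top (x := z) (r := δ)).ne (measure_mono fun u hu => ?_))
    rw [Metric.mem_closedBall, dist_comm, dist_eq_norm]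
    exact hu.2
  refine h1.mono' (by apply Measurable.aestronglyMeasurable; fun_prop)
    ((ae_restrict_iff' (measurableSet_annulus z δ' δ)).2 (Eventually.of_forall fun u hu => ?_))
  rw [norm_div, norm_one, norm_pow]
  have : δ' < ‖z - u‖ := hu.1
  gcongr

theorem setIntegral_annulus_translate (z : ℂ) (δ' δ : ℝ) :
    ∫ u in {u : ℂ | δ' < ‖z - u‖ ∧ ‖z - u‖ ≤ δ}, 1 / (z - u) ^ 2 = 0 := by
  have hm : MeasurableSet {w : ℂ | δ' < ‖w‖ ∧ ‖w‖ ≤ δ} :=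
    (measurableSet_lt measurable_const measurable_norm).inter
      (measurableSet_le measurable_norm measurable_const)
  have h := setIntegral_annulus_inv_sq δ' δ
  rw [← integral_indicator hm, ← integral_sub_left_eq_self _ volume z] at h
  rw [← integral_indicator (measurableSet_annulus z δ' δ), ← h]
  rfl

theorem truncatedBeurling_sub {g : ℂ → ℂ} (hg : Integrable g) (z : ℂ) {δ' δ : ℝ} (hδ' : 0 < δ')
    (hδ : δ' ≤ δ) : truncatedBeurling g δ' z - truncatedBeurling g δ z =
      -(1 / (Real.pi : ℂ)) *
        ∫ u in {u : ℂ | δ' < ‖z - u‖ ∧ ‖z - u‖ ≤ δ}, g u * (1 / (z - u) ^ 2) := by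
  rw [truncatedBeurling_eq, truncatedBeurling_eq, ← mul_sub]
  congr 1
  have hunion : {u : ℂ | δ' < ‖z - u‖} =
      {u : ℂ | δ' < ‖z - u‖ ∧ ‖z - u‖ ≤ δ} ∪ {u : ℂ | δ < ‖z - u‖} := by
    ext u
    simp only [mem_ofPred_eq, mem_union]
    constructor
    · intro h
      rcases le_or_gt ‖z - u‖ δ with h1 | h1
      · exact Or.inl ⟨h, h1⟩
      · exact Or.inr h1
    · rintro (h | h)
      · exact h.1
      · exact hδ.trans_lt h
  have hI := integrableOn_mul_inv_sq hg z hδ'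
  rw [hunion, setIntegral_union _ (measurableSet_lt_norm_sub z δ)
    (hI.mono_set (by rw [hunion]; exact subset_union_left))
    (integrableOn_mul_inv_sq hg z (hδ'.trans_le hδ)), add_sub_cancel_right]
  rw [Set.disjoint_left]
  intro u hu hu'
  exact absurd hu' (not_lt.2 hu.2)

theorem norm_neg_one_div_pi_le : ‖(-(1 / (Real.pi : ℂ)))‖ ≤ 1 := by
  rw [norm_neg, norm_div, norm_one, Complex.norm_real, Real.norm_of_nonneg Real.pi_pos.le,
    div_le_one Real.pi_pos]
  linarith [Real.pi_gt_three]

/-- The kernel has mean zero on annuli, so that on a thin annulus a constant may be subtracted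
from the density. -/
theorem norm_truncatedBeurling_sub_le {g : ℂ → ℂ} (hg : Integrable g) (z : ℂ) {δ' δ : ℝ}
    (hδ' : 0 < δ') (hδ : δ' ≤ δ) (c : ℂ) {X : ℝ} (hX : 0 ≤ X)
    (hc : ∫⁻ x in Metric.closedBall z δ, ‖g x - c‖ₑ ≤ ENNReal.ofReal X) :
    ‖truncatedBeurling g δ' z - truncatedBeurling g δ z‖ ≤ X / δ' ^ 2 := by
  set S := {u : ℂ | δ' < ‖z - u‖ ∧ ‖z - u‖ ≤ δ} with hS
  have hSm : MeasurableSet S := measurableSet_annulus z δ' δ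
  have e1 : ∫ u in S, g u * (1 / (z - u) ^ 2) = ∫ u in S, (g u - c) * (1 / (z - u) ^ 2) := by
    have h1 : ∫ u in S, (g u - c) * (1 / (z - u) ^ 2) =
        ∫ u in S, (g u * (1 / (z - u) ^ 2) - c * (1 / (z - u) ^ 2)) := by
      congr 1; funext u; ring
    rw [h1, integral_sub, integral_const_mul, setIntegral_annulus_translate, mul_zero, sub_zero]
    · exact (integrableOn_mul_inv_sq hg z hδ').mono_set fun u hu => hu.1
    · exact (integrableOn_annulus_inv_sq z hδ').const_mul c
  rw [truncatedBeurling_sub hg z hδ' hδ, norm_mul, e1]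
  have h2 : ‖∫ u in S, (g u - c) * (1 / (z - u) ^ 2)‖ ≤ X / δ' ^ 2 := by
    rw [← ENNReal.ofReal_le_ofReal_iff (by positivity), ofReal_norm]
    calc ‖∫ u in S, (g u - c) * (1 / (z - u) ^ 2)‖ₑ
        ≤ ∫⁻ u in S, ‖(g u - c) * (1 / (z - u) ^ 2)‖ₑ := enorm_integral_le_lintegral_enorm _
      _ ≤ ∫⁻ u in S, ‖g u - c‖ₑ * ENNReal.ofReal (1 / δ' ^ 2) := by
          refine setLIntegral_mono' hSm fun u hu => ?_
          rw [enorm_mul]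
          gcongr
          rw [← ofReal_norm]
          apply ENNReal.ofReal_le_ofReal
          rw [norm_div, norm_one, norm_pow]
          have : δ' < ‖z - u‖ := hu.1
          gcongr
      _ = (∫⁻ u in S, ‖g u - c‖ₑ) * ENNReal.ofReal (1 / δ' ^ 2) :=
          lintegral_mul_const' _ _ (by finiteness)
      _ ≤ ENNReal.ofReal X * ENNReal.ofReal (1 / δ' ^ 2) := by
          gcongr
          refine (lintegral_mono_set fun u hu => ?_).trans hc
          rw [Metric.mem_closedBall, dist_comm, dist_eq_norm]
          exact hu.2
      _ = _ := by
          rw [← ENNReal.ofReal_mul hX, mul_one_div]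
  calc _ ≤ 1 * (X / δ' ^ 2) := mul_le_mul norm_neg_one_div_pi_le h2 (norm_nonneg _) zero_le_one
    _ = _ := one_mul _

theorem OscData.tendsto_beurling {ω : ℝ → ℝ} (hω : IsRegularModulus ω) {Ω : Set ℂ} {g : ℂ → ℂ}
    {N A : ℝ} (h : OscData ω Ω g N A) (hΩ : IsOpen Ω) (hΩb : Bornology.IsBounded Ω) {z : ℂ}
    (hz : z ∈ Ω) :
    Tendsto (fun δ => truncatedBeurling g δ z) (𝓝[>] 0) (𝓝 (beurling g z)) := by
  refine tendsto_nhds_limUnder ?_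
  obtain ⟨d, hd, hdΩ⟩ := Metric.nhds_basis_closedBall.mem_iff.1 (hΩ.mem_nhds hz)
  refine hω.exists_tendsto_of_dyadic hd (A := 4 * A) fun s s' hs' hss hs2 hsd => ?_
  have hs : 0 < s := hs'.trans_le hss
  obtain ⟨c, -, hc⟩ := h.osc z hz s hs
  rw [inter_eq_left.2 ((Metric.closedBall_subset_closedBall hsd).trans hdΩ)] at hc
  have hωs := hω.nonneg hs.le
  have hA := h.nonneg
  refine (norm_truncatedBeurling_sub_le (h.integrable hΩb) z hs' hss c (by positivity) hc).trans ?_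
  rw [div_le_iff₀ (by positivity)]
  have : s ^ 2 ≤ 4 * s' ^ 2 := by nlinarith
  calc A * ω s * s ^ 2 ≤ A * ω s * (4 * s' ^ 2) := by gcongr
    _ = _ := by ring

theorem closedBall_subset_square (z : ℂ) (r : ℝ) :
    Metric.closedBall z r ⊆ square (z - (r + r * Complex.I)) (2 * r) := by
  intro u hu
  rw [Metric.mem_closedBall, dist_eq_norm] at hu
  have h1 := (Complex.abs_re_le_norm (u - z)).trans hu
  have h2 := (Complex.abs_im_le_norm (u - z)).trans hu
  rw [abs_le] at h1 h2
  simp only [Complex.sub_re, Complex.sub_im] at h1 h2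
  rw [square, Complex.mem_reProdIm]
  simp only [Complex.sub_re, Complex.add_re, Complex.ofReal_re, Complex.mul_re, Complex.I_re,
    mul_zero, Complex.ofReal_im, Complex.I_im, mul_one, sub_self, add_zero, Complex.sub_im,
    Complex.add_im, Complex.mul_im, zero_add, mem_Icc]
  refine ⟨⟨?_, ?_⟩, ?_, ?_⟩ <;> linarith

theorem isClosed_square (a : ℂ) (ℓ : ℝ) : IsClosed (square a ℓ) :=
  isClosed_Icc.reProdIm isClosed_Icc

theorem norm_setAverage_le {S : Set ℂ} {f : ℂ → ℂ} {N : ℝ} (hN : 0 ≤ N)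
    (hf : ∀ᵐ x ∂volume.restrict S, ‖f x‖ ≤ N) : ‖⨍ x in S, f x‖ ≤ N := by
  rw [setAverage_eq, norm_smul, norm_inv, Real.norm_of_nonneg measureReal_nonneg]
  rcases eq_or_ne (volume S) ∞ with h | h
  · simp [measureReal_def, h, hN]
  have h2 : ‖∫ x in S, f x‖ ≤ N * volume.real S := by
    have : IsFiniteMeasure (volume.restrict S) := ⟨by simpa using lt_top_iff_ne_top.2 h⟩
    simpa using norm_integral_le_of_norm_le_const hf
  rcases eq_or_lt_of_le (measureReal_nonneg (μ := (volume : Measure ℂ)) (s := S)) with h0 | h0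
  · rw [← h0]; simpa using hN
  · rw [inv_mul_le_iff₀ h0]
    linarith

/-- A Campanato function agrees almost everywhere on `Ω` with one that is measurable and bounded
everywhere; its oscillation over squares controls that over discs. -/
theorem exists_oscData {ω : ℝ → ℝ} (hω : IsRegularModulus ω) :
    ∃ K : ℝ, 0 < K ∧ ∀ Ω : Set ℂ, MeasurableSet Ω → ∀ f : ℂ → ℂ, MemCampanato ω Ω f →
      ∃ g : ℂ → ℂ, OscData ω Ω g (eLpNorm f ∞ (volume.restrict Ω)).toReal
        (K * (campanatoSeminorm ω Ω f).toReal) ∧ g =ᵐ[volume] Ω.indicator f := by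
  obtain ⟨C, hC, hdil⟩ := hω.exists_dilation_const zero_le_two
  refine ⟨4 * C, by positivity, fun Ω hΩ f hf => ?_⟩
  obtain ⟨hfL, hfS⟩ := hf
  set N := (eLpNorm f ∞ (volume.restrict Ω)).toReal with hNdef
  have hN0 : 0 ≤ N := ENNReal.toReal_nonneg
  set f₀ := hfL.1.mk f with hf₀
  have hf₀m : Measurable f₀ := hfL.1.stronglyMeasurable_mk.measurable
  have hae : ∀ᵐ x ∂volume.restrict Ω, f x = f₀ x := hfL.1.ae_eq_mk
  have hb : ∀ᵐ x ∂volume.restrict Ω, ‖f x‖ ≤ N := by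
    have h1 : ∀ᵐ x ∂volume.restrict Ω, ‖f x‖ₑ ≤ eLpNorm f ∞ (volume.restrict Ω) := by
      rw [eLpNorm_exponent_top]
      exact ae_le_eLpNormEssSup
    filter_upwards [h1] with x hx
    rw [← toReal_enorm]
    exact ENNReal.toReal_mono hfL.2.ne hx
  have hset : MeasurableSet (Ω ∩ {x | ‖f₀ x‖ ≤ N}) :=
    hΩ.inter (measurableSet_le hf₀m.norm measurable_const)
  set g := (Ω ∩ {x | ‖f₀ x‖ ≤ N}).indicator f₀ with hg
  have hgΩ : ∀ᵐ x ∂volume.restrict Ω, g x = f x := by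
    filter_upwards [hae, hb, ae_restrict_mem hΩ] with x h1 h2 h3
    have h4 : x ∈ Ω ∩ {x | ‖f₀ x‖ ≤ N} := ⟨h3, by rw [mem_ofPred_eq, ← h1]; exact h2⟩
    rw [hg, indicator_of_mem h4, h1]
  refine ⟨g, ⟨hf₀m.indicator hset, fun x => ?_, fun x hx => ?_, by positivity,
    fun z hz r hr => ?_⟩, ?_⟩
  · by_cases hx : x ∈ Ω ∩ {x | ‖f₀ x‖ ≤ N}
    · rw [hg, indicator_of_mem hx]
      exact hx.2
    · rw [hg, indicator_of_notMem hx, norm_zero]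
      exact hN0
  · exact indicator_of_notMem (fun h => hx h.1) _
  · set a := z - (r + r * Complex.I)
    set Q := square a (2 * r) ∩ Ω with hQ
    have hQm : MeasurableSet Q := (isClosed_square _ _).measurableSet.inter hΩ
    refine ⟨⨍ w in Q, f w, norm_setAverage_le hN0 (ae_restrict_of_ae_restrict_of_subset
      inter_subset_right hb), ?_⟩
    have h1 : (ENNReal.ofReal (ω (2 * r)))⁻¹ * (ENNReal.ofReal ((2 * r) ^ 2))⁻¹ *
        ∫⁻ x in Q, ‖f x - ⨍ w in Q, f w‖ₑ ≤ campanatoSeminorm ω Ω f := by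
      unfold campanatoSeminorm
      refine le_iSup_of_le a (le_iSup_of_le (2 * r) (le_iSup_of_le (by positivity) le_rfl))
    have hω2 : 0 < ω (2 * r) := hω.pos _ (by positivity)
    have hω1 : 0 < ω r := hω.pos _ hr
    have h2 : ∫⁻ x in Q, ‖f x - ⨍ w in Q, f w‖ₑ ≤
        ENNReal.ofReal (ω (2 * r)) * ENNReal.ofReal ((2 * r) ^ 2) * campanatoSeminorm ω Ω f := by
      have hne : ENNReal.ofReal (ω (2 * r)) * ENNReal.ofReal ((2 * r) ^ 2) ≠ 0 := by
        rw [← ENNReal.ofReal_mul hω2.le]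
        have : 0 < ω (2 * r) * (2 * r) ^ 2 := by positivity
        simpa using this
      have h3 : (ENNReal.ofReal (ω (2 * r)))⁻¹ * (ENNReal.ofReal ((2 * r) ^ 2))⁻¹ =
          (ENNReal.ofReal (ω (2 * r)) * ENNReal.ofReal ((2 * r) ^ 2))⁻¹ := by
        rw [ENNReal.mul_inv (Or.inr (by finiteness)) (Or.inl (by finiteness))]
      rw [h3] at h1
      rwa [ENNReal.inv_mul_le_iff hne (by finiteness)] at h1
    calc ∫⁻ x in Metric.closedBall z r ∩ Ω, ‖g x - ⨍ w in Q, f w‖ₑ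
        ≤ ∫⁻ x in Q, ‖g x - ⨍ w in Q, f w‖ₑ :=
          lintegral_mono_set (inter_subset_inter_left _ (closedBall_subset_square z r))
      _ = ∫⁻ x in Q, ‖f x - ⨍ w in Q, f w‖ₑ := by
          refine lintegral_congr_ae ?_
          filter_upwards [ae_restrict_of_ae_restrict_of_subset inter_subset_right hgΩ] with x hx
          rw [hx]
      _ ≤ _ := h2
      _ ≤ ENNReal.ofReal (C * ω r) * ENNReal.ofReal ((2 * r) ^ 2) *
          ENNReal.ofReal (campanatoSeminorm ω Ω f).toReal := by
          rw [ENNReal.ofReal_toReal hfS.ne]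
          gcongr
          exact hdil r hr
      _ = _ := by
          rw [← ENNReal.ofReal_mul (by positivity), ← ENNReal.ofReal_mul (by positivity)]
          congr 1
          ring
  · have := (ae_restrict_iff' hΩ).1 hgΩ
    filter_upwards [this] with x hx
    by_cases hxΩ : x ∈ Ω
    · rw [hx hxΩ, indicator_of_mem hxΩ]
    · rw [indicator_of_notMem hxΩ, hg, indicator_of_notMem (fun h => hxΩ h.1)]

theorem truncatedBeurling_congr {f g : ℂ → ℂ} (h : f =ᵐ[volume] g) :
    truncatedBeurling f = truncatedBeurling g := by
  funext δ z
  rw [truncatedBeurling_eq, truncatedBeurling_eq]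
  congr 1
  refine integral_congr_ae (ae_restrict_of_ae ?_)
  filter_upwards [h] with u hu
  rw [hu]

theorem truncatedBeurling_linear {f g : ℂ → ℂ} (hf : Integrable f) (hg : Integrable g) (a b : ℂ)
    {δ : ℝ} (hδ : 0 < δ) (z : ℂ) :
    truncatedBeurling (fun x => a * f x + b * g x) δ z =
      a * truncatedBeurling f δ z + b * truncatedBeurling g δ z := by
  rw [truncatedBeurling_eq, truncatedBeurling_eq, truncatedBeurling_eq]
  have h1 := (integrableOn_mul_inv_sq hf z hδ).const_mul a
  have h2 := (integrableOn_mul_inv_sq hg z hδ).const_mul b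
  have h3 : (fun u => (a * f u + b * g u) * (1 / (z - u) ^ 2)) =
      fun u => a * (f u * (1 / (z - u) ^ 2)) + b * (g u * (1 / (z - u) ^ 2)) := by
    funext u; ring
  rw [h3, integral_add h1 h2, integral_const_mul, integral_const_mul]
  ring

/-! ### Oscillation of the transform -/

theorem measurable_truncatedBeurling {h : ℂ → ℂ} (hh : Measurable h) (δ : ℝ) :
    Measurable (truncatedBeurling h δ) := by
  have h1 : StronglyMeasurable
      (fun z => ∫ w in {w : ℂ | δ < ‖w‖}, h (z - w) * (1 / w ^ 2)) := by
    apply StronglyMeasurable.integral_prod_right (f := fun z w => h (z - w) * (1 / w ^ 2))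
    apply Measurable.stronglyMeasurable
    fun_prop
  exact h1.measurable.const_mul _

theorem OscData.aemeasurable_beurling {ω : ℝ → ℝ} (hω : IsRegularModulus ω) {Ω : Set ℂ}
    {g : ℂ → ℂ} {N A : ℝ} (h : OscData ω Ω g N A) (hΩ : IsOpen Ω)
    (hΩb : Bornology.IsBounded Ω) : AEMeasurable (beurling g) (volume.restrict Ω) := by
  have hseq : Tendsto (fun n : ℕ => (1 : ℝ) / (n + 1)) atTop (𝓝[>] 0) := by
    rw [tendsto_nhdsWithin_iff]
    exact ⟨tendsto_one_div_add_atTop_nhds_zero_nat,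
      Eventually.of_forall fun n => mem_Ioi.2 Nat.one_div_pos_of_nat⟩
  refine aemeasurable_of_tendsto_metrizable_ae atTop
    (fun n : ℕ => (measurable_truncatedBeurling h.measurable (1 / ((n : ℝ) + 1))).aemeasurable) ?_
  filter_upwards [ae_restrict_mem hΩ.measurableSet] with z hz
  exact (h.tendsto_beurling hω hΩ hΩb hz).comp hseq

/-- The `L²` bound for limits of the truncated transforms. -/
theorem exists_lintegral_sq_limit_le :
    ∃ C : ℝ≥0, ∀ h : ℂ → ℂ, Measurable h → ∀ N R : ℝ, (∀ x, ‖h x‖ ≤ N) →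
      (∀ x, h x ≠ 0 → ‖x‖ ≤ R) → ∀ (S : Set ℂ) (G : ℂ → ℂ), MeasurableSet S →
      (∀ w ∈ S, Tendsto (fun δ => truncatedBeurling h δ w) (𝓝[>] 0) (𝓝 (G w))) →
      ∫⁻ w in S, ‖G w‖ₑ ^ 2 ≤ C * ∫⁻ x, ‖h x‖ₑ ^ 2 := by
  obtain ⟨C, hC⟩ := exists_lintegral_sq_truncatedBeurling_le
  refine ⟨C, fun h hh N R hN hR S G hS hlim => ?_⟩
  have hseq : Tendsto (fun n : ℕ => (1 : ℝ) / (n + 1)) atTop (𝓝[>] 0) := by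
    rw [tendsto_nhdsWithin_iff]
    exact ⟨tendsto_one_div_add_atTop_nhds_zero_nat,
      Eventually.of_forall fun n => mem_Ioi.2 Nat.one_div_pos_of_nat⟩
  calc ∫⁻ w in S, ‖G w‖ₑ ^ 2
      = ∫⁻ w in S, liminf (fun n : ℕ => ‖truncatedBeurling h (1 / ((n : ℝ) + 1)) w‖ₑ ^ 2)
          atTop := by
        refine setLIntegral_congr_fun hS fun w hw => ?_
        exact ((ENNReal.continuous_pow 2).tendsto _ |>.comp
          ((continuous_enorm.tendsto _).comp ((hlim w hw).comp hseq))).liminf_eq.symm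
    _ ≤ liminf (fun n : ℕ => ∫⁻ w in S, ‖truncatedBeurling h (1 / ((n : ℝ) + 1)) w‖ₑ ^ 2)
          atTop :=
        lintegral_liminf_le fun n => (measurable_truncatedBeurling hh _).enorm.pow_const 2
    _ ≤ C * ∫⁻ x, ‖h x‖ₑ ^ 2 := by
        refine (liminf_le_liminf (Eventually.of_forall fun n =>
          (setLIntegral_le_lintegral _ _).trans (hC h hh N R hN hR _
            Nat.one_div_pos_of_nat))).trans (le_of_eq ?_)
        exact liminf_const _

/-- Over the discs `2 ^ k B` the function `g` deviates from a constant adapted to `B` by at most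
`2 ^ (k ε)` times the oscillation over `B`, up to a constant. -/
theorem exists_far_oscillation {ω : ℝ → ℝ} (hω : IsRegularModulus ω) {Ω : Set ℂ} {κ D : ℝ}
    (hκ : 0 < κ) (hdens : HasDensity Ω κ D) (hdiam : ∀ z ∈ Ω, Ω ⊆ Metric.closedBall z (D / 2)) :
    ∃ θ L : ℝ, 1 < θ ∧ θ < 2 ∧ 0 < L ∧ ∀ (g : ℂ → ℂ) (N A : ℝ), OscData ω Ω g N A →
      ∀ z ∈ Ω, ∀ ρ : ℝ, 0 < ρ → 8 * ρ ≤ D → ∀ c : ℂ,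
      ∫⁻ x in Metric.closedBall z (8 * ρ) ∩ Ω, ‖g x - c‖ₑ ≤
        ENNReal.ofReal (A * ω (8 * ρ) * (8 * ρ) ^ 2) →
      ∀ k : ℕ, ∫⁻ x in Metric.closedBall z (2 ^ k * (8 * ρ)) ∩ Ω, ‖g x - c‖ₑ ≤
        ENNReal.ofReal (L * A * ω ρ * θ ^ k * (2 ^ k * (8 * ρ)) ^ 2) := by
  obtain ⟨ε, C, hε0, hε1, hC, hdil⟩ := hω.exists_dilation
  set θ : ℝ := 2 ^ ε with hθ
  have hθ1 : 1 < θ := Real.one_lt_rpow (by norm_num) hε0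
  have hθ2 : θ < 2 := by
    simpa using Real.rpow_lt_rpow_of_exponent_lt (x := (2 : ℝ)) (by norm_num) hε1
  set W : ℝ := C * 8 ^ ε with hW
  have hW0 : 0 < W := by positivity
  set M : ℝ := 5 * W * θ / (κ * (θ - 1)) with hM
  have hθ10 : 0 < θ - 1 := by linarith
  have hM0 : 0 < M := by positivity
  refine ⟨θ, W + 4 * M, hθ1, hθ2, by positivity, fun g N A hg z hz ρ hρ hρD c hc => ?_⟩
  have hA := hg.nonneg
  have hωρ := hω.pos ρ hρ
  set R : ℕ → ℝ := fun k => 2 ^ k * (8 * ρ) with hR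
  have hRpos : ∀ k, 0 < R k := fun k => by positivity
  have hRsucc : ∀ k, R (k + 1) = 2 * R k := fun k => by simp only [hR, pow_succ]; ring
  have hωR : ∀ k, ω (R k) ≤ W * θ ^ k * ω ρ := by
    intro k
    have h1 : (1 : ℝ) ≤ 2 ^ k * 8 := by
      have : (1 : ℝ) ≤ 2 ^ k := one_le_pow₀ (by norm_num)
      linarith
    have h2 := hdil ρ (2 ^ k * 8) hρ h1
    rw [Real.mul_rpow (by positivity) (by norm_num)] at h2
    have h3 : ((2 : ℝ) ^ k) ^ ε = θ ^ k := by
      rw [hθ, ← Real.rpow_natCast, ← Real.rpow_mul (by norm_num), ← Real.rpow_natCast,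
        ← Real.rpow_mul (by norm_num), mul_comm]
    rw [h3] at h2
    calc ω (R k) = ω (2 ^ k * 8 * ρ) := by simp only [hR]; ring_nf
      _ ≤ _ := h2
      _ = _ := by rw [hW]; ring
  have hP : ∀ k, R k ≤ D → ∃ c' : ℂ, ‖c' - c‖ ≤ M * θ ^ k * A * ω ρ ∧
      ∫⁻ x in Metric.closedBall z (R k) ∩ Ω, ‖g x - c'‖ₑ ≤
        ENNReal.ofReal (A * ω (R k) * R k ^ 2) := by
    intro k
    induction k with
    | zero =>
      intro _
      refine ⟨c, ?_, by simpa [hR] using hc⟩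
      rw [sub_self, norm_zero]
      positivity
    | succ k ih =>
      intro hk
      have hRk := hRpos k
      rw [hRsucc] at hk
      obtain ⟨c', hc'1, hc'2⟩ := ih (by linarith)
      obtain ⟨c'', -, hc''⟩ := hg.osc z hz (R (k + 1)) (hRpos _)
      refine ⟨c'', ?_, hc''⟩
      have hω0 : 0 ≤ ω (R k) := hω.nonneg hRk.le
      have hω1 : 0 ≤ ω (R (k + 1)) := hω.nonneg (hRpos _).le
      have h1 := norm_sub_le_of_lintegral_le hg.measurable.aemeasurable (V := κ * R k ^ 2)
        (by positivity)
        (X := A * ω (R (k + 1)) * R (k + 1) ^ 2) (by positivity) (by positivity)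
        (hdens z hz (R k) hRk (by linarith))
        ((lintegral_mono_set (inter_subset_inter_left _
          (Metric.closedBall_subset_closedBall (by rw [hRsucc]; linarith)))).trans hc'') hc'2
      have h2 : ‖c'' - c'‖ ≤ 5 * W / κ * θ ^ (k + 1) * A * ω ρ := by
        refine h1.trans ?_
        have h3 : ω (R k) ≤ ω (R (k + 1)) := hω.mono hRk.le (by rw [hRsucc]; linarith)
        calc (A * ω (R (k + 1)) * R (k + 1) ^ 2 + A * ω (R k) * R k ^ 2) / (κ * R k ^ 2)
            ≤ (A * ω (R (k + 1)) * R (k + 1) ^ 2 + A * ω (R (k + 1)) * R k ^ 2) /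
              (κ * R k ^ 2) := by gcongr
          _ = 5 / κ * A * ω (R (k + 1)) := by rw [hRsucc]; field_simp; ring
          _ ≤ 5 / κ * A * (W * θ ^ (k + 1) * ω ρ) := by gcongr; exact hωR _
          _ = _ := by ring
      calc ‖c'' - c‖ ≤ ‖c'' - c'‖ + ‖c' - c‖ := norm_sub_le_norm_sub_add_norm_sub _ _ _
        _ ≤ 5 * W / κ * θ ^ (k + 1) * A * ω ρ + M * θ ^ k * A * ω ρ := add_le_add h2 hc'1
        _ = _ := by rw [hM]; field_simp; ring
  intro k
  induction k with
  | zero =>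
    refine (show _ ≤ _ by simpa [hR] using hc : _ ≤ ENNReal.ofReal (A * ω (8 * ρ) *
      (8 * ρ) ^ 2)).trans (ENNReal.ofReal_le_ofReal ?_)
    have h1 := hωR 0
    simp only [hR, pow_zero, one_mul, mul_one] at h1 ⊢
    calc A * ω (8 * ρ) * (8 * ρ) ^ 2 ≤ A * (W * ω ρ) * (8 * ρ) ^ 2 := by gcongr
      _ ≤ A * ((W + 4 * M) * ω ρ) * (8 * ρ) ^ 2 := by gcongr; linarith
      _ = _ := by ring
  | succ k ih =>
    rcases le_or_gt (R (k + 1)) D with hk | hk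
    · obtain ⟨c', hc'1, hc'2⟩ := hP (k + 1) hk
      have hRk := hRpos (k + 1)
      change ∫⁻ x in Metric.closedBall z (R (k + 1)) ∩ Ω, ‖g x - c‖ₑ ≤
        ENNReal.ofReal ((W + 4 * M) * A * ω ρ * θ ^ (k + 1) * R (k + 1) ^ 2)
      have hω1 : 0 ≤ ω (R (k + 1)) := hω.nonneg hRk.le
      calc ∫⁻ x in Metric.closedBall z (R (k + 1)) ∩ Ω, ‖g x - c‖ₑ
          ≤ ∫⁻ x in Metric.closedBall z (R (k + 1)) ∩ Ω, (‖g x - c'‖ₑ + ‖c' - c‖ₑ) := by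
            refine lintegral_mono fun x => ?_
            have : g x - c = (g x - c') + (c' - c) := by ring
            rw [this]
            exact enorm_add_le _ _
        _ ≤ ENNReal.ofReal (A * ω (R (k + 1)) * R (k + 1) ^ 2) +
            ENNReal.ofReal (M * θ ^ (k + 1) * A * ω ρ) * ENNReal.ofReal (4 * R (k + 1) ^ 2) := by
            rw [lintegral_add_right _ measurable_const, setLIntegral_const]
            gcongr
            · rw [← ofReal_norm]
              exact ENNReal.ofReal_le_ofReal hc'1
            · exact (measure_mono inter_subset_left).trans (volume_closedBall_le _ hRk.le)
        _ ≤ _ := by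
            rw [← ENNReal.ofReal_mul (by positivity), ← ENNReal.ofReal_add (by positivity)
              (by positivity)]
            apply ENNReal.ofReal_le_ofReal
            calc _ ≤ A * (W * θ ^ (k + 1) * ω ρ) * R (k + 1) ^ 2 +
                  M * θ ^ (k + 1) * A * ω ρ * (4 * R (k + 1) ^ 2) := by gcongr; exact hωR _
              _ = _ := by ring
    · have hk2 : D / 2 ≤ R k := by rw [hRsucc] at hk; linarith
      refine le_trans (lintegral_mono_set ?_) (ih.trans (ENNReal.ofReal_le_ofReal ?_))
      · intro x hx
        exact ⟨Metric.closedBall_subset_closedBall hk2 (hdiam z hz hx.2), hx.2⟩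
      · have h1 : θ ^ k ≤ θ ^ (k + 1) := pow_le_pow_right₀ hθ1.le (by omega)
        have h2 : (2 : ℝ) ^ k ≤ 2 ^ (k + 1) := pow_le_pow_right₀ (by norm_num) (by omega)
        gcongr

/-- Integration of a function with slowly growing means against the cubic decay of the
differentiated kernel. -/
theorem lintegral_mul_inv_cube_le {G : ℂ → ℝ≥0∞} {Ω : Set ℂ} (hΩ : MeasurableSet Ω)
    {z : ℂ} {ρ X θ : ℝ} (hρ : 0 < ρ) (hX : 0 ≤ X)
    (hθ0 : 0 < θ) (hθ : θ < 2)
    (h : ∀ k : ℕ, ∫⁻ x in Metric.closedBall z (2 ^ k * (8 * ρ)) ∩ Ω, G x ≤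
      ENNReal.ofReal (X * θ ^ k * (2 ^ k * (8 * ρ)) ^ 2)) :
    ∫⁻ x in Ω \ Metric.closedBall z (4 * ρ), G x * ENNReal.ofReal (ρ / ‖x - z‖ ^ 3) ≤
      ENNReal.ofReal (X * (2 / (2 - θ))) := by
  set R : ℕ → ℝ := fun k => 2 ^ k * (8 * ρ) with hR
  have hRpos : ∀ k, 0 < R k := fun k => by positivity
  let S : ℕ → Set ℂ := fun k => (Metric.closedBall z (R k) ∩ Ω) \ Metric.closedBall z (R k / 2)
  have hcover : Ω \ Metric.closedBall z (4 * ρ) ⊆ ⋃ k, S k := by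
    intro x hx
    have hx2 : 4 * ρ < dist x z := by simpa using hx.2
    obtain ⟨n, hn1, hn2⟩ := exists_nat_pow_near (x := dist x z / (4 * ρ)) (y := (2 : ℝ))
      ((one_le_div (by positivity)).2 hx2.le) (by norm_num)
    rw [le_div_iff₀ (by positivity)] at hn1
    rw [div_lt_iff₀ (by positivity)] at hn2
    rcases hn1.lt_or_eq with hlt | heq
    · refine mem_iUnion.2 ⟨n, ⟨?_, hx.1⟩, ?_⟩
      · rw [Metric.mem_closedBall]
        simp only [hR]
        rw [pow_succ] at hn2
        linarith
      · rw [Metric.mem_closedBall, not_le]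
        simp only [hR]
        linarith
    · have hn0 : n ≠ 0 := by
        rintro rfl
        rw [pow_zero, one_mul] at heq
        linarith
      obtain ⟨m, rfl⟩ := Nat.exists_eq_succ_of_ne_zero hn0
      rw [Nat.succ_eq_add_one, pow_succ] at heq
      have hp : 0 < (2 : ℝ) ^ m * (4 * ρ) := by positivity
      refine mem_iUnion.2 ⟨m, ⟨?_, hx.1⟩, ?_⟩
      · rw [Metric.mem_closedBall]
        simp only [hR]
        linarith
      · rw [Metric.mem_closedBall, not_le]
        simp only [hR]
        linarith
  have hS : ∀ k, ∫⁻ x in S k, G x * ENNReal.ofReal (ρ / ‖x - z‖ ^ 3) ≤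
      ENNReal.ofReal (X * (θ / 2) ^ k) := by
    intro k
    have hRk := hRpos k
    have hm : MeasurableSet (S k) :=
      (measurableSet_closedBall.inter hΩ).diff measurableSet_closedBall
    calc ∫⁻ x in S k, G x * ENNReal.ofReal (ρ / ‖x - z‖ ^ 3)
        ≤ ∫⁻ x in S k, G x * ENNReal.ofReal (ρ / (R k / 2) ^ 3) := by
          refine setLIntegral_mono' hm fun x hx => ?_
          gcongr
          have := hx.2
          rw [Metric.mem_closedBall, not_le, dist_eq_norm] at this
          exact this.le
      _ = (∫⁻ x in S k, G x) * ENNReal.ofReal (ρ / (R k / 2) ^ 3) :=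
          lintegral_mul_const' _ _ (by finiteness)
      _ ≤ ENNReal.ofReal (X * θ ^ k * R k ^ 2) * ENNReal.ofReal (ρ / (R k / 2) ^ 3) := by
          gcongr
          exact (lintegral_mono_set sdiff_subset).trans (h k)
      _ = ENNReal.ofReal (X * (θ / 2) ^ k) := by
          rw [← ENNReal.ofReal_mul (by positivity)]
          congr 1
          simp only [hR, div_pow]
          field_simp
          norm_num
  calc _ ≤ ∫⁻ x in ⋃ k, S k, G x * ENNReal.ofReal (ρ / ‖x - z‖ ^ 3) := lintegral_mono_set hcover
    _ ≤ ∑' k, ∫⁻ x in S k, G x * ENNReal.ofReal (ρ / ‖x - z‖ ^ 3) := lintegral_iUnion_le _ _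
    _ ≤ ∑' k : ℕ, ENNReal.ofReal (X * (θ / 2) ^ k) := ENNReal.tsum_le_tsum hS
    _ = _ := by
        have hg := hasSum_geometric_of_lt_one (r := θ / 2) (by positivity) (by linarith)
        rw [← ENNReal.ofReal_tsum_of_nonneg (fun k => by positivity) (hg.summable.mul_left X),
          tsum_mul_left, hg.tsum_eq]
        congr 2
        have : 2 - θ ≠ 0 := by linarith
        field_simp

theorem truncatedBeurling_of_far {h : ℂ → ℂ} {z w : ℂ} {ρ δ : ℝ}
    (hsupp : ∀ u, u ∈ Metric.closedBall z (4 * ρ) → h u = 0)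
    (hw : w ∈ Metric.closedBall z ρ) (hδ : δ ≤ ρ) :
    truncatedBeurling h δ w = -(1 / (Real.pi : ℂ)) * ∫ u, h u * (1 / (w - u) ^ 2) := by
  rw [truncatedBeurling_eq]
  congr 1
  refine setIntegral_eq_integral_of_forall_compl_eq_zero fun u hu => ?_
  have h1 : ‖w - u‖ ≤ δ := not_lt.1 hu
  rw [hsupp u, zero_mul]
  rw [Metric.mem_closedBall] at hw ⊢
  have h2 : dist u w ≤ δ := by rwa [dist_comm, dist_eq_norm]
  have := dist_triangle u w z
  have := dist_nonneg (x := w) (y := z)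
  linarith

theorem enorm_truncatedBeurling_sub_le_of_far {h : ℂ → ℂ} (hh : Integrable h) {z w : ℂ} {ρ : ℝ}
    (hρ : 0 < ρ) (hsupp : ∀ u, u ∈ Metric.closedBall z (4 * ρ) → h u = 0)
    (hw : w ∈ Metric.closedBall z ρ) :
    ‖truncatedBeurling h ρ w - truncatedBeurling h ρ z‖ₑ ≤
      ∫⁻ u, ‖h u‖ₑ * ENNReal.ofReal (16 * (ρ / ‖u - z‖ ^ 3)) := by
  have hI : ∀ w ∈ Metric.closedBall z ρ, Integrable fun u => h u * (1 / (w - u) ^ 2) := by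
    intro w hw
    have h1 := (integrable_indicator_iff (measurableSet_lt_norm_sub w ρ)).2
      (integrableOn_mul_inv_sq hh w hρ)
    refine h1.congr (Eventually.of_forall fun u => ?_)
    by_cases hu : u ∈ {u : ℂ | ρ < ‖w - u‖}
    · rw [indicator_of_mem hu]
    · simp only [indicator_of_notMem hu]
      rw [hsupp u, zero_mul]
      have h2 : dist u w ≤ ρ := by
        rw [dist_comm, dist_eq_norm]
        exact not_lt.1 hu
      rw [Metric.mem_closedBall] at hw ⊢
      have := dist_triangle u w z
      linarith
  have hz : z ∈ Metric.closedBall z ρ := Metric.mem_closedBall_self hρ.le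
  rw [truncatedBeurling_of_far hsupp hw le_rfl, truncatedBeurling_of_far hsupp hz le_rfl, ← mul_sub,
    ← integral_sub (hI w hw) (hI z hz), enorm_mul]
  have hpi : ‖(-(1 / (Real.pi : ℂ)))‖ₑ ≤ 1 := by
    rw [← ofReal_norm, ENNReal.ofReal_le_one]
    exact norm_neg_one_div_pi_le
  calc _ ≤ 1 * ∫⁻ u, ‖h u * (1 / (w - u) ^ 2) - h u * (1 / (z - u) ^ 2)‖ₑ :=
        mul_le_mul' hpi (enorm_integral_le_lintegral_enorm _)
    _ ≤ _ := by
        rw [one_mul]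
        refine lintegral_mono fun u => ?_
        rw [← mul_sub, enorm_mul]
        by_cases hu : u ∈ Metric.closedBall z (4 * ρ)
        · simp [hsupp u hu]
        gcongr
        rw [← ofReal_norm]
        apply ENNReal.ofReal_le_ofReal
        rw [Metric.mem_closedBall, not_le, dist_eq_norm] at hu
        rw [Metric.mem_closedBall, dist_eq_norm] at hw
        have h1 : ‖u - z‖ ≤ 2 * ‖w - u‖ := by
          have h2 : ‖u - z‖ ≤ ‖w - u‖ + ‖w - z‖ := by
            have : u - z = -(w - u) + (w - z) := by ring
            rw [this]
            exact (norm_add_le _ _).trans (by rw [norm_neg])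
          linarith
        have h3 : ‖u - z‖ ≤ 2 * ‖z - u‖ := by
          rw [norm_sub_rev z u]
          linarith [norm_nonneg (u - z)]
        refine (norm_inv_sq_sub_inv_sq_le (by linarith) h1 h3).trans ?_
        have h4 : w - u - (z - u) = w - z := by ring
        rw [h4, ← mul_div_assoc]
        gcongr
        norm_num

/-- The mean oscillation of `Bg` over small discs. The density is split into a constant multiple of
`χ_Ω`, a near part, to which the `L²` bound and the John–Nirenberg inequality apply, and a far
part, whose transform is smooth. -/
theorem exists_oscillation_beurling {ω : ℝ → ℝ} (hω : IsRegularModulus ω) {Ω : Set ℂ}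
    (hΩ : IsOpen Ω) (hΩb : Bornology.IsBounded Ω) {κ D : ℝ} (hκ : 0 < κ)
    (hdens : HasDensity Ω κ D) (hdiam : ∀ z ∈ Ω, Ω ⊆ Metric.closedBall z (D / 2))
    {CF ρ₁ : ℝ} (hCF : 0 ≤ CF)
    (hF : ∀ z ∈ Ω, ∀ ρ : ℝ, 0 < ρ → ρ ≤ ρ₁ → ∃ c : ℂ,
      ∫⁻ x in Metric.closedBall z ρ ∩ Ω, ‖beurling (Ω.indicator fun _ => (1 : ℂ)) x - c‖ₑ ≤
        ENNReal.ofReal (CF * ω ρ * ρ ^ 2)) :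
    ∃ C : ℝ, 0 < C ∧ ∀ (g : ℂ → ℂ) (N A : ℝ), OscData ω Ω g N A →
      ∀ z ∈ Ω, ∀ ρ : ℝ, 0 < ρ → ρ ≤ ρ₁ → 8 * ρ ≤ D → ∃ c : ℂ,
      ∫⁻ x in Metric.closedBall z ρ ∩ Ω, ‖beurling g x - c‖ₑ ≤
        ENNReal.ofReal (C * (N + A) * ω ρ * ρ ^ 2) := by
  obtain ⟨θ, L, hθ1, hθ2, hL, hfar⟩ := exists_far_oscillation hω hκ hdens hdiam
  obtain ⟨CJ, hCJ, hJN⟩ := exists_sqOscBound hΩ.measurableSet hκ hdens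
  obtain ⟨C2, hL2⟩ := exists_lintegral_sq_limit_le
  obtain ⟨W, hW1, hW⟩ := hω.exists_dilation_const (lam := 8) (by norm_num)
  have hC20 : (0 : ℝ) ≤ C2 := C2.2
  set K₁ : ℝ := 8 * Real.sqrt (CJ * C2) * W with hK₁
  set K₂ : ℝ := 64 * L * (2 / (2 - θ)) with hK₂
  have hθ' : 0 < 2 - θ := by linarith
  have hK₁0 : 0 ≤ K₁ := by positivity
  have hK₂0 : 0 < K₂ := by positivity
  refine ⟨K₁ + K₂ + CF, by positivity, fun g N A hg z hz ρ hρ hρ₁ hρD => ?_⟩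
  have hA := hg.nonneg
  have hN : 0 ≤ N := (norm_nonneg _).trans (hg.bound 0)
  have hωρ := hω.pos ρ hρ
  have hω8 : 0 < ω (8 * ρ) := hω.pos _ (by positivity)
  have hgm := hg.measurable
  obtain ⟨c, hcN, hc⟩ := hg.osc z hz (8 * ρ) (by positivity)
  obtain ⟨cF, hcF⟩ := hF z hz ρ hρ hρ₁
  set B4 := Metric.closedBall z (4 * ρ) with hB4
  set χ : ℂ → ℂ := Ω.indicator fun _ => (1 : ℂ) with hχ
  set h₁ : ℂ → ℂ := (B4 ∩ Ω).indicator fun x => g x - c with hh₁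
  set h₂ : ℂ → ℂ := (Ω \ B4).indicator fun x => g x - c with hh₂
  have hχd : OscData ω Ω χ 1 0 := oscData_indicator_one hΩ.measurableSet
  have hχi := hχd.integrable hΩb
  have hm1 : MeasurableSet (B4 ∩ Ω) := measurableSet_closedBall.inter hΩ.measurableSet
  have hm2 : MeasurableSet (Ω \ B4) := hΩ.measurableSet.diff measurableSet_closedBall
  have hh₁m : Measurable h₁ := (hgm.sub_const c).indicator hm1
  have hh₂m : Measurable h₂ := (hgm.sub_const c).indicator hm2
  have hgi := hg.integrable hΩb
  have hΩfin : volume Ω ≠ ∞ := hΩb.measure_lt_top.ne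
  have hgci : IntegrableOn (fun x => g x - c) Ω :=
    hgi.integrableOn.sub (integrableOn_const hΩfin)
  have hh₁i : Integrable h₁ := (integrable_indicator_iff hm1).2 (hgci.mono_set inter_subset_right)
  have hh₂i : Integrable h₂ := (integrable_indicator_iff hm2).2 (hgci.mono_set sdiff_subset)
  have hsplit : ∀ δ : ℝ, 0 < δ → ∀ w, truncatedBeurling g δ w =
      c * truncatedBeurling χ δ w + truncatedBeurling h₁ δ w + truncatedBeurling h₂ δ w := by
    intro δ hδ w
    have e1 : g = fun x => 1 * (c * χ x + 1 * h₁ x) + 1 * h₂ x := by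
      funext x
      by_cases hx : x ∈ Ω
      · by_cases hx4 : x ∈ B4 <;> simp [hχ, hh₁, hh₂, hx, hx4]
      · simp [hχ, hh₁, hh₂, hx, hg.supp x hx]
    have e2 := truncatedBeurling_linear (f := fun x => c * χ x + 1 * h₁ x) (g := h₂)
      ((hχi.const_mul c).add (hh₁i.const_mul 1)) hh₂i 1 1 hδ w
    rw [← e1, truncatedBeurling_linear hχi hh₁i c 1 hδ w] at e2
    rw [e2]
    ring
  have hsupp2 : ∀ u, u ∈ Metric.closedBall z (4 * ρ) → h₂ u = 0 := fun u hu =>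
    indicator_of_notMem (fun h => h.2 hu) _
  set H : ℂ → ℂ := truncatedBeurling h₂ ρ with hH
  have hHm : Measurable H := measurable_truncatedBeurling hh₂m ρ
  set G₁ : ℂ → ℂ := fun w => beurling g w - c * beurling χ w - H w with hG₁
  set S := Metric.closedBall z ρ ∩ Ω with hS
  have hSm : MeasurableSet S := measurableSet_closedBall.inter hΩ.measurableSet
  have hlim : ∀ w ∈ S, Tendsto (fun δ => truncatedBeurling h₁ δ w) (𝓝[>] 0) (𝓝 (G₁ w)) := by
    intro w hw
    have t1 := hg.tendsto_beurling hω hΩ hΩb hw.2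
    have t2 := hχd.tendsto_beurling hω hΩ hΩb hw.2
    refine ((t1.sub (t2.const_mul c)).sub_const (H w)).congr' ?_
    filter_upwards [Ioc_mem_nhdsGT hρ] with δ hδ
    rw [hsplit δ hδ.1 w, hH, truncatedBeurling_of_far hsupp2 hw.1 hδ.2,
      truncatedBeurling_of_far hsupp2 hw.1 le_rfl]
    ring
  -- the near part
  have hnear2 : ∫⁻ w in S, ‖G₁ w‖ₑ ^ 2 ≤
      ENNReal.ofReal (16 * (CJ * C2) * (A * ω (8 * ρ)) ^ 2 * ρ ^ 2) := by
    have hsq : ∫⁻ x, ‖h₁ x‖ₑ ^ 2 ≤ ENNReal.ofReal (CJ * (A * ω (8 * ρ)) ^ 2 * (4 * ρ) ^ 2) := by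
      have h1 := hJN g hgm N (A * ω (8 * ρ)) (4 * ρ) (by positivity) (by linarith) hg.bound
        (fun z' hz' r hr hr8 => by
          obtain ⟨c', hc'N, hc'⟩ := hg.osc z' hz' r hr
          refine ⟨c', hc'N, hc'.trans (ENNReal.ofReal_le_ofReal ?_)⟩
          have := hω.mono hr.le (show r ≤ 8 * ρ by linarith)
          gcongr)
        z hz (4 * ρ) (by positivity) le_rfl c hcN
        (by
          rw [show 2 * (4 * ρ) = 8 * ρ by ring]
          exact hc.trans (ENNReal.ofReal_le_ofReal (le_of_eq (by ring))))
      refine le_trans (le_of_eq ?_) h1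
      rw [← lintegral_indicator hm1]
      refine lintegral_congr fun x => ?_
      by_cases hx : x ∈ B4 ∩ Ω
      · rw [indicator_of_mem hx, hh₁, indicator_of_mem hx]
      · rw [indicator_of_notMem hx, hh₁, indicator_of_notMem hx]
        simp
    obtain ⟨R, hR⟩ := hΩb.subset_closedBall 0
    have hL2' := hL2 h₁ hh₁m (2 * N) R (fun x => by
        by_cases hx : x ∈ B4 ∩ Ω
        · rw [hh₁, indicator_of_mem hx]
          exact (norm_sub_le _ _).trans (by linarith [hg.bound x])
        · rw [hh₁, indicator_of_notMem hx, norm_zero]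
          positivity)
      (fun x hx => by
        have : x ∈ B4 ∩ Ω := by
          by_contra h
          exact hx (indicator_of_notMem h _)
        simpa using hR this.2) S G₁ hSm hlim
    calc ∫⁻ w in S, ‖G₁ w‖ₑ ^ 2 ≤ C2 * ∫⁻ x, ‖h₁ x‖ₑ ^ 2 := hL2'
      _ ≤ C2 * ENNReal.ofReal (CJ * (A * ω (8 * ρ)) ^ 2 * (4 * ρ) ^ 2) := by gcongr
      _ = _ := by
          rw [← ENNReal.ofReal_coe_nnreal, ← ENNReal.ofReal_mul hC20]
          congr 1
          ring
  have hAg : AEMeasurable (beurling g) (volume.restrict S) :=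
    (hg.aemeasurable_beurling hω hΩ hΩb).mono_measure (Measure.restrict_mono inter_subset_right
      le_rfl)
  have hAχ : AEMeasurable (beurling χ) (volume.restrict S) :=
    (hχd.aemeasurable_beurling hω hΩ hΩb).mono_measure (Measure.restrict_mono inter_subset_right
      le_rfl)
  have hG₁m : AEMeasurable G₁ (volume.restrict S) :=
    (hAg.sub (hAχ.const_mul c)).sub hHm.aemeasurable
  have hvol : volume S ≤ ENNReal.ofReal (4 * ρ ^ 2) :=
    (measure_mono inter_subset_left).trans (volume_closedBall_le z hρ.le)
  have hnear : ∫⁻ w in S, ‖G₁ w‖ₑ ≤ ENNReal.ofReal (K₁ * A * ω ρ * ρ ^ 2) := by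
    have h1 := sq_lintegral_mul_le (μ := volume.restrict S) (k := fun _ => 1)
      (h := fun w => ‖G₁ w‖ₑ) aemeasurable_const hG₁m.enorm
    simp only [one_mul, setLIntegral_one] at h1
    have h2 : (∫⁻ w in S, ‖G₁ w‖ₑ) ^ 2 ≤
        ENNReal.ofReal (8 * Real.sqrt (CJ * C2) * (A * ω (8 * ρ)) * ρ ^ 2) ^ 2 := by
      refine h1.trans ((mul_le_mul' hvol hnear2).trans (le_of_eq ?_))
      rw [← ENNReal.ofReal_mul (by positivity), ← ENNReal.ofReal_pow (by positivity)]
      congr 1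
      have := Real.sq_sqrt (show 0 ≤ CJ * C2 by positivity)
      calc _ = 64 * (CJ * C2) * (A * ω (8 * ρ)) ^ 2 * (ρ ^ 2) ^ 2 := by ring
        _ = 64 * (Real.sqrt (CJ * C2)) ^ 2 * (A * ω (8 * ρ)) ^ 2 * (ρ ^ 2) ^ 2 := by rw [this]
        _ = _ := by ring
    have h3 := (ENNReal.pow_le_pow_left_iff two_ne_zero).1 h2
    refine h3.trans (ENNReal.ofReal_le_ofReal ?_)
    calc 8 * Real.sqrt (CJ * C2) * (A * ω (8 * ρ)) * ρ ^ 2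
        ≤ 8 * Real.sqrt (CJ * C2) * (A * (W * ω ρ)) * ρ ^ 2 := by
          gcongr
          exact hW ρ hρ
      _ = _ := by rw [hK₁]; ring
  -- the far part
  have hfarpt : ∀ w ∈ S, ‖H w - H z‖ₑ ≤ ENNReal.ofReal (16 * (L * A * ω ρ * (2 / (2 - θ)))) := by
    intro w hw
    refine (enorm_truncatedBeurling_sub_le_of_far hh₂i hρ hsupp2 hw.1).trans ?_
    have h1 := lintegral_mul_inv_cube_le (G := fun x => ‖g x - c‖ₑ) hΩ.measurableSet hρ
      (X := L * A * ω ρ) (by positivity) (by linarith) hθ2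
      (hfar g N A hg z hz ρ hρ hρD c hc)
    calc ∫⁻ u, ‖h₂ u‖ₑ * ENNReal.ofReal (16 * (ρ / ‖u - z‖ ^ 3))
        = ∫⁻ u in Ω \ B4, ENNReal.ofReal 16 *
            (‖g u - c‖ₑ * ENNReal.ofReal (ρ / ‖u - z‖ ^ 3)) := by
          rw [← lintegral_indicator hm2]
          refine lintegral_congr fun u => ?_
          by_cases hu : u ∈ Ω \ B4
          · rw [indicator_of_mem hu, hh₂, indicator_of_mem hu, ENNReal.ofReal_mul (by norm_num)]
            ring
          · rw [indicator_of_notMem hu, hh₂, indicator_of_notMem hu, enorm_zero, zero_mul]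
      _ = ENNReal.ofReal 16 * ∫⁻ u in Ω \ B4, ‖g u - c‖ₑ * ENNReal.ofReal (ρ / ‖u - z‖ ^ 3) :=
          lintegral_const_mul' _ _ (by finiteness)
      _ ≤ ENNReal.ofReal 16 * ENNReal.ofReal (L * A * ω ρ * (2 / (2 - θ))) := by gcongr
      _ = _ := (ENNReal.ofReal_mul (by norm_num)).symm
  refine ⟨c * cF + H z, ?_⟩
  have hpt : ∀ w ∈ S, ‖beurling g w - (c * cF + H z)‖ₑ ≤
      ‖G₁ w‖ₑ + (ENNReal.ofReal N * ‖beurling χ w - cF‖ₑ +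
        ENNReal.ofReal (16 * (L * A * ω ρ * (2 / (2 - θ))))) := by
    intro w hw
    have e : beurling g w - (c * cF + H z) =
        G₁ w + (c * (beurling χ w - cF) + (H w - H z)) := by
      simp only [hG₁]; ring
    rw [e]
    refine (enorm_add_le _ _).trans ?_
    gcongr
    refine (enorm_add_le _ _).trans ?_
    rw [enorm_mul]
    gcongr
    · rw [← ofReal_norm]
      exact ENNReal.ofReal_le_ofReal hcN
    · exact hfarpt w hw
  calc ∫⁻ w in S, ‖beurling g w - (c * cF + H z)‖ₑ
      ≤ ∫⁻ w in S, (‖G₁ w‖ₑ + (ENNReal.ofReal N * ‖beurling χ w - cF‖ₑ +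
        ENNReal.ofReal (16 * (L * A * ω ρ * (2 / (2 - θ)))))) := setLIntegral_mono' hSm hpt
    _ = (∫⁻ w in S, ‖G₁ w‖ₑ) + (ENNReal.ofReal N * (∫⁻ w in S, ‖beurling χ w - cF‖ₑ) +
        ENNReal.ofReal (16 * (L * A * ω ρ * (2 / (2 - θ)))) * volume S) := by
        rw [lintegral_add_left' hG₁m.enorm, lintegral_add_right _ measurable_const,
          lintegral_const_mul' _ _ (by finiteness), setLIntegral_const]
    _ ≤ ENNReal.ofReal (K₁ * A * ω ρ * ρ ^ 2) + (ENNReal.ofReal N *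
        ENNReal.ofReal (CF * ω ρ * ρ ^ 2) + ENNReal.ofReal (16 * (L * A * ω ρ * (2 / (2 - θ)))) *
          ENNReal.ofReal (4 * ρ ^ 2)) := by gcongr
    _ = ENNReal.ofReal ((K₁ * A + N * CF + K₂ * A) * ω ρ * ρ ^ 2) := by
        rw [← ENNReal.ofReal_mul (by positivity), ← ENNReal.ofReal_mul (by positivity),
          ← ENNReal.ofReal_add (by positivity) (by positivity),
          ← ENNReal.ofReal_add (by positivity) (by positivity)]
        congr 1
        rw [hK₂]
        ring
    _ ≤ _ := by
        apply ENNReal.ofReal_le_ofReal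
        gcongr
        nlinarith [mul_nonneg hK₁0 hN, mul_nonneg hK₂0.le hN, mul_nonneg hCF hA]

/-! ### Boundedness of the transform -/

theorem exists_lintegral_beurling_le {ω : ℝ → ℝ} (hω : IsRegularModulus ω) {Ω : Set ℂ}
    (hΩ : IsOpen Ω) (hΩb : Bornology.IsBounded Ω) :
    ∃ C : ℝ, 0 < C ∧ ∀ (g : ℂ → ℂ) (N A : ℝ), OscData ω Ω g N A →
      ∫⁻ x in Ω, ‖beurling g x‖ₑ ≤ ENNReal.ofReal (C * N) := by
  obtain ⟨C2, hC2⟩ := exists_lintegral_sq_limit_le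
  obtain ⟨R, hR⟩ := hΩb.subset_closedBall 0
  have hfin : volume Ω ≠ ∞ := hΩb.measure_lt_top.ne
  set V := (volume Ω).toReal with hV
  have hV0 : 0 ≤ V := ENNReal.toReal_nonneg
  have hC20 : (0 : ℝ) ≤ C2 := C2.2
  refine ⟨Real.sqrt C2 * V + 1, by positivity, fun g N A hg => ?_⟩
  have hN : 0 ≤ N := (norm_nonneg _).trans (hg.bound 0)
  have h1 := hC2 g hg.measurable N R hg.bound (fun x hx => by
    have : x ∈ Ω := by
      by_contra h
      exact hx (hg.supp x h)
    simpa using hR this) Ω (beurling g) hΩ.measurableSet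
    (fun w hw => hg.tendsto_beurling hω hΩ hΩb hw)
  have h2 : ∫⁻ x, ‖g x‖ₑ ^ 2 ≤ ENNReal.ofReal (N ^ 2 * V) := by
    calc ∫⁻ x, ‖g x‖ₑ ^ 2 ≤ ∫⁻ x in Ω, ENNReal.ofReal (N ^ 2) := by
          rw [← lintegral_indicator hΩ.measurableSet]
          refine lintegral_mono fun x => ?_
          by_cases hx : x ∈ Ω
          · rw [indicator_of_mem hx, ← ofReal_norm, ← ENNReal.ofReal_pow (norm_nonneg _)]
            apply ENNReal.ofReal_le_ofReal
            gcongr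
            exact hg.bound x
          · rw [hg.supp x hx]
            simp
      _ = _ := by
          rw [setLIntegral_const, ENNReal.ofReal_mul (by positivity), hV,
            ENNReal.ofReal_toReal hfin]
  have h3 := sq_lintegral_mul_le (μ := volume.restrict Ω) (k := fun _ => 1)
    (h := fun w => ‖beurling g w‖ₑ) aemeasurable_const
    (hg.aemeasurable_beurling hω hΩ hΩb).enorm
  simp only [one_mul, setLIntegral_one] at h3
  have h4 : (∫⁻ x in Ω, ‖beurling g x‖ₑ) ^ 2 ≤ ENNReal.ofReal (Real.sqrt C2 * V * N) ^ 2 := by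
    refine h3.trans ((mul_le_mul' le_rfl (h1.trans (mul_le_mul' le_rfl h2))).trans (le_of_eq ?_))
    rw [← ENNReal.ofReal_toReal hfin, ← hV, ← ENNReal.ofReal_coe_nnreal, ← ENNReal.ofReal_mul hC20,
      ← ENNReal.ofReal_mul hV0, ← ENNReal.ofReal_pow (by positivity)]
    congr 1
    rw [mul_pow, mul_pow, Real.sq_sqrt hC20]
    ring
  refine ((ENNReal.pow_le_pow_left_iff two_ne_zero).1 h4).trans (ENNReal.ofReal_le_ofReal ?_)
  linarith

/-- A function on `Ω` with integral at most `X` and mean oscillation at most `B ω` over the discs of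
radius up to `ρ₂`. Both its `L^∞` norm and its Campanato seminorm are `O(X + B)`. -/
structure LocalBounds (ω : ℝ → ℝ) (Ω : Set ℂ) (u : ℂ → ℂ) (ρ₂ X B : ℝ) : Prop where
  aemeasurable : AEMeasurable u (volume.restrict Ω)
  nonneg_X : 0 ≤ X
  nonneg_B : 0 ≤ B
  lintegral_le : ∫⁻ x in Ω, ‖u x‖ₑ ≤ ENNReal.ofReal X
  osc : ∀ z ∈ Ω, ∀ ρ : ℝ, 0 < ρ → ρ ≤ ρ₂ → ∃ c : ℂ,
    ∫⁻ x in Metric.closedBall z ρ ∩ Ω, ‖u x - c‖ₑ ≤ ENNReal.ofReal (B * ω ρ * ρ ^ 2)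

/-- A function whose mean oscillations are dominated by a Dini modulus is bounded: the means over
concentric discs telescope. -/
theorem LocalBounds.ae_norm_le {ω : ℝ → ℝ} (hω : IsRegularModulus ω) {Ω : Set ℂ}
    (hΩ : IsOpen Ω) {κ ρ₂ : ℝ} (hκ : 0 < κ) (hρ₂ : 0 < ρ₂) (hdens : HasDensity Ω κ ρ₂) :
    ∃ K : ℝ, 0 < K ∧ ∀ (u : ℂ → ℂ) (X B : ℝ), LocalBounds ω Ω u ρ₂ X B →
      ∀ᵐ z ∂volume.restrict Ω, ‖u z‖ ≤ K * (X + B) := by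
  set s : ℝ := ∑' k : ℕ, ω ((1 / 2) ^ k * ρ₂) with hs
  have hsum := hω.summable_dyadic hρ₂
  have hs0 : 0 ≤ s := tsum_nonneg fun k => hω.nonneg (by positivity)
  have hωρ₂ := hω.pos ρ₂ hρ₂
  set K : ℝ := 1 / (κ * ρ₂ ^ 2) + ω ρ₂ / κ + 5 / κ * s + ω ρ₂ with hK
  have hK0 : 0 < K := by positivity
  refine ⟨K, hK0, fun u X B h => ?_⟩
  have hX := h.nonneg_X
  have hB := h.nonneg_B
  have hui : Integrable (Ω.indicator u) := by
    rw [integrable_indicator_iff hΩ.measurableSet]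
    exact ⟨h.aemeasurable.aestronglyMeasurable,
      h.lintegral_le.trans_lt ENNReal.ofReal_lt_top⟩
  rw [ae_restrict_iff' hΩ.measurableSet]
  filter_upwards [(Besicovitch.vitaliFamily (volume : Measure ℂ)).ae_tendsto_lintegral_enorm_sub_div
    hui.locallyIntegrable] with z hz hzΩ
  rw [indicator_of_mem hzΩ] at hz
  -- `z` is a Lebesgue point; `c k` are approximate means over the discs of radius `r k`
  set r : ℕ → ℝ := fun k => (1 / 2) ^ k * ρ₂ with hr
  have hrpos : ∀ k, 0 < r k := fun k => by positivity
  have hrle : ∀ k, r k ≤ ρ₂ := fun k => by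
    have : (1 / 2 : ℝ) ^ k ≤ 1 := pow_le_one₀ (by norm_num) (by norm_num)
    simp only [hr]
    nlinarith
  have hrsucc : ∀ k, r (k + 1) = r k / 2 := fun k => by simp only [hr, pow_succ]; ring
  have hrlim : Tendsto r atTop (𝓝[>] 0) := by
    rw [tendsto_nhdsWithin_iff]
    refine ⟨?_, Eventually.of_forall hrpos⟩
    simpa [hr] using (tendsto_pow_atTop_nhds_zero_of_lt_one (r := (1 / 2 : ℝ)) (by norm_num)
      (by norm_num)).mul_const ρ₂
  have hc : ∀ k, ∃ c : ℂ, ∫⁻ x in Metric.closedBall z (r k) ∩ Ω, ‖u x - c‖ₑ ≤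
      ENNReal.ofReal (B * ω (r k) * r k ^ 2) := fun k => h.osc z hzΩ (r k) (hrpos k) (hrle k)
  choose c hc using hc
  have hmeas : ∀ S, S ⊆ Ω → AEMeasurable u (volume.restrict S) := fun S hS =>
    h.aemeasurable.mono_measure (Measure.restrict_mono hS le_rfl)
  have hωr : ∀ k, 0 ≤ ω (r k) := fun k => hω.nonneg (hrpos k).le
  have hstep : ∀ k, ‖c (k + 1) - c k‖ ≤ 5 / κ * B * ω (r k) := by
    intro k
    have hk := hrpos k
    have hk1 := hrpos (k + 1)
    have h0 := hωr k
    have h0' := hωr (k + 1)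
    have hle : ω (r (k + 1)) ≤ ω (r k) := hω.mono hk1.le (by rw [hrsucc]; linarith)
    have h1 := norm_sub_le_of_lintegral_le (hmeas _ inter_subset_right)
      (V := κ * r (k + 1) ^ 2) (by positivity) (by positivity)
      (Y := B * ω (r k) * r k ^ 2) (by positivity)
      (hdens z hzΩ (r (k + 1)) hk1 (hrle _)) (hc (k + 1))
      ((lintegral_mono_set (inter_subset_inter_left _
        (Metric.closedBall_subset_closedBall (by rw [hrsucc]; linarith)))).trans (hc k))
    refine h1.trans ?_
    rw [div_le_iff₀ (by positivity)]
    calc B * ω (r (k + 1)) * r (k + 1) ^ 2 + B * ω (r k) * r k ^ 2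
        ≤ B * ω (r k) * r (k + 1) ^ 2 + B * ω (r k) * r k ^ 2 := by gcongr
      _ = _ := by rw [hrsucc]; field_simp; ring
  have htel : ∀ k, ‖c k - c 0‖ ≤ 5 / κ * B * s := by
    intro k
    calc ‖c k - c 0‖ = ‖∑ j ∈ Finset.range k, (c (j + 1) - c j)‖ := by
          rw [Finset.sum_range_sub]
      _ ≤ ∑ j ∈ Finset.range k, 5 / κ * B * ω (r j) :=
          (norm_sum_le _ _).trans (Finset.sum_le_sum fun j _ => hstep j)
      _ = 5 / κ * B * ∑ j ∈ Finset.range k, ω (r j) := by rw [Finset.mul_sum]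
      _ ≤ _ := by
          gcongr
          exact hsum.sum_le_tsum _ (fun j _ => hωr j)
  have hc0 : ‖c 0‖ ≤ (B * ω ρ₂ * ρ₂ ^ 2 + X) / (κ * ρ₂ ^ 2) := by
    have hr0 : r 0 = ρ₂ := by simp [hr]
    have h1 := hc 0
    rw [hr0] at h1
    have h2 := norm_sub_le_of_lintegral_le (hmeas (Metric.closedBall z ρ₂ ∩ Ω) inter_subset_right)
      (V := κ * ρ₂ ^ 2) (c' := 0) (Y := X) (by positivity) (by positivity) hX
      (hdens z hzΩ ρ₂ hρ₂ le_rfl) h1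
      (by
        simp only [sub_zero]
        exact (lintegral_mono_set inter_subset_right).trans h.lintegral_le)
    simpa using h2
  refine le_of_forall_pos_le_add fun η hη => ?_
  have hz1 := (hz.comp ((Besicovitch.tendsto_filterAt volume z).comp hrlim)).eventually_lt_const
    (show (0 : ℝ≥0∞) < ENNReal.ofReal (η / 4) by simpa using hη)
  obtain ⟨d, hd, hdΩ⟩ := Metric.nhds_basis_closedBall.mem_iff.1 (hΩ.mem_nhds hzΩ)
  have hz2 : ∀ᶠ k in atTop, r k < d :=
    (hrlim.mono_right nhdsWithin_le_nhds).eventually_lt_const hd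
  obtain ⟨k, hk1, hk2⟩ := (hz1.and hz2).exists
  have hrk := hrpos k
  have hsub : Metric.closedBall z (r k) ⊆ Ω :=
    (Metric.closedBall_subset_closedBall hk2.le).trans hdΩ
  have hvol : volume (Metric.closedBall z (r k)) ≤ ENNReal.ofReal (4 * r k ^ 2) :=
    volume_closedBall_le z hrk.le
  have hvol' : ENNReal.ofReal (r k ^ 2) ≤ volume (Metric.closedBall z (r k)) := by
    rw [volume_closedBall_eq z hrk.le]
    apply ENNReal.ofReal_le_ofReal
    nlinarith [Real.pi_gt_three, sq_nonneg (r k)]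
  have h3 : ∫⁻ x in Metric.closedBall z (r k), ‖u x - u z‖ₑ ≤ ENNReal.ofReal (η * r k ^ 2) := by
    have h4 : ∫⁻ x in Metric.closedBall z (r k), ‖u x - u z‖ₑ =
        ∫⁻ x in Metric.closedBall z (r k), ‖Ω.indicator u x - u z‖ₑ :=
      setLIntegral_congr_fun measurableSet_closedBall fun x hx => by
        rw [indicator_of_mem (hsub hx)]
    rw [h4]
    simp only [Function.comp_apply] at hk1
    have h5 := ENNReal.div_le_iff_le_mul (Or.inl (by
        have : 0 < ENNReal.ofReal (r k ^ 2) := by simpa using by positivity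
        exact (this.trans_le hvol').ne')) (Or.inl measure_closedBall_lt_top.ne) |>.1 hk1.le
    refine h5.trans ((mul_le_mul' le_rfl hvol).trans (le_of_eq ?_))
    rw [← ENNReal.ofReal_mul (by positivity)]
    congr 1
    ring
  have h6 := hc k
  rw [inter_eq_left.2 hsub] at h6
  have hωk := hωr k
  have h7 := norm_sub_le_of_lintegral_le (hmeas _ hsub) (V := r k ^ 2) (by positivity)
    (by positivity) (by positivity) hvol' h3 h6
  have h8 : (η * r k ^ 2 + B * ω (r k) * r k ^ 2) / r k ^ 2 = η + B * ω (r k) := by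
    field_simp
  rw [h8] at h7
  have h9 : ω (r k) ≤ ω ρ₂ := hω.mono hrk.le (hrle k)
  have h10 : ‖u z‖ ≤ ‖u z - c k‖ + ‖c k - c 0‖ + ‖c 0‖ := by
    have : u z = (u z - c k) + (c k - c 0) + c 0 := by ring
    calc ‖u z‖ = ‖(u z - c k) + (c k - c 0) + c 0‖ := by rw [← this]
      _ ≤ _ := norm_add₃_le
  calc ‖u z‖ ≤ (η + B * ω ρ₂) + 5 / κ * B * s + (B * ω ρ₂ * ρ₂ ^ 2 + X) / (κ * ρ₂ ^ 2) := by
        refine h10.trans (add_le_add (add_le_add (h7.trans ?_) (htel k)) hc0)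
        gcongr
    _ = (1 / (κ * ρ₂ ^ 2)) * X + (ω ρ₂ / κ + 5 / κ * s + ω ρ₂) * B + η := by
        field_simp; ring
    _ ≤ K * X + K * B + η := by
        gcongr
        · rw [hK]
          have : 0 ≤ ω ρ₂ / κ + 5 / κ * s + ω ρ₂ := by positivity
          linarith
        · rw [hK]
          have : 0 ≤ 1 / (κ * ρ₂ ^ 2) := by positivity
          linarith
    _ = _ := by ring

theorem lintegral_enorm_sub_average_le {S : Set ℂ} (hS : volume S ≠ ∞) {u : ℂ → ℂ}
    (hu : IntegrableOn u S) (c : ℂ) :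
    ∫⁻ x in S, ‖u x - ⨍ w in S, u w‖ₑ ≤ 2 * ∫⁻ x in S, ‖u x - c‖ₑ := by
  have hum : AEMeasurable u (volume.restrict S) := hu.aestronglyMeasurable.aemeasurable
  rcases eq_or_ne (volume S) 0 with h0 | h0
  · rw [Measure.restrict_eq_zero.2 h0]; simp
  have h1 : ‖c - ⨍ w in S, u w‖ₑ * volume S ≤ ∫⁻ x in S, ‖u x - c‖ₑ := by
    have h2 : (⨍ w in S, u w) - c = ⨍ w in S, (u w - c) := by
      have hfin : IsFiniteMeasure (volume.restrict S) := ⟨by simpa using lt_top_iff_ne_top.2 hS⟩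
      rw [setAverage_eq, setAverage_eq, integral_sub hu (integrable_const c), smul_sub,
        setIntegral_const, smul_smul, inv_mul_cancel₀, one_smul]
      rw [measureReal_def]
      exact (ENNReal.toReal_pos h0 hS).ne'
    rw [← enorm_neg, neg_sub, h2, setAverage_eq, enorm_smul]
    have h3 : ‖(volume.real S)⁻¹‖ₑ * volume S = 1 := by
      rw [measureReal_def, ← ENNReal.toReal_inv, Real.enorm_of_nonneg ENNReal.toReal_nonneg,
        ENNReal.ofReal_toReal (ENNReal.inv_ne_top.2 h0), ENNReal.inv_mul_cancel h0 hS]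
    rw [mul_right_comm, h3, one_mul]
    exact enorm_integral_le_lintegral_enorm _
  calc ∫⁻ x in S, ‖u x - ⨍ w in S, u w‖ₑ
      ≤ ∫⁻ x in S, (‖u x - c‖ₑ + ‖c - ⨍ w in S, u w‖ₑ) := by
        refine lintegral_mono fun x => ?_
        have : u x - ⨍ w in S, u w = (u x - c) + (c - ⨍ w in S, u w) := by ring
        rw [this]
        exact enorm_add_le _ _
    _ = (∫⁻ x in S, ‖u x - c‖ₑ) + ‖c - ⨍ w in S, u w‖ₑ * volume S := by
        rw [lintegral_add_right _ measurable_const, setLIntegral_const]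
    _ ≤ _ := by
        rw [two_mul]
        gcongr

theorem square_subset_closedBall {a z : ℂ} {ℓ : ℝ} (hz : z ∈ square a ℓ) :
    square a ℓ ⊆ Metric.closedBall z (2 * ℓ) := by
  intro w hw
  rw [square, Complex.mem_reProdIm] at hz hw
  rw [Metric.mem_closedBall, dist_eq_norm]
  refine (Complex.norm_le_abs_re_add_abs_im _).trans ?_
  have h1 : |(w - z).re| ≤ ℓ := by
    rw [Complex.sub_re, abs_le]
    constructor <;> linarith [hz.1.1, hz.1.2, hw.1.1, hw.1.2]
  have h2 : |(w - z).im| ≤ ℓ := by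
    rw [Complex.sub_im, abs_le]
    constructor <;> linarith [hz.2.1, hz.2.2, hw.2.1, hw.2.2]
  linarith

theorem LocalBounds.campanatoSeminorm_le {ω : ℝ → ℝ} (hω : IsRegularModulus ω) {Ω : Set ℂ}
    (hΩb : Bornology.IsBounded Ω) {ρ₂ : ℝ} (hρ₂ : 0 < ρ₂) :
    ∃ K : ℝ, 0 < K ∧ ∀ (u : ℂ → ℂ) (X B : ℝ), LocalBounds ω Ω u ρ₂ X B →
      campanatoSeminorm ω Ω u ≤ ENNReal.ofReal (K * (X + B)) := by
  obtain ⟨W, hW1, hW⟩ := hω.exists_dilation_const zero_le_two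
  have hω₂ := hω.pos (ρ₂ / 2) (by positivity)
  set K : ℝ := 8 * W + 2 / (ω (ρ₂ / 2) * (ρ₂ / 2) ^ 2) with hK
  have hK0 : 0 < K := by positivity
  refine ⟨K, hK0, fun u X B h => ?_⟩
  have hX := h.nonneg_X
  have hB := h.nonneg_B
  have hui : IntegrableOn u Ω :=
    ⟨h.aemeasurable.aestronglyMeasurable, h.lintegral_le.trans_lt ENNReal.ofReal_lt_top⟩
  unfold campanatoSeminorm
  refine iSup_le fun a => iSup_le fun ℓ => iSup_le fun hℓ => ?_
  have hωℓ := hω.pos ℓ hℓ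
  set Q := square a ℓ ∩ Ω with hQ
  have hQfin : volume Q ≠ ∞ := ne_top_of_le_ne_top hΩb.measure_lt_top.ne
    (measure_mono inter_subset_right)
  have key : ∫⁻ z in Q, ‖u z - ⨍ w in Q, u w‖ₑ ≤
      ENNReal.ofReal (ω ℓ) * ENNReal.ofReal (ℓ ^ 2) * ENNReal.ofReal (K * (X + B)) := by
    rw [← ENNReal.ofReal_mul hωℓ.le, ← ENNReal.ofReal_mul (by positivity)]
    rcases Q.eq_empty_or_nonempty with hemp | ⟨z, hz⟩
    · rw [hemp]; simp
    rcases le_or_gt ℓ (ρ₂ / 2) with hℓ2 | hℓ2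
    · obtain ⟨c, hc⟩ := h.osc z hz.2 (2 * ℓ) (by positivity) (by linarith)
      refine (lintegral_enorm_sub_average_le hQfin (hui.mono_set inter_subset_right) c).trans ?_
      have h1 : ∫⁻ x in Q, ‖u x - c‖ₑ ≤ ENNReal.ofReal (B * ω (2 * ℓ) * (2 * ℓ) ^ 2) :=
        (lintegral_mono_set (inter_subset_inter_left _ (square_subset_closedBall hz.1))).trans hc
      refine (mul_le_mul' le_rfl h1).trans ?_
      rw [← ENNReal.ofReal_ofNat 2, ← ENNReal.ofReal_mul (by norm_num)]
      apply ENNReal.ofReal_le_ofReal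
      have h2 : 0 < 2 / (ω (ρ₂ / 2) * (ρ₂ / 2) ^ 2) := by positivity
      calc 2 * (B * ω (2 * ℓ) * (2 * ℓ) ^ 2) ≤ 2 * (B * (W * ω ℓ) * (2 * ℓ) ^ 2) := by
            gcongr
            exact hW ℓ hℓ
        _ = ω ℓ * ℓ ^ 2 * (8 * W * (0 + B)) := by ring
        _ ≤ ω ℓ * ℓ ^ 2 * (K * (X + B)) := by
            gcongr
            rw [hK]
            linarith
    · refine (lintegral_enorm_sub_average_le hQfin (hui.mono_set inter_subset_right) 0).trans ?_
      simp only [sub_zero]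
      have h1 : ∫⁻ x in Q, ‖u x‖ₑ ≤ ENNReal.ofReal X :=
        (lintegral_mono_set inter_subset_right).trans h.lintegral_le
      refine (mul_le_mul' le_rfl h1).trans ?_
      rw [← ENNReal.ofReal_ofNat 2, ← ENNReal.ofReal_mul (by norm_num)]
      apply ENNReal.ofReal_le_ofReal
      have h2 : ω (ρ₂ / 2) ≤ ω ℓ := hω.mono (by positivity) hℓ2.le
      calc 2 * X = ω (ρ₂ / 2) * (ρ₂ / 2) ^ 2 * (2 / (ω (ρ₂ / 2) * (ρ₂ / 2) ^ 2) * (X + 0)) := by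
            field_simp; ring
        _ ≤ ω ℓ * ℓ ^ 2 * (K * (X + B)) := by
            gcongr
            rw [hK]
            linarith
  have hne : ENNReal.ofReal (ω ℓ) * ENNReal.ofReal (ℓ ^ 2) ≠ 0 := by
    rw [← ENNReal.ofReal_mul hωℓ.le]
    have : 0 < ω ℓ * ℓ ^ 2 := by positivity
    simpa using this
  rw [← ENNReal.mul_inv (Or.inr (by finiteness)) (Or.inl (by finiteness)),
    ENNReal.inv_mul_le_iff hne (by finiteness)]
  exact key

/-- The theorem for domains of positive density on which the transform of the characteristic
function has mean oscillation of order `ω`. -/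
theorem beurling_bounded_of_oscillation {ω : ℝ → ℝ} (hω : IsRegularModulus ω) {Ω : Set ℂ}
    (hΩ : IsOpen Ω) (hΩb : Bornology.IsBounded Ω) {κ D : ℝ} (hκ : 0 < κ) (hD : 0 < D)
    (hdens : HasDensity Ω κ D) (hdiam : ∀ z ∈ Ω, Ω ⊆ Metric.closedBall z (D / 2))
    {CF ρ₁ : ℝ} (hCF : 0 ≤ CF) (hρ₁ : 0 < ρ₁)
    (hF : ∀ z ∈ Ω, ∀ ρ : ℝ, 0 < ρ → ρ ≤ ρ₁ → ∃ c : ℂ,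
      ∫⁻ x in Metric.closedBall z ρ ∩ Ω, ‖beurling (Ω.indicator fun _ => (1 : ℂ)) x - c‖ₑ ≤
        ENNReal.ofReal (CF * ω ρ * ρ ^ 2)) :
    ∃ C : ℝ≥0, ∀ f : ℂ → ℂ, MemCampanato ω Ω f →
      MemCampanato ω Ω (restrictedBeurling Ω f) ∧
      campanatoNorm ω Ω (restrictedBeurling Ω f) ≤ (C : ℝ≥0∞) * campanatoNorm ω Ω f := by
  obtain ⟨K, hK, hdata⟩ := exists_oscData hω
  obtain ⟨C₁, hC₁, hosc⟩ := exists_oscillation_beurling hω hΩ hΩb hκ hdens hdiam hCF hF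
  obtain ⟨C₂, hC₂, hint⟩ := exists_lintegral_beurling_le hω hΩ hΩb
  set ρ₂ := min ρ₁ (D / 8) with hρ₂
  have hρ₂0 : 0 < ρ₂ := lt_min hρ₁ (by positivity)
  have h8 : 8 * ρ₂ ≤ D := by
    have := min_le_right ρ₁ (D / 8)
    linarith
  have hdens' : HasDensity Ω κ ρ₂ := fun z hz ρ hρ hρ' => hdens z hz ρ hρ (by linarith)
  obtain ⟨K₁, hK₁, hsup⟩ := LocalBounds.ae_norm_le hω hΩ hκ hρ₂0 hdens'
  obtain ⟨K₂, hK₂, hsem⟩ := LocalBounds.campanatoSeminorm_le hω hΩb hρ₂0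
  set M : ℝ := (K₁ + K₂) * ((C₂ + C₁) * (1 + K)) with hM
  have hM0 : 0 ≤ M := by positivity
  refine ⟨M.toNNReal, fun f hf => ?_⟩
  obtain ⟨g, hg, hgf⟩ := hdata Ω hΩ.measurableSet f hf
  have hbe : restrictedBeurling Ω f = beurling g := by
    funext z
    unfold restrictedBeurling beurling
    rw [truncatedBeurling_congr hgf]
  set N := (eLpNorm f ∞ (volume.restrict Ω)).toReal with hN
  set S := (campanatoSeminorm ω Ω f).toReal with hS
  have hN0 : 0 ≤ N := ENNReal.toReal_nonneg
  have hS0 : 0 ≤ S := ENNReal.toReal_nonneg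
  have hlb : LocalBounds ω Ω (beurling g) ρ₂ (C₂ * N) (C₁ * (N + K * S)) :=
    ⟨hg.aemeasurable_beurling hω hΩ hΩb, by positivity, by positivity, hint g N _ hg,
      fun z hz ρ hρ hρ' => hosc g N _ hg z hz ρ hρ (hρ'.trans (min_le_left _ _)) (by linarith)⟩
  have h1 : eLpNorm (beurling g) ∞ (volume.restrict Ω) ≤
      ENNReal.ofReal (K₁ * (C₂ * N + C₁ * (N + K * S))) := by
    rw [eLpNorm_exponent_top]
    exact eLpNormEssSup_le_of_ae_bound (hsup _ _ _ hlb)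
  have h2 := hsem _ _ _ hlb
  rw [hbe]
  refine ⟨⟨⟨hlb.aemeasurable.aestronglyMeasurable, h1.trans_lt ENNReal.ofReal_lt_top⟩,
    h2.trans_lt ENNReal.ofReal_lt_top⟩, ?_⟩
  have h3 : campanatoNorm ω Ω f = ENNReal.ofReal (N + S) := by
    unfold campanatoNorm
    rw [ENNReal.ofReal_add hN0 hS0, hN, hS, ENNReal.ofReal_toReal hf.1.2.ne,
      ENNReal.ofReal_toReal hf.2.ne]
  rw [h3]
  change _ ≤ ENNReal.ofReal M * _
  rw [← ENNReal.ofReal_mul hM0]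
  unfold campanatoNorm
  refine (add_le_add h1 h2).trans ?_
  rw [← ENNReal.ofReal_add (by positivity) (by positivity), ← add_mul]
  apply ENNReal.ofReal_le_ofReal
  have h4 : C₂ * N + C₁ * (N + K * S) ≤ (C₂ + C₁) * (1 + K) * (N + S) := by
    have e : (C₂ + C₁) * (1 + K) * (N + S) - (C₂ * N + C₁ * (N + K * S)) =
        C₂ * S + C₂ * K * (N + S) + C₁ * S + C₁ * K * N := by ring
    have : 0 ≤ C₂ * S + C₂ * K * (N + S) + C₁ * S + C₁ * K * N := by positivity
    linarith
  calc (K₁ + K₂) * (C₂ * N + C₁ * (N + K * S))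
      ≤ (K₁ + K₂) * ((C₂ + C₁) * (1 + K) * (N + S)) := by gcongr
    _ = _ := by rw [hM]; ring

/-! ### Uniform boundary charts -/

/-- The point with coordinates `(x, y)` in the frame with origin `ζ` and direction `c`. -/
noncomputable def chartPt (ζ c : ℂ) (x y : ℝ) : ℂ := ζ + c * ((x : ℂ) + (y : ℂ) * Complex.I)

/-- The coordinates of `u` in the frame with origin `ζ` and direction `c`, as a complex number. -/
noncomputable def chartCoord (ζ c u : ℂ) : ℂ := (starRingEnd ℂ) c * (u - ζ)

theorem conj_mul_self_of_norm_eq_one {c : ℂ} (hc : ‖c‖ = 1) : (starRingEnd ℂ) c * c = 1 := by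
  rw [mul_comm, Complex.mul_conj, Complex.normSq_eq_norm_sq, hc]; simp

theorem chartPt_chartCoord {ζ c : ℂ} (hc : ‖c‖ = 1) (u : ℂ) :
    chartPt ζ c (chartCoord ζ c u).re (chartCoord ζ c u).im = u := by
  have := conj_mul_self_of_norm_eq_one hc
  rw [chartPt, Complex.re_add_im, chartCoord]
  linear_combination (u - ζ) * this

theorem chartCoord_chartPt {ζ c : ℂ} (hc : ‖c‖ = 1) (x y : ℝ) :
    chartCoord ζ c (chartPt ζ c x y) = x + y * Complex.I := by
  have := conj_mul_self_of_norm_eq_one hc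
  rw [chartPt, chartCoord]
  linear_combination (x + y * Complex.I) * this

theorem norm_chartCoord {ζ c : ℂ} (hc : ‖c‖ = 1) (u : ℂ) : ‖chartCoord ζ c u‖ = ‖u - ζ‖ := by
  rw [chartCoord, norm_mul, RCLike.norm_conj, hc, one_mul]

theorem chartPt_sub (ζ c : ℂ) (x y x' y' : ℝ) :
    chartPt ζ c x y - chartPt ζ c x' y' =
      c * (((x - x' : ℝ) : ℂ) + ((y - y' : ℝ) : ℂ) * Complex.I) := by
  simp only [chartPt]; push_cast; ring

theorem norm_add_mul_I_le (x y : ℝ) : ‖(x : ℂ) + (y : ℂ) * Complex.I‖ ≤ |x| + |y| := by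
  refine (norm_add_le _ _).trans ?_
  simp

theorem norm_chartPt_sub_le {ζ c : ℂ} (hc : ‖c‖ = 1) (x y x' y' : ℝ) :
    ‖chartPt ζ c x y - chartPt ζ c x' y'‖ ≤ |x - x'| + |y - y'| := by
  rw [chartPt_sub, norm_mul, hc, one_mul]
  exact norm_add_mul_I_le _ _

theorem abs_sub_le_norm_chartPt_sub {ζ c : ℂ} (hc : ‖c‖ = 1) (x y x' y' : ℝ) :
    |x - x'| ≤ ‖chartPt ζ c x y - chartPt ζ c x' y'‖ ∧
      |y - y'| ≤ ‖chartPt ζ c x y - chartPt ζ c x' y'‖ := by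
  rw [chartPt_sub, norm_mul, hc, one_mul]
  constructor
  · simpa using Complex.abs_re_le_norm (((x - x' : ℝ) : ℂ) + ((y - y' : ℝ) : ℂ) * Complex.I)
  · simpa using Complex.abs_im_le_norm (((x - x' : ℝ) : ℂ) + ((y - y' : ℝ) : ℂ) * Complex.I)

theorem chartPt_chartPt (ζ c : ℂ) (x y x' y' : ℝ) :
    chartPt (chartPt ζ c x y) c x' y' = chartPt ζ c (x + x') (y + y') := by
  simp only [chartPt]; push_cast; ring

/-- A boundary chart centred at the boundary point `ζ`: in a box of size `R` the domain is the
subgraph of an `M`-Lipschitz function `φ`, which deviates from its tangent line of slope `m` by at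
most `M |x| ω(|x|)`. -/
structure UniformChart (ω : ℝ → ℝ) (Ω : Set ℂ) (R M : ℝ) (ζ c : ℂ) (φ : ℝ → ℝ) (m : ℝ) :
    Prop where
  norm_eq : ‖c‖ = 1
  map_zero : φ 0 = 0
  lipschitz : ∀ x ∈ Ioo (-R) R, ∀ x' ∈ Ioo (-R) R, |φ x - φ x'| ≤ M * |x - x'|
  slope : |m| ≤ M
  tangent : ∀ x ∈ Ioo (-R) R, |φ x - m * x| ≤ M * |x| * ω |x|
  mem_iff : ∀ x ∈ Ioo (-R) R, ∀ y ∈ Ioo (-R) R, (chartPt ζ c x y ∈ Ω ↔ y < φ x)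

theorem UniformChart.mono {ω : ℝ → ℝ} (hω : IsModulus ω) {Ω : Set ℂ} {R M R' M' : ℝ} {ζ c : ℂ}
    {φ : ℝ → ℝ} {m : ℝ} (h : UniformChart ω Ω R M ζ c φ m) (hR : R' ≤ R) (hM : M ≤ M') :
    UniformChart ω Ω R' M' ζ c φ m := by
  have hsub : Ioo (-R') R' ⊆ Ioo (-R) R := Ioo_subset_Ioo (by linarith) hR
  refine ⟨h.norm_eq, h.map_zero, fun x hx x' hx' => ?_, h.slope.trans hM, fun x hx => ?_,
    fun x hx y hy => h.mem_iff x (hsub hx) y (hsub hy)⟩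
  · exact (h.lipschitz x (hsub hx) x' (hsub hx')).trans (by gcongr)
  · refine (h.tangent x (hsub hx)).trans ?_
    have := hω.nonneg (abs_nonneg x)
    gcongr

theorem chartPt_mem_frontier {Ω : Set ℂ} {ζ c : ℂ} (hc : ‖c‖ = 1) {r : ℝ} {φ : ℝ → ℝ}
    (hmem : ∀ x ∈ Ioo (-r) r, ∀ y ∈ Ioo (-r) r, (chartPt ζ c x y ∈ Ω ↔ y < φ x))
    {x : ℝ} (hx : x ∈ Ioo (-r) r) (hφ : φ x ∈ Ioo (-r) r) : chartPt ζ c x (φ x) ∈ frontier Ω := by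
  have hnot : chartPt ζ c x (φ x) ∉ Ω := fun h => lt_irrefl _ ((hmem x hx _ hφ).1 h)
  refine ⟨?_, fun h => hnot (interior_subset h)⟩
  rw [Metric.mem_closure_iff]
  intro e he
  set η := min (e / 2) ((φ x + r) / 2) with hη
  have hη0 : 0 < η := lt_min (by positivity) (by linarith [hφ.1])
  have hη1 : η ≤ e / 2 := min_le_left _ _
  have hη2 : η ≤ (φ x + r) / 2 := min_le_right _ _
  refine ⟨chartPt ζ c x (φ x - η), (hmem x hx _ ⟨by linarith [hφ.1], by linarith [hφ.2]⟩).2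
    (by linarith), ?_⟩
  rw [dist_eq_norm]
  refine (norm_chartPt_sub_le hc _ _ _ _).trans_lt ?_
  rw [sub_self, abs_zero, zero_add, sub_sub_cancel, abs_of_pos hη0]
  linarith

theorem eq_of_chartPt_mem_frontier {Ω : Set ℂ} (hΩ : IsOpen Ω) {ζ c : ℂ} (hc : ‖c‖ = 1) {r : ℝ}
    {φ : ℝ → ℝ} (hφc : ContinuousOn φ (Ioo (-r) r))
    (hmem : ∀ x ∈ Ioo (-r) r, ∀ y ∈ Ioo (-r) r, (chartPt ζ c x y ∈ Ω ↔ y < φ x))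
    {x y : ℝ} (hx : x ∈ Ioo (-r) r) (hy : y ∈ Ioo (-r) r)
    (hf : chartPt ζ c x y ∈ frontier Ω) : y = φ x := by
  rw [hΩ.frontier_eq] at hf
  have h1 : φ x ≤ y := by
    by_contra h
    exact hf.2 ((hmem x hx y hy).2 (not_le.1 h))
  by_contra hne
  have hlt : φ x < y := lt_of_le_of_ne h1 (Ne.symm hne)
  set p := chartPt ζ c x y with hp
  have hcont : Continuous fun u => chartCoord ζ c u := by unfold chartCoord; fun_prop
  have hre : Continuous fun u => (chartCoord ζ c u).re := Complex.continuous_re.comp hcont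
  have him : Continuous fun u => (chartCoord ζ c u).im := Complex.continuous_im.comp hcont
  have hpre : (chartCoord ζ c p).re = x := by rw [hp, chartCoord_chartPt hc]; simp
  have hpim : (chartCoord ζ c p).im = y := by rw [hp, chartCoord_chartPt hc]; simp
  have e1 : ∀ᶠ u in 𝓝 p, (chartCoord ζ c u).re ∈ Ioo (-r) r :=
    hre.continuousAt.eventually_mem (by rw [hpre]; exact isOpen_Ioo.mem_nhds hx)
  have e2 : ∀ᶠ u in 𝓝 p, (chartCoord ζ c u).im ∈ Ioo (-r) r :=
    him.continuousAt.eventually_mem (by rw [hpim]; exact isOpen_Ioo.mem_nhds hy)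
  have hφx : ContinuousAt φ (chartCoord ζ c p).re := by
    rw [hpre]; exact hφc.continuousAt (isOpen_Ioo.mem_nhds hx)
  have e3 : ∀ᶠ u in 𝓝 p, φ (chartCoord ζ c u).re < (chartCoord ζ c u).im := by
    refine Tendsto.eventually_lt
      (ContinuousAt.comp (f := fun u => (chartCoord ζ c u).re) hφx hre.continuousAt)
      him.continuousAt ?_
    simp only [Function.comp_apply, hpre, hpim]
    exact hlt
  obtain ⟨u, hu, h4, h5, h6⟩ := (mem_closure_iff_frequently.1 hf.1).and_eventually
    (e1.and (e2.and e3)) |>.exists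
  rw [← chartPt_chartCoord (ζ := ζ) hc u, hmem _ h4 _ h5] at hu
  exact lt_asymm hu h6

/-- The slope of a line is a Lipschitz function of its unit normal, as long as it is bounded. -/
theorem abs_sub_le_norm_normal_sub {M s s' : ℝ} (hs : |s| ≤ M) (hs' : |s'| ≤ M) :
    |s - s'| ≤ (1 + M) ^ 2 * ‖(-(s : ℂ) + Complex.I) / ((‖-(s : ℂ) + Complex.I‖ : ℝ) : ℂ) -
      (-(s' : ℂ) + Complex.I) / ((‖-(s' : ℂ) + Complex.I‖ : ℝ) : ℂ)‖ := by
  have hM : 0 ≤ M := (abs_nonneg _).trans hs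
  set n := ‖-(s : ℂ) + Complex.I‖ with hn
  set n' := ‖-(s' : ℂ) + Complex.I‖ with hn'
  have him : ∀ t : ℝ, 1 ≤ ‖-(t : ℂ) + Complex.I‖ := fun t => by
    simpa using Complex.abs_im_le_norm (-(t : ℂ) + Complex.I)
  have hn1 : 1 ≤ n := him s
  have hn1' : 1 ≤ n' := him s'
  have hnM : n ≤ 1 + M := by
    refine (norm_add_le _ _).trans ?_
    rw [norm_neg, Complex.norm_real, Complex.norm_I, Real.norm_eq_abs]
    linarith
  set E := (-(s : ℂ) + Complex.I) / (n : ℂ) - (-(s' : ℂ) + Complex.I) / (n' : ℂ) with hE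
  have hre : E.re = -s / n + s' / n' := by
    rw [hE, Complex.sub_re, Complex.div_ofReal_re, Complex.div_ofReal_re]
    simp
    ring
  have him' : E.im = 1 / n - 1 / n' := by
    rw [hE, Complex.sub_im, Complex.div_ofReal_im, Complex.div_ofReal_im]
    simp
  have hid : s - s' = n * (-E.re - s' * E.im) := by
    rw [hre, him']
    field_simp
    ring
  rw [hid, abs_mul, abs_of_pos (by linarith : 0 < n)]
  have h1 : |-E.re - s' * E.im| ≤ (1 + M) * ‖E‖ := by
    calc |-E.re - s' * E.im| ≤ |-E.re| + |s' * E.im| := abs_sub _ _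
      _ = |E.re| + |s'| * |E.im| := by rw [abs_neg, abs_mul]
      _ ≤ ‖E‖ + M * ‖E‖ := by
          gcongr
          · exact Complex.abs_re_le_norm E
          · exact Complex.abs_im_le_norm E
      _ = _ := by ring
  calc n * |-E.re - s' * E.im| ≤ (1 + M) * ((1 + M) * ‖E‖) := by gcongr
    _ = _ := by ring

/-- A chart at `ζ`, translated along the graph, is a chart at every boundary point close to `ζ`. The
modulus of continuity of the normal passes to the derivative of the graph, and from there to the
deviation from the tangent. -/
theorem exists_local_uniformChart {ω : ℝ → ℝ} (hω : IsRegularModulus ω) {Ω : Set ℂ}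
    (hΩ : IsOpen Ω) {ν : ℂ → ℂ} (hν : IsC1BoundaryWithNormal Ω ν)
    (hLip : IsLipschitzClass ω (frontier Ω) ν) {ζ : ℂ} (hζ : ζ ∈ frontier Ω) :
    ∃ R M : ℝ, 0 < R ∧ 1 ≤ M ∧ ∀ ζ₀ ∈ frontier Ω, ζ₀ ∈ Metric.ball ζ R →
      ∃ c φ m, UniformChart ω Ω R M ζ₀ c φ m := by
  obtain ⟨c, r, φ, hchart, hnormal⟩ := hν ζ hζ
  obtain ⟨K, hK⟩ := hLip
  have hr := hchart.r_pos
  have hc := hchart.norm_eq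
  have hmem : ∀ x ∈ Ioo (-r) r, ∀ y ∈ Ioo (-r) r, (chartPt ζ c x y ∈ Ω ↔ y < φ x) :=
    hchart.mem_iff
  have hφc : ContinuousOn φ (Ioo (-r) r) := hchart.contDiffOn.continuousOn
  have h0 : (0 : ℝ) ∈ Ioo (-r) r := ⟨by linarith, hr⟩
  have hφ0 : φ 0 = 0 :=
    (eq_of_chartPt_mem_frontier hΩ hc hφc hmem h0 h0 (by simpa [chartPt] using hζ)).symm
  have hdiff : ∀ x ∈ Ioo (-r) r, DifferentiableAt ℝ φ x := fun x hx =>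
    (hchart.contDiffOn.differentiableOn one_ne_zero).differentiableAt (isOpen_Ioo.mem_nhds hx)
  have hdc : ContinuousOn (deriv φ) (Ioo (-r) r) :=
    hchart.contDiffOn.continuousOn_deriv_of_isOpen isOpen_Ioo le_rfl
  have hIcc : Icc (-(r / 2)) (r / 2) ⊆ Ioo (-r) r := fun x hx =>
    ⟨by linarith [hx.1], by linarith [hx.2]⟩
  obtain ⟨M₁, hM₁⟩ := isCompact_Icc.exists_bound_of_continuousOn (hdc.mono hIcc)
  have hM₁0 : 0 ≤ M₁ := (norm_nonneg _).trans (hM₁ 0 ⟨by linarith, by linarith⟩)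
  obtain ⟨r₂, hr₂, hφr⟩ : ∃ r₂ > 0, ∀ x, |x| < r₂ → |φ x| < r := by
    have h1 : ContinuousAt φ 0 := hφc.continuousAt (isOpen_Ioo.mem_nhds h0)
    obtain ⟨r₂, hr₂, h2⟩ := Metric.continuousAt_iff.1 h1 r hr
    refine ⟨r₂, hr₂, fun x hx => ?_⟩
    simpa [Real.dist_eq, hφ0] using h2 (x := x) (by simpa [Real.dist_eq] using hx)
  set r₁ := min r₂ (r / 2) with hr₁
  have hr₁0 : 0 < r₁ := lt_min hr₂ (by positivity)
  have hr₁2 : r₁ ≤ r / 2 := min_le_right _ _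
  have hI : ∀ x, |x| < r₁ → x ∈ Icc (-(r / 2)) (r / 2) := fun x hx => by
    rw [abs_lt] at hx
    exact ⟨by linarith, by linarith⟩
  have hIr : ∀ x, |x| < r₁ → x ∈ Ioo (-r) r := fun x hx => hIcc (hI x hx)
  have hφI : ∀ x, |x| < r₁ → φ x ∈ Ioo (-r) r := fun x hx =>
    abs_lt.1 (hφr x (hx.trans_le (min_le_left _ _)))
  have hconv : Convex ℝ (Ioo (-r₁) r₁) := convex_Ioo _ _
  have hIoo : ∀ x, x ∈ Ioo (-r₁) r₁ ↔ |x| < r₁ := fun x => abs_lt.symm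
  have hlip1 : ∀ x x', |x| < r₁ → |x'| < r₁ → |φ x - φ x'| ≤ M₁ * |x - x'| := by
    intro x x' hx hx'
    exact hconv.norm_image_sub_le_of_norm_deriv_le (f := φ)
      (fun s hs => hdiff s (hIr s ((hIoo s).1 hs))) (fun s hs => hM₁ s (hI s ((hIoo s).1 hs)))
      ((hIoo x').2 hx') ((hIoo x).2 hx)
  obtain ⟨Cd, hCd1, hCd⟩ := hω.exists_dilation_const (lam := 1 + M₁) (by positivity)
  set M₂ := (1 + M₁) ^ 2 * (|K| * Cd) with hM₂
  have hM₂0 : 0 ≤ M₂ := by positivity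
  have hderiv : ∀ x x', |x| < r₁ → |x'| < r₁ → |deriv φ x - deriv φ x'| ≤ M₂ * ω |x - x'| := by
    intro x x' hx hx'
    rcases eq_or_ne x x' with rfl | hne
    · rw [sub_self, sub_self, abs_zero, hω.map_zero, mul_zero]
    have hpos : 0 < |x - x'| := abs_pos.2 (sub_ne_zero.2 hne)
    have e1 := hnormal x (hIr x hx) (hφI x hx)
    have e2 := hnormal x' (hIr x' hx') (hφI x' hx')
    have h1 := hK _ (chartPt_mem_frontier hc hmem (hIr x hx) (hφI x hx)) _
      (chartPt_mem_frontier hc hmem (hIr x' hx') (hφI x' hx'))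
    have h2 : ‖chartPt ζ c x (φ x) - chartPt ζ c x' (φ x')‖ ≤ (1 + M₁) * |x - x'| := by
      refine (norm_chartPt_sub_le hc _ _ _ _).trans ?_
      linarith [hlip1 x x' hx hx']
    have h3 : ω ‖chartPt ζ c x (φ x) - chartPt ζ c x' (φ x')‖ ≤ Cd * ω |x - x'| :=
      (hω.mono (norm_nonneg _) h2).trans (hCd _ hpos)
    have h4 : 0 ≤ ω ‖chartPt ζ c x (φ x) - chartPt ζ c x' (φ x')‖ := hω.nonneg (norm_nonneg _)
    refine (abs_sub_le_norm_normal_sub (hM₁ x (hI x hx)) (hM₁ x' (hI x' hx'))).trans ?_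
    rw [hM₂, mul_assoc]
    gcongr
    calc _ = ‖ν (chartPt ζ c x (φ x)) - ν (chartPt ζ c x' (φ x'))‖ := by
          simp only [chartPt]
          rw [e1, e2, ← mul_sub, norm_mul, hc, one_mul]
      _ ≤ K * ω ‖chartPt ζ c x (φ x) - chartPt ζ c x' (φ x')‖ := h1
      _ ≤ |K| * (Cd * ω |x - x'|) := by
          gcongr
          exact le_abs_self K
      _ = _ := by ring
  refine ⟨r₁ / 2, 1 + M₁ + M₂, by positivity, by linarith, fun ζ₀ hζ₀ hball => ?_⟩
  rw [Metric.mem_ball, dist_eq_norm] at hball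
  set w := chartCoord ζ c ζ₀ with hw
  have hwn : ‖w‖ < r₁ / 2 := by rw [hw, norm_chartCoord hc]; exact hball
  have hx₀ : |w.re| < r₁ / 2 := (Complex.abs_re_le_norm w).trans_lt hwn
  have hy₀ : |w.im| < r₁ / 2 := (Complex.abs_im_le_norm w).trans_lt hwn
  have hpt : chartPt ζ c w.re w.im = ζ₀ := chartPt_chartCoord hc ζ₀
  have hyφ : w.im = φ w.re := by
    refine eq_of_chartPt_mem_frontier hΩ hc hφc hmem (hIr _ (by linarith)) ?_ (by rwa [hpt])
    exact abs_lt.1 (by linarith)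
  have habs : ∀ x, x ∈ Ioo (-(r₁ / 2)) (r₁ / 2) → |w.re + x| < r₁ := fun x hx => by
    have h1 : |x| < r₁ / 2 := abs_lt.2 hx
    have := abs_add_le w.re x
    linarith
  refine ⟨c, fun x => φ (w.re + x) - φ w.re, deriv φ w.re, hc, by simp, fun x hx x' hx' => ?_, ?_,
    fun x hx => ?_, fun x hx y hy => ?_⟩
  · have h1 := hlip1 _ _ (habs x hx) (habs x' hx')
    have e1 : φ (w.re + x) - φ w.re - (φ (w.re + x') - φ w.re) = φ (w.re + x) - φ (w.re + x') := by
      ring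
    have e2 : w.re + x - (w.re + x') = x - x' := by ring
    rw [e2] at h1
    rw [e1]
    refine h1.trans ?_
    gcongr
    linarith
  · have := hM₁ w.re (hI _ (by linarith))
    rw [Real.norm_eq_abs] at this
    linarith
  · have hωx := hω.nonneg (abs_nonneg x)
    have hseg : ∀ s ∈ uIcc w.re (w.re + x), |s| < r₁ ∧ |s - w.re| ≤ |x| := by
      intro s hs
      have h1 : |s - w.re| ≤ |x| := by simpa using abs_sub_left_of_mem_uIcc hs
      have h2 : |x| < r₁ / 2 := abs_lt.2 hx
      have h3 := abs_add_le w.re (s - w.re)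
      rw [add_sub_cancel] at h3
      exact ⟨by linarith, h1⟩
    have h1 := (convex_uIcc w.re (w.re + x)).norm_image_sub_le_of_norm_hasDerivWithin_le
      (f := fun s => φ s - deriv φ w.re * s) (f' := fun s => deriv φ s - deriv φ w.re)
      (C := M₂ * ω |x|) (x := w.re) (y := w.re + x)
      (fun s hs => by
        have h2 := (hdiff s (hIr s (hseg s hs).1)).hasDerivAt
        have h3 := (hasDerivAt_id s).const_mul (deriv φ w.re)
        rw [mul_one] at h3
        exact (h2.sub h3).hasDerivWithinAt)
      (fun s hs => by
        refine (hderiv s w.re (hseg s hs).1 (by linarith)).trans ?_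
        gcongr
        exact hω.mono (abs_nonneg _) (hseg s hs).2)
      left_mem_uIcc right_mem_uIcc
    rw [Real.norm_eq_abs, Real.norm_eq_abs, add_sub_cancel_left] at h1
    have e1 : φ (w.re + x) - φ w.re - deriv φ w.re * x =
        φ (w.re + x) - deriv φ w.re * (w.re + x) - (φ w.re - deriv φ w.re * w.re) := by ring
    rw [e1]
    refine h1.trans ?_
    calc M₂ * ω |x| * |x| = M₂ * |x| * ω |x| := by ring
      _ ≤ _ := by gcongr; linarith
  · have hy' : |y| < r₁ / 2 := abs_lt.2 hy
    rw [← hpt, chartPt_chartPt, hmem (w.re + x) (hIr _ (habs x hx)) (w.im + y) ?_, hyφ]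
    · constructor <;> intro h <;> linarith
    · rw [mem_Ioo, ← abs_lt]
      have := abs_add_le w.im y
      linarith

/-- By compactness of the boundary the charts may be chosen with uniform parameters. -/
theorem exists_uniformChart {ω : ℝ → ℝ} (hω : IsRegularModulus ω) {Ω : Set ℂ}
    (hΩ : IsOpen Ω) (hΩb : Bornology.IsBounded Ω) (hsmooth : HasC1OmegaBoundary ω Ω) :
    ∃ R M : ℝ, 0 < R ∧ 1 ≤ M ∧ ∀ ζ ∈ frontier Ω, ∃ c φ m, UniformChart ω Ω R M ζ c φ m := by
  obtain ⟨ν, hν, hLip⟩ := hsmooth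
  have hcomp : IsCompact (frontier Ω) := Metric.isCompact_of_isClosed_isBounded isClosed_frontier
    (hΩb.closure.subset frontier_subset_closure)
  let p : Set ℂ → Prop := fun s => ∃ R M : ℝ, 0 < R ∧ 1 ≤ M ∧
    ∀ ζ ∈ frontier Ω, ζ ∈ s → ∃ c φ m, UniformChart ω Ω R M ζ c φ m
  have hp : p (frontier Ω) := by
    refine hcomp.induction_on (p := p) ⟨1, 1, by norm_num, le_rfl, fun ζ _ h => h.elim⟩
      (fun s t hst ⟨R, M, hR, hM, h⟩ => ⟨R, M, hR, hM, fun ζ hζ hs => h ζ hζ (hst hs)⟩) ?_ ?_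
    · rintro s t ⟨R, M, hR, hM, h⟩ ⟨R', M', hR', hM', h'⟩
      refine ⟨min R R', max M M', lt_min hR hR', hM.trans (le_max_left _ _), fun ζ hζ hs => ?_⟩
      rcases hs with hs | hs
      · obtain ⟨c, φ, m, hc⟩ := h ζ hζ hs
        exact ⟨c, φ, m, hc.mono hω.toIsModulus (min_le_left _ _) (le_max_left _ _)⟩
      · obtain ⟨c, φ, m, hc⟩ := h' ζ hζ hs
        exact ⟨c, φ, m, hc.mono hω.toIsModulus (min_le_right _ _) (le_max_right _ _)⟩
    · intro ζ hζ
      obtain ⟨R, M, hR, hM, h⟩ := exists_local_uniformChart hω hΩ hν hLip hζ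
      exact ⟨Metric.ball ζ R, mem_nhdsWithin_of_mem_nhds (Metric.ball_mem_nhds ζ hR), R, M, hR, hM,
        fun ζ₀ h1 h2 => h ζ₀ h1 h2⟩
  obtain ⟨R, M, hR, hM, h⟩ := hp
  exact ⟨R, M, hR, hM, fun ζ hζ => h ζ hζ hζ⟩

/-! ### Points below the boundary graph -/

theorem UniformChart.mem_frontier {ω : ℝ → ℝ} {Ω : Set ℂ} {R M : ℝ} {ζ c : ℂ} {φ : ℝ → ℝ} {m : ℝ}
    (h : UniformChart ω Ω R M ζ c φ m) {x : ℝ} (hx : x ∈ Ioo (-R) R) (hφ : φ x ∈ Ioo (-R) R) :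
    chartPt ζ c x (φ x) ∈ frontier Ω :=
  chartPt_mem_frontier h.norm_eq h.mem_iff hx hφ

theorem UniformChart.abs_graph_le {ω : ℝ → ℝ} {Ω : Set ℂ} {R M : ℝ} {ζ c : ℂ} {φ : ℝ → ℝ} {m : ℝ}
    (h : UniformChart ω Ω R M ζ c φ m) (hR : 0 < R) {x : ℝ} (hx : x ∈ Ioo (-R) R) :
    |φ x| ≤ M * |x| := by
  have := h.lipschitz x hx 0 ⟨by linarith, hR⟩
  rwa [h.map_zero, sub_zero, sub_zero] at this

/-- A point at height `s` below the graph has distance at least `s / (1 + M)` from the complement,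
since the graph is `M`-Lipschitz. -/
theorem UniformChart.le_norm_sub {ω : ℝ → ℝ} {Ω : Set ℂ} {R M : ℝ} {ζ c : ℂ} {φ : ℝ → ℝ} {m : ℝ}
    (h : UniformChart ω Ω R M ζ c φ m) (hR : 0 < R) (hM : 1 ≤ M) {x s : ℝ} (hs : 0 < s)
    (hsize : (1 + M) * |x| + 2 * s < R) {u : ℂ} (hu : u ∉ Ω) :
    1 / (1 + M) * s ≤ ‖u - chartPt ζ c x (φ x - s)‖ := by
  by_contra hlt
  rw [not_le] at hlt
  have hM' : (0 : ℝ) < 1 + M := by linarith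
  have hx0 := abs_nonneg x
  have hMx : 0 ≤ M * |x| := by positivity
  have hx : x ∈ Ioo (-R) R := abs_lt.1 (by nlinarith)
  have hφ := h.abs_graph_le hR hx
  set w := chartCoord ζ c u with hw
  have hupt : chartPt ζ c w.re w.im = u := chartPt_chartCoord h.norm_eq u
  rw [← hupt] at hlt hu
  obtain ⟨h1, h2⟩ := abs_sub_le_norm_chartPt_sub (ζ := ζ) h.norm_eq w.re w.im x (φ x - s)
  have h3 : 1 / (1 + M) * s ≤ s := by
    rw [one_div, inv_mul_le_iff₀ hM']
    nlinarith
  have h4 : (1 + M) * ‖chartPt ζ c w.re w.im - chartPt ζ c x (φ x - s)‖ < s := by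
    have := mul_lt_mul_of_pos_left hlt hM'
    rwa [← mul_assoc, mul_one_div_cancel hM'.ne', one_mul] at this
  have hwx : w.re ∈ Ioo (-R) R := by
    rw [mem_Ioo, ← abs_lt]
    have := abs_add_le (w.re - x) x
    rw [sub_add_cancel] at this
    nlinarith
  have hwy : w.im ∈ Ioo (-R) R := by
    rw [mem_Ioo, ← abs_lt]
    have e1 := abs_add_le (w.im - (φ x - s)) (φ x - s)
    have e2 := abs_sub (φ x) s
    rw [abs_of_pos hs] at e2
    rw [sub_add_cancel] at e1
    nlinarith
  rw [h.mem_iff _ hwx _ hwy, not_lt] at hu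
  have h5 := (abs_le.1 (h.lipschitz _ hwx x hx)).1
  have h6 := (abs_le.1 h2).2
  have h7 : M * |w.re - x| ≤ M * ‖chartPt ζ c w.re w.im - chartPt ζ c x (φ x - s)‖ := by gcongr
  linarith

theorem norm_chartPt_sub_graph {ζ c : ℂ} (hc : ‖c‖ = 1) (x y s : ℝ) :
    ‖chartPt ζ c x (y - s) - chartPt ζ c x y‖ ≤ |s| := by
  refine (norm_chartPt_sub_le hc _ _ _ _).trans ?_
  rw [sub_self, abs_zero, zero_add, sub_sub_cancel_left, abs_neg]

theorem ne_univ_of_isBounded {Ω : Set ℂ} (hΩb : Bornology.IsBounded Ω) : Ω ≠ univ := by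
  rintro rfl
  exact NormedSpace.unbounded_univ ℝ ℂ hΩb

theorem infDist_compl_pos {Ω : Set ℂ} (hΩ : IsOpen Ω) (hΩb : Bornology.IsBounded Ω) {z : ℂ}
    (hz : z ∈ Ω) : 0 < Metric.infDist z Ωᶜ := by
  have hne : Ωᶜ.Nonempty := nonempty_compl.2 (ne_univ_of_isBounded hΩb)
  exact (hΩ.isClosed_compl.notMem_iff_infDist_pos hne).1 (by simpa using hz)

theorem infDist_compl_le {Ω : Set ℂ} {z u : ℂ} (hu : u ∉ Ω) : Metric.infDist z Ωᶜ ≤ ‖u - z‖ := by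
  rw [← dist_eq_norm, dist_comm]
  exact Metric.infDist_le_dist_of_mem hu

theorem ball_subset_of_le {Ω : Set ℂ} {z : ℂ} {r : ℝ} (h : ∀ u ∉ Ω, r ≤ ‖u - z‖) :
    Metric.ball z r ⊆ Ω := by
  intro u hu
  by_contra hn
  rw [Metric.mem_ball, dist_eq_norm] at hu
  linarith [h u hn]

/-- Every disc centred in `Ω` contains a disc of comparable radius lying in `Ω`. -/
theorem exists_hasDensity {ω : ℝ → ℝ} (hω : IsRegularModulus ω) {Ω : Set ℂ} (hΩ : IsOpen Ω)
    (hΩb : Bornology.IsBounded Ω) (hsmooth : HasC1OmegaBoundary ω Ω) {D : ℝ} (hD : 0 < D) :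
    ∃ κ : ℝ, 0 < κ ∧ HasDensity Ω κ D := by
  obtain ⟨R, M, hR, hM, hchart⟩ := exists_uniformChart hω hΩ hΩb hsmooth
  have hM' : (0 : ℝ) < 1 + M := by linarith
  have key : ∀ z ∈ Ω, ∀ ρ : ℝ, 0 < ρ → ρ ≤ R → ∃ p : ℂ,
      Metric.ball p (1 / (1 + M) * (ρ / 4)) ⊆ Metric.closedBall z ρ ∩ Ω := by
    intro z hz ρ hρ hρR
    have hle : 1 / (1 + M) * (ρ / 4) ≤ ρ / 4 := by
      rw [one_div, inv_mul_le_iff₀ hM']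
      nlinarith
    rcases le_or_gt (ρ / 4) (Metric.infDist z Ωᶜ) with h | h
    · refine ⟨z, subset_inter (Metric.ball_subset_closedBall.trans
        (Metric.closedBall_subset_closedBall (by linarith))) (ball_subset_of_le fun u hu => ?_)⟩
      exact hle.trans (h.trans (infDist_compl_le hu))
    · obtain ⟨ζ, hζ, hdist⟩ := exists_mem_frontier_infDist_compl_eq_dist hz
        (ne_univ_of_isBounded hΩb)
      obtain ⟨c, φ, m, hU⟩ := hchart ζ hζ
      have hζ0 : chartPt ζ c 0 (φ 0) = ζ := by simp [chartPt, hU.map_zero]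
      refine ⟨chartPt ζ c 0 (φ 0 - ρ / 4), subset_inter (fun u hu => ?_)
        (ball_subset_of_le fun u hu => hU.le_norm_sub hR hM (by positivity) ?_ hu)⟩
      · have h1 := norm_chartPt_sub_graph (ζ := ζ) hU.norm_eq 0 (φ 0) (ρ / 4)
        rw [hζ0, abs_of_pos (by positivity), ← dist_eq_norm] at h1
        rw [Metric.mem_ball] at hu
        rw [Metric.mem_closedBall]
        have h2 := dist_triangle4 u (chartPt ζ c 0 (φ 0 - ρ / 4)) ζ z
        rw [hdist, dist_comm] at h
        linarith
      · rw [abs_zero, mul_zero, zero_add]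
        linarith
  set a := 1 / (1 + M) * (1 / 4) with ha
  have ha0 : 0 < a := by positivity
  set b := min 1 (R / D) with hb
  have hb0 : 0 < b := lt_min one_pos (by positivity)
  refine ⟨(a * b) ^ 2, by positivity, fun z hz ρ hρ hρD => ?_⟩
  obtain ⟨p, hp⟩ := key z hz (b * ρ) (by positivity) (by
    calc b * ρ ≤ R / D * D := by gcongr; exact min_le_right _ _
      _ = R := div_mul_cancel₀ _ hD.ne')
  have hsub : Metric.closedBall z (b * ρ) ⊆ Metric.closedBall z ρ :=
    Metric.closedBall_subset_closedBall (by nlinarith [min_le_left 1 (R / D)])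
  refine le_trans ?_ (measure_mono (hp.trans (inter_subset_inter_left _ hsub)))
  rw [Complex.volume_ball]
  calc ENNReal.ofReal ((a * b) ^ 2 * ρ ^ 2) =
        ENNReal.ofReal (1 / (1 + M) * (b * ρ / 4)) ^ 2 * 1 := by
        rw [← ENNReal.ofReal_pow (by positivity), mul_one]
        congr 1
        rw [ha]
        ring
    _ ≤ _ := by
        gcongr
        rw [ENNReal.one_le_coe_iff, ← NNReal.coe_le_coe]
        exact (by norm_num : (1 : ℝ) ≤ 3).trans Real.pi_gt_three.le

/-! ### Integration in rotated coordinates -/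

/-- The rotated coordinates as a measurable equivalence. -/
noncomputable def chartEquiv (ζ : ℂ) (c : Circle) : ℝ × ℝ ≃ᵐ ℂ :=
  (Complex.measurableEquivRealProd.symm.trans
    (rotation c).toHomeomorph.toMeasurableEquiv).trans (MeasurableEquiv.addLeft ζ)

theorem chartEquiv_apply (ζ : ℂ) (c : Circle) (p : ℝ × ℝ) :
    chartEquiv ζ c p = chartPt ζ c p.1 p.2 := by
  have h : Complex.measurableEquivRealProd.symm p = (p.1 : ℂ) + (p.2 : ℂ) * Complex.I := by
    rw [← Complex.mk_eq_add_mul_I]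
    rfl
  change ζ + c * Complex.measurableEquivRealProd.symm p = _
  rw [h, chartPt]

theorem measurePreserving_chartEquiv (ζ : ℂ) (c : Circle) :
    MeasurePreserving (chartEquiv ζ c) volume volume :=
  (measurePreserving_add_left volume ζ).comp
    ((rotation c).measurePreserving.comp Complex.volume_preserving_equiv_real_prod.symm)

theorem measurePreserving_chartPt (ζ : ℂ) {c : ℂ} (hc : ‖c‖ = 1) :
    MeasurePreserving (fun p : ℝ × ℝ => chartPt ζ c p.1 p.2) volume volume ∧
      MeasurableEmbedding (fun p : ℝ × ℝ => chartPt ζ c p.1 p.2) := by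
  obtain ⟨a, rfl⟩ : ∃ a : Circle, (a : ℂ) = c := ⟨⟨c, mem_sphere_zero_iff_norm.2 hc⟩, rfl⟩
  have h : (fun p : ℝ × ℝ => chartPt ζ a p.1 p.2) = chartEquiv ζ a := by
    funext p
    rw [chartEquiv_apply]
  rw [h]
  exact ⟨measurePreserving_chartEquiv _ _, MeasurableEquiv.measurableEmbedding _⟩

/-- One half of Tonelli's theorem, valid without any measurability. -/
theorem lintegral_le_lintegral_chartPt (ζ : ℂ) {c : ℂ} (hc : ‖c‖ = 1) (f : ℂ → ℝ≥0∞) :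
    ∫⁻ u, f u ≤ ∫⁻ x : ℝ, ∫⁻ y : ℝ, f (chartPt ζ c x y) := by
  obtain ⟨h1, h2⟩ := measurePreserving_chartPt ζ hc
  rw [← h1.lintegral_comp_emb h2]
  exact lintegral_prod_le _

/-! ### The transform of the characteristic function as an integral over the complement -/

/-- The difference of the Beurling kernels with poles `z` and `z'`. -/
noncomputable def kernelDiff (z z' u : ℂ) : ℂ := 1 / (z - u) ^ 2 - 1 / (z' - u) ^ 2

theorem measurable_kernelDiff (z z' : ℂ) : Measurable (kernelDiff z z') := by
  unfold kernelDiff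
  fun_prop

/-- Cubic decay of the difference of the kernels, when both poles have distance comparable to `t`
from `u` and at most comparable to `t` from `a`. -/
theorem norm_kernelDiff_le {a z z' u : ℂ} {t κ Λ : ℝ} (ht : 0 < t) (hκ : 0 < κ)
    (hz : ‖z - a‖ ≤ Λ * t) (hz' : ‖z' - a‖ ≤ Λ * t) (hu : κ * t ≤ ‖u - z‖)
    (hu' : κ * t ≤ ‖u - z'‖) :
    ‖kernelDiff z z' u‖ ≤ 2 * (1 + (1 + Λ) / κ) ^ 3 * ‖z - z'‖ / (t + ‖u - a‖) ^ 3 := by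
  have hΛ : 0 ≤ Λ := by
    by_contra h
    nlinarith [norm_nonneg (z - a)]
  have key : ∀ p, ‖p - a‖ ≤ Λ * t → κ * t ≤ ‖u - p‖ →
      t + ‖u - a‖ ≤ (1 + (1 + Λ) / κ) * ‖p - u‖ := by
    intro p hp hup
    have h1 := norm_add_le (u - p) (p - a)
    rw [sub_add_sub_cancel] at h1
    have h2 : (1 + Λ) * t ≤ (1 + Λ) / κ * ‖u - p‖ := by
      calc (1 + Λ) * t = (1 + Λ) / κ * (κ * t) := by field_simp
        _ ≤ _ := by gcongr
    rw [norm_sub_rev p u]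
    linarith
  have h := norm_inv_sq_sub_inv_sq_le (by positivity) (key z hz hu) (key z' hz' hu')
  rwa [sub_sub_sub_cancel_right] at h

theorem integrable_one_div_add_norm_cube (a : ℂ) {t : ℝ} (ht : 0 < t) :
    Integrable fun u : ℂ => 1 / (t + ‖u - a‖) ^ 3 := by
  have h0 : Integrable fun u : ℂ => (1 + ‖u‖) ^ (-(3 : ℝ)) :=
    integrable_one_add_norm (by rw [Complex.finrank_real_complex]; norm_num)
  have h1 := (h0.comp_sub_right a).const_mul ((min t 1)⁻¹ ^ 3)
  have hm : 0 < min t 1 := lt_min ht one_pos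
  refine h1.mono' (by apply Measurable.aestronglyMeasurable; fun_prop)
    (Eventually.of_forall fun u => ?_)
  have hn := norm_nonneg (u - a)
  have h2 : min t 1 * (1 + ‖u - a‖) ≤ t + ‖u - a‖ := by
    have := min_le_left t 1
    have := min_le_right t 1
    nlinarith
  rw [Real.norm_of_nonneg (by positivity), Real.rpow_neg (by positivity),
    show (3 : ℝ) = ((3 : ℕ) : ℝ) by norm_num, Real.rpow_natCast, ← inv_pow, ← mul_pow,
    one_div, ← inv_pow, ← mul_inv]
  gcongr

theorem integrableOn_kernelDiff {a z z' : ℂ} {t κ Λ : ℝ} (ht : 0 < t) (hκ : 0 < κ)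
    (hz : ‖z - a‖ ≤ Λ * t) (hz' : ‖z' - a‖ ≤ Λ * t) {S : Set ℂ} (hS : MeasurableSet S)
    (hu : ∀ u ∈ S, κ * t ≤ ‖u - z‖) (hu' : ∀ u ∈ S, κ * t ≤ ‖u - z'‖) :
    IntegrableOn (kernelDiff z z') S := by
  have h := ((integrable_one_div_add_norm_cube a ht).const_mul
    (2 * (1 + (1 + Λ) / κ) ^ 3 * ‖z - z'‖)).integrableOn (s := S)
  refine h.mono' (measurable_kernelDiff z z').aestronglyMeasurable
    ((ae_restrict_iff' hS).2 (Eventually.of_forall fun u hus => ?_))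
  rw [mul_one_div]
  exact norm_kernelDiff_le ht hκ hz hz' (hu u hus) (hu' u hus)

/-- As the kernel has mean zero on annuli, the integral over `Ω` may be replaced by an absolutely
convergent one over the complement. -/
theorem beurling_indicator_one_eq {Ω : Set ℂ} (hΩ : IsOpen Ω) {z : ℂ} (hz : z ∈ Ω) {L : ℝ}
    (hL : Ω ⊆ Metric.closedBall z L) :
    beurling (Ω.indicator fun _ => (1 : ℂ)) z =
      1 / (Real.pi : ℂ) * ∫ u in Metric.closedBall z L \ Ω, 1 / (z - u) ^ 2 := by
  obtain ⟨d, hd, hdΩ⟩ := Metric.nhds_basis_closedBall.mem_iff.1 (hΩ.mem_nhds hz)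
  refine Tendsto.limUnder_eq (tendsto_const_nhds.congr' ?_)
  filter_upwards [Ioo_mem_nhdsGT hd] with δ hδ
  set A := {u : ℂ | δ < ‖z - u‖ ∧ ‖z - u‖ ≤ L} with hA
  have e1 : (fun u => Ω.indicator (fun _ => (1 : ℂ)) u * (1 / (z - u) ^ 2)) =
      Ω.indicator fun u => 1 / (z - u) ^ 2 := by
    funext u
    by_cases hu : u ∈ Ω <;> simp [hu]
  have hmem : ∀ u, u ∈ Metric.closedBall z L ↔ ‖z - u‖ ≤ L := fun u => by
    rw [Metric.mem_closedBall, dist_comm, dist_eq_norm]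
  have e2 : {u : ℂ | δ < ‖z - u‖} ∩ Ω = A ∩ Ω := by
    ext u
    exact ⟨fun h => ⟨⟨h.1, (hmem u).1 (hL h.2)⟩, h.2⟩, fun h => ⟨h.1.1, h.2⟩⟩
  have e3 : Metric.closedBall z L \ Ω = A \ Ω := by
    ext u
    refine ⟨fun h => ⟨⟨?_, (hmem u).1 h.1⟩, h.2⟩, fun h => ⟨(hmem u).2 h.1.2, h.2⟩⟩
    by_contra hn
    refine h.2 (hdΩ ?_)
    rw [Metric.mem_closedBall, dist_comm, dist_eq_norm]
    exact (not_lt.1 hn).trans hδ.2.le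
  rw [truncatedBeurling_eq, e1, setIntegral_indicator hΩ.measurableSet, e2, e3]
  have h := integral_inter_add_sdiff hΩ.measurableSet
    (integrableOn_annulus_inv_sq z (δ' := δ) (δ := L) hδ.1)
  rw [setIntegral_annulus_translate] at h
  linear_combination (1 / (Real.pi : ℂ)) * h

/-- The difference of the kernels decays cubically, so the discs of `beurling_indicator_one_eq` may
be exhausted. -/
theorem beurling_sub_eq {Ω : Set ℂ} (hΩ : IsOpen Ω) (hΩb : Bornology.IsBounded Ω) {z z' : ℂ}
    (hz : z ∈ Ω) (hz' : z' ∈ Ω) :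
    beurling (Ω.indicator fun _ => (1 : ℂ)) z - beurling (Ω.indicator fun _ => (1 : ℂ)) z' =
      1 / (Real.pi : ℂ) * ∫ u in Ωᶜ, kernelDiff z z' u := by
  set F := beurling (Ω.indicator fun _ => (1 : ℂ)) with hF
  set h := ‖z - z'‖ with hh
  have hh0 : 0 ≤ h := norm_nonneg _
  set t := min (Metric.infDist z Ωᶜ) (Metric.infDist z' Ωᶜ) with ht
  have ht0 : 0 < t := lt_min (infDist_compl_pos hΩ hΩb hz) (infDist_compl_pos hΩ hΩb hz')
  have hu : ∀ u ∈ Ωᶜ, 1 * t ≤ ‖u - z‖ := fun u hu => by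
    rw [one_mul]; exact (min_le_left _ _).trans (infDist_compl_le hu)
  have hu' : ∀ u ∈ Ωᶜ, 1 * t ≤ ‖u - z'‖ := fun u hu => by
    rw [one_mul]; exact (min_le_right _ _).trans (infDist_compl_le hu)
  have hint : IntegrableOn (kernelDiff z z') Ωᶜ :=
    integrableOn_kernelDiff (a := z) (Λ := h / t) ht0 one_pos (by simp; positivity)
      (by rw [div_mul_cancel₀ _ ht0.ne', norm_sub_rev]) hΩ.measurableSet.compl hu hu'
  have hcover := (aecover_closedBall (μ := volume.restrict Ωᶜ) (x := z)
    (tendsto_id (α := ℝ) (x := atTop))).integral_tendsto_of_countably_generated hint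
  have hlim := hcover.const_mul (1 / (Real.pi : ℂ))
  refine tendsto_nhds_unique ?_ hlim
  obtain ⟨L₀, hL₀⟩ := hΩb.subset_closedBall z
  -- replacing the disc about `z'` by the disc about `z` costs `O(1 / L)`
  have hbound : ∀ᶠ L : ℝ in atTop, ‖F z - F z' -
      1 / (Real.pi : ℂ) * ∫ u in Metric.closedBall z (id L), kernelDiff z z' u
        ∂(volume.restrict Ωᶜ)‖ ≤ 12 * h / L := by
    filter_upwards [eventually_ge_atTop L₀, eventually_ge_atTop (2 * h), eventually_gt_atTop 0]
      with L h1 h2 h3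
    have hsubL : Ω ⊆ Metric.closedBall z L :=
      hL₀.trans (Metric.closedBall_subset_closedBall h1)
    have hsub2 : Metric.closedBall z L ⊆ Metric.closedBall z' (L + h) := by
      apply Metric.closedBall_subset_closedBall'
      rw [dist_eq_norm]
    have e1 := beurling_indicator_one_eq hΩ hz hsubL
    have e2 := beurling_indicator_one_eq hΩ hz' (hsubL.trans hsub2)
    have hset : Metric.closedBall z' (L + h) \ Ω =
        (Metric.closedBall z L \ Ω) ∪ (Metric.closedBall z' (L + h) \ Metric.closedBall z L) := by
      ext u
      constructor
      · intro hu
        by_cases hm : u ∈ Metric.closedBall z L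
        · exact Or.inl ⟨hm, hu.2⟩
        · exact Or.inr ⟨hu.1, hm⟩
      · rintro (hu | hu)
        · exact ⟨hsub2 hu.1, hu.2⟩
        · exact ⟨hu.1, fun hm => hu.2 (hsubL hm)⟩
    have hfin : ∀ (p : ℂ) (r : ℝ), (∀ u ∈ Ωᶜ, 1 * t ≤ ‖u - p‖) → ∀ q : ℂ,
        IntegrableOn (fun u => 1 / (p - u) ^ 2) (Metric.closedBall q r \ Ω) := by
      intro p r hp q
      refine Measure.integrableOn_of_bounded (M := 1 / t ^ 2)
        (ne_top_of_le_ne_top (measure_closedBall_lt_top (x := q) (r := r)).ne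
          (measure_mono sdiff_subset)) (by apply Measurable.aestronglyMeasurable; fun_prop) ?_
      refine (ae_restrict_iff' (measurableSet_closedBall.diff hΩ.measurableSet)).2
        (Eventually.of_forall fun u hu => ?_)
      have := hp u hu.2
      rw [one_mul, norm_sub_rev] at this
      rw [norm_div, norm_one, norm_pow]
      gcongr
    have hI := hfin z L hu z
    have hI' := hfin z' L hu' z
    have hI2 := hfin z' (L + h) hu' z'
    have e3 : ∫ u in Metric.closedBall z' (L + h) \ Ω, 1 / (z' - u) ^ 2 =
        (∫ u in Metric.closedBall z L \ Ω, 1 / (z' - u) ^ 2) +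
          ∫ u in Metric.closedBall z' (L + h) \ Metric.closedBall z L, 1 / (z' - u) ^ 2 := by
      rw [hset, setIntegral_union _ (measurableSet_closedBall.diff measurableSet_closedBall) hI'
        (hI2.mono_set (by rw [hset]; exact subset_union_right))]
      rw [Set.disjoint_left]
      exact fun u hu hv => hv.2 hu.1
    have e4 : ∫ u in Metric.closedBall z (id L), kernelDiff z z' u ∂(volume.restrict Ωᶜ) =
        (∫ u in Metric.closedBall z L \ Ω, 1 / (z - u) ^ 2) -
          ∫ u in Metric.closedBall z L \ Ω, 1 / (z' - u) ^ 2 := by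
      rw [Measure.restrict_restrict measurableSet_closedBall, id, ← sdiff_eq, ← integral_sub hI hI']
      rfl
    have e5 : F z - F z' - 1 / (Real.pi : ℂ) * ∫ u in Metric.closedBall z (id L),
        kernelDiff z z' u ∂(volume.restrict Ωᶜ) = -(1 / (Real.pi : ℂ)) *
        ∫ u in Metric.closedBall z' (L + h) \ Metric.closedBall z L, 1 / (z' - u) ^ 2 := by
      rw [e4, hF, e1, e2, e3]
      ring
    have hvol : volume.real (Metric.closedBall z' (L + h) \ Metric.closedBall z L) =
        Real.pi * (2 * L * h + h ^ 2) := by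
      rw [measureReal_sdiff hsub2 measurableSet_closedBall measure_closedBall_lt_top.ne]
      simp only [measureReal_def, Complex.volume_closedBall, ENNReal.toReal_mul,
        ENNReal.toReal_pow, ENNReal.toReal_ofReal h3.le,
        ENNReal.toReal_ofReal (add_nonneg h3.le hh0), ENNReal.coe_toReal, NNReal.coe_real_pi]
      ring
    have h4 : ‖∫ u in Metric.closedBall z' (L + h) \ Metric.closedBall z L, 1 / (z' - u) ^ 2‖ ≤
        1 / (L / 2) ^ 2 * volume.real (Metric.closedBall z' (L + h) \ Metric.closedBall z L) := by
      refine norm_setIntegral_le_of_norm_le_const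
        ((measure_mono sdiff_subset).trans_lt measure_closedBall_lt_top) fun u hu => ?_
      have h5 : L < ‖u - z‖ := by
        have := hu.2
        rwa [Metric.mem_closedBall, not_le, dist_eq_norm] at this
      have h6 := norm_add_le (u - z') (z' - z)
      rw [sub_add_sub_cancel, norm_sub_rev z' z, norm_sub_rev u z'] at h6
      rw [norm_div, norm_one, norm_pow]
      have h7 : L / 2 ≤ ‖z' - u‖ := by linarith
      gcongr
    rw [e5, norm_mul, norm_neg, norm_div, norm_one, Complex.norm_real,
      Real.norm_of_nonneg Real.pi_pos.le]
    rw [hvol] at h4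
    calc _ ≤ 1 / Real.pi * (1 / (L / 2) ^ 2 * (Real.pi * (2 * L * h + h ^ 2))) := by
          have := Real.pi_pos
          gcongr
      _ = 4 * (2 * L * h + h * h) / L ^ 2 := by
          have := Real.pi_pos
          field_simp
          ring
      _ ≤ 4 * (2 * L * h + h * L) / L ^ 2 := by
          gcongr
          linarith
      _ = _ := by
          field_simp
          ring
  have hzero : Tendsto (fun L : ℝ => 12 * h / L) atTop (𝓝 0) :=
    tendsto_const_nhds.div_atTop tendsto_id
  have h8 := squeeze_zero_norm' hbound hzero
  have h9 := (tendsto_const_nhds (x := F z - F z')).sub h8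
  simpa using h9

/-! ### Cancellation over half-planes -/

theorem tendsto_inv_sub_chartPt {ζ c : ℂ} (hc : ‖c‖ = 1) (z : ℂ) (y : ℝ) {l : Filter ℝ}
    (hl : Tendsto (fun x : ℝ => |x|) l atTop) :
    Tendsto (fun x => (z - chartPt ζ c x y)⁻¹) l (𝓝 0) := by
  refine tendsto_inv₀_cobounded.comp (tendsto_norm_atTop_iff_cobounded.1 ?_)
  refine tendsto_atTop_mono (f := fun x => |x| - |(chartCoord ζ c z).re|) (fun x => ?_)
    (tendsto_atTop_add_const_right _ _ hl)
  have h := (abs_sub_le_norm_chartPt_sub (ζ := ζ) hc x y (chartCoord ζ c z).re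
    (chartCoord ζ c z).im).1
  rw [chartPt_chartCoord hc, norm_sub_rev] at h
  exact (abs_sub_abs_le_abs_sub _ _).trans h

/-- On lines which avoid both poles, the kernel is the derivative of a function vanishing at
infinity. -/
theorem integral_line_kernelDiff {ζ c : ℂ} (hc : ‖c‖ = 1) {z z' : ℂ} {y : ℝ}
    (hz : ∀ x, chartPt ζ c x y ≠ z) (hz' : ∀ x, chartPt ζ c x y ≠ z') :
    ∫ x : ℝ, kernelDiff z z' (chartPt ζ c x y) = 0 := by
  -- a function which is not integrable has integral zero by convention
  by_cases hint : Integrable fun x : ℝ => kernelDiff z z' (chartPt ζ c x y)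
  swap
  · exact integral_undef hint
  have hc0 : c ≠ 0 := fun h => by simp [h] at hc
  have hline : ∀ x : ℝ, HasDerivAt (fun x : ℝ => chartPt ζ c x y) c x := fun x => by
    have h1 := (((Complex.ofRealCLM.hasDerivAt (x := x)).add_const
      ((y : ℂ) * Complex.I)).const_mul c).const_add ζ
    simpa [chartPt] using h1
  have hinv : ∀ p : ℂ, (∀ x, chartPt ζ c x y ≠ p) → ∀ x : ℝ,
      HasDerivAt (fun x : ℝ => (p - chartPt ζ c x y)⁻¹)
        (c * (1 / (p - chartPt ζ c x y) ^ 2)) x := by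
    intro p hp x
    have h1 := ((hline x).const_sub p).fun_inv (sub_ne_zero.2 (hp x).symm)
    rwa [neg_neg, div_eq_mul_one_div] at h1
  have hder : ∀ x : ℝ, HasDerivAt
      (fun x : ℝ => c⁻¹ * ((z - chartPt ζ c x y)⁻¹ - (z' - chartPt ζ c x y)⁻¹))
      (kernelDiff z z' (chartPt ζ c x y)) x := fun x => by
    have h1 := ((hinv z hz x).sub (hinv z' hz' x)).const_mul c⁻¹
    rwa [← mul_sub, inv_mul_cancel_left₀ hc0] at h1
  have hlim : ∀ l : Filter ℝ, Tendsto (fun x : ℝ => |x|) l atTop → Tendsto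
      (fun x : ℝ => c⁻¹ * ((z - chartPt ζ c x y)⁻¹ - (z' - chartPt ζ c x y)⁻¹)) l (𝓝 0) := by
    intro l hl
    simpa using ((tendsto_inv_sub_chartPt (ζ := ζ) hc z y hl).sub
      (tendsto_inv_sub_chartPt hc z' y hl)).const_mul c⁻¹
  rw [integral_of_hasDerivAt_of_tendsto hder hint (hlim _ tendsto_abs_atBot_atTop)
    (hlim _ tendsto_abs_atTop_atTop), sub_zero]

theorem measurableSet_halfPlane (ζ c : ℂ) : MeasurableSet {u : ℂ | 0 ≤ (chartCoord ζ c u).im} := by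
  have : Measurable fun u => (chartCoord ζ c u).im := by
    unfold chartCoord
    exact Complex.measurable_im.comp (by fun_prop)
  exact measurableSet_le measurable_const this

/-- The half-plane is foliated by lines parallel to its boundary, over each of which the kernel has
integral zero. -/
theorem setIntegral_halfPlane_kernelDiff {ζ c : ℂ} (hc : ‖c‖ = 1) {z z' : ℂ}
    (hz : (chartCoord ζ c z).im < 0) (hz' : (chartCoord ζ c z').im < 0)
    (hint : IntegrableOn (kernelDiff z z') {u : ℂ | 0 ≤ (chartCoord ζ c u).im}) :
    ∫ u in {u : ℂ | 0 ≤ (chartCoord ζ c u).im}, kernelDiff z z' u = 0 := by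
  obtain ⟨h1, h2⟩ := measurePreserving_chartPt ζ hc
  have him : ∀ x y : ℝ, (chartCoord ζ c (chartPt ζ c x y)).im = y := fun x y => by
    rw [chartCoord_chartPt hc]; simp
  have hpre : (fun p : ℝ × ℝ => chartPt ζ c p.1 p.2) ⁻¹' {u : ℂ | 0 ≤ (chartCoord ζ c u).im} =
      univ ×ˢ Ici 0 := by
    ext p
    simp [him]
  rw [← h1.setIntegral_preimage_emb h2, hpre]
  have hint' : IntegrableOn (fun p : ℝ × ℝ => kernelDiff z z' (chartPt ζ c p.1 p.2))
      (univ ×ˢ Ici 0) := by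
    rw [← hpre]
    exact (h1.integrableOn_comp_preimage h2).2 hint
  rw [IntegrableOn, Measure.volume_eq_prod, ← Measure.prod_restrict] at hint'
  rw [Measure.volume_eq_prod, ← Measure.prod_restrict, integral_prod_symm _ hint']
  refine setIntegral_eq_zero_of_forall_eq_zero fun y hy => ?_
  rw [Measure.restrict_univ]
  have hne : ∀ p : ℂ, (chartCoord ζ c p).im < 0 → ∀ x, chartPt ζ c x y ≠ p := by
    rintro p hp x rfl
    rw [him] at hp
    exact absurd hy (not_le.2 hp)
  exact integral_line_kernelDiff hc (hne z hz) (hne z' hz')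

/-! ### Comparison with the tangent half-plane -/

/-- The complement of the tangent half-plane, in the chart centred at `ζ` with direction `c`, for
the slope `m`. -/
def aboveTangent (ζ c : ℂ) (m : ℝ) : Set ℂ :=
  {u : ℂ | m * (chartCoord ζ c u).re ≤ (chartCoord ζ c u).im}

/-- A half-plane bounded by a sloping line is an upper half-plane in a rotated frame. -/
theorem exists_aboveTangent_eq (ζ : ℂ) {c : ℂ} (hc : ‖c‖ = 1) (m : ℝ) :
    ∃ c' : ℂ, ‖c'‖ = 1 ∧ ∀ u, 0 ≤ (chartCoord ζ c' u).im ↔ u ∈ aboveTangent ζ c m := by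
  set a : ℂ := 1 + (m : ℂ) * Complex.I with ha
  have hn : 0 < ‖a‖ := by
    rw [norm_pos_iff]
    intro h
    have := congrArg Complex.re h
    simp [ha] at this
  refine ⟨c * a * ((‖a‖⁻¹ : ℝ) : ℂ), ?_, fun u => ?_⟩
  · rw [norm_mul, norm_mul, hc, one_mul, Complex.norm_real, Real.norm_of_nonneg (by positivity),
      mul_inv_cancel₀ hn.ne']
  · have h1 : chartCoord ζ (c * a * ((‖a‖⁻¹ : ℝ) : ℂ)) u =
        ((‖a‖⁻¹ : ℝ) : ℂ) * ((starRingEnd ℂ) a * chartCoord ζ c u) := by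
      simp only [chartCoord, map_mul, Complex.conj_ofReal]
      ring
    have h2 : ((starRingEnd ℂ) a * chartCoord ζ c u).im =
        (chartCoord ζ c u).im - m * (chartCoord ζ c u).re := by
      simp [ha, Complex.mul_im]
      ring
    rw [h1, Complex.im_ofReal_mul, h2, mul_nonneg_iff_of_pos_left (by positivity), sub_nonneg]
    rfl

theorem measurableSet_aboveTangent (ζ : ℂ) {c : ℂ} (hc : ‖c‖ = 1) (m : ℝ) :
    MeasurableSet (aboveTangent ζ c m) := by
  obtain ⟨c', -, h⟩ := exists_aboveTangent_eq ζ hc m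
  convert measurableSet_halfPlane ζ c' using 1
  ext u
  exact (h u).symm

/-- The set between the graph and its tangent has vertical thickness at most `M |x| ω(|x|)`, so
that its contribution to the integral of the kernel decays. -/
theorem lintegral_strip_le {ω : ℝ → ℝ} (hω : IsRegularModulus ω) :
    ∃ C : ℝ, 0 < C ∧ ∀ (M : ℝ) (ζ c : ℂ) (m t : ℝ), 0 ≤ M → ‖c‖ = 1 → 0 < t →
      ∫⁻ u, {u : ℂ | |(chartCoord ζ c u).im - m * (chartCoord ζ c u).re| ≤
        M * |(chartCoord ζ c u).re| * ω |(chartCoord ζ c u).re|}.indicator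
          (fun u => ENNReal.ofReal (1 / (t + ‖u - ζ‖) ^ 3)) u ≤
      ENNReal.ofReal (C * M * (ω t / t)) := by
  obtain ⟨ε, C, hε0, hε1, hC, hdil⟩ := hω.exists_dilation
  have hI : Integrable fun x : ℝ => (1 + ‖x‖) ^ (-(2 - ε)) :=
    integrable_one_add_norm (by rw [Module.finrank_self]; norm_num; linarith)
  set I := ∫ x : ℝ, (1 + ‖x‖) ^ (-(2 - ε)) with hIdef
  have hI0 : 0 ≤ I := integral_nonneg fun x => by positivity
  refine ⟨2 * C * (I + 1), by positivity, fun M ζ c m t hM hc ht => ?_⟩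
  have hωt := hω.pos t ht
  set S := {u : ℂ | |(chartCoord ζ c u).im - m * (chartCoord ζ c u).re| ≤
        M * |(chartCoord ζ c u).re| * ω |(chartCoord ζ c u).re|} with hS
  have hinner : ∀ x : ℝ, ∫⁻ y : ℝ, S.indicator
      (fun u => ENNReal.ofReal (1 / (t + ‖u - ζ‖) ^ 3)) (chartPt ζ c x y) ≤
      ENNReal.ofReal (2 * M * C * ω t / t ^ 2 * (1 + ‖x / t‖) ^ (-(2 - ε))) := by
    intro x
    have hx0 := abs_nonneg x
    have hωx := hω.nonneg hx0
    set v := M * |x| * ω |x| with hv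
    have h1 : ∀ y : ℝ, S.indicator (fun u => ENNReal.ofReal (1 / (t + ‖u - ζ‖) ^ 3))
        (chartPt ζ c x y) ≤ (Icc (m * x - v) (m * x + v)).indicator
          (fun _ => ENNReal.ofReal (1 / (t + |x|) ^ 3)) y := by
      intro y
      by_cases hy : chartPt ζ c x y ∈ S
      · rw [indicator_of_mem hy]
        have h2 : |y - m * x| ≤ v := by
          simpa [hS, chartCoord_chartPt hc] using hy
        rw [abs_le] at h2
        rw [indicator_of_mem (show y ∈ Icc (m * x - v) (m * x + v) from
          ⟨by linarith, by linarith⟩)]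
        have h3 : |x| ≤ ‖chartPt ζ c x y - ζ‖ := by
          have := (abs_sub_le_norm_chartPt_sub (ζ := ζ) hc x y 0 0).1
          simpa [chartPt] using this
        gcongr
      · rw [indicator_of_notMem hy]
        exact zero_le
    refine (lintegral_mono h1).trans ?_
    rw [lintegral_indicator measurableSet_Icc, setLIntegral_const, Real.volume_Icc,
      ← ENNReal.ofReal_mul (by positivity)]
    apply ENNReal.ofReal_le_ofReal
    set q := 1 + |x| / t with hq
    have hq1 : 1 ≤ q := by rw [hq]; have : 0 ≤ |x| / t := by positivity
                           linarith
    have hq0 : 0 < q := by linarith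
    have htq : t + |x| = q * t := by rw [hq]; field_simp
    have hnorm : 1 + ‖x / t‖ = q := by rw [Real.norm_eq_abs, abs_div, abs_of_pos ht]
    have h4 : ω |x| ≤ C * q ^ ε * ω t :=
      (hω.mono hx0 (by rw [← htq]; linarith)).trans (hdil t q ht hq1)
    have h5 : |x| ≤ q * t := by rw [← htq]; linarith
    have h6 : q ^ (-(2 - ε)) = q ^ ε / q ^ 2 := by
      rw [neg_sub, Real.rpow_sub hq0]
      norm_num
    rw [hnorm, htq, h6]
    calc 1 / (q * t) ^ 3 * (m * x + v - (m * x - v)) = 2 * M * (|x| * ω |x|) / (q * t) ^ 3 := by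
          rw [hv]; ring
      _ ≤ 2 * M * (q * t * (C * q ^ ε * ω t)) / (q * t) ^ 3 := by gcongr
      _ = _ := by field_simp
  have hscale : Integrable fun x : ℝ => (1 + ‖x / t‖) ^ (-(2 - ε)) := hI.comp_div ht.ne'
  calc _ ≤ _ := lintegral_le_lintegral_chartPt ζ hc _
    _ ≤ ∫⁻ x : ℝ, ENNReal.ofReal (2 * M * C * ω t / t ^ 2 * (1 + ‖x / t‖) ^ (-(2 - ε))) :=
        lintegral_mono hinner
    _ = ENNReal.ofReal (∫ x : ℝ, 2 * M * C * ω t / t ^ 2 * (1 + ‖x / t‖) ^ (-(2 - ε))) :=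
        (ofReal_integral_eq_lintegral_ofReal (hscale.const_mul _)
          (Eventually.of_forall fun x => by positivity)).symm
    _ ≤ _ := by
        apply ENNReal.ofReal_le_ofReal
        rw [integral_const_mul, Measure.integral_comp_div (fun x : ℝ => (1 + ‖x‖) ^ (-(2 - ε))),
          smul_eq_mul, abs_of_pos ht, ← hIdef]
        calc 2 * M * C * ω t / t ^ 2 * (t * I) = 2 * C * I * M * (ω t / t) := by
              field_simp
          _ ≤ _ := by gcongr; linarith

/-- Outside a fixed disc the contribution of the cubic kernel is bounded, uniformly in `t`. -/
theorem exists_lintegral_outside_le {R : ℝ} (hR : 0 < R) :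
    ∃ C : ℝ, 0 < C ∧ ∀ (ζ : ℂ) (t : ℝ), 0 < t →
      ∫⁻ u in {u : ℂ | R ≤ ‖u - ζ‖}, ENNReal.ofReal (1 / (t + ‖u - ζ‖) ^ 3) ≤
        ENNReal.ofReal C := by
  set J := ∫ u : ℂ, 1 / (1 + ‖u - 0‖) ^ 3 with hJ
  have hJ0 : 0 ≤ J := integral_nonneg fun u => by positivity
  refine ⟨(1 + 1 / R) ^ 3 * (J + 1), by positivity, fun ζ t ht => ?_⟩
  have hm : MeasurableSet {u : ℂ | R ≤ ‖u - ζ‖} :=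
    measurableSet_le measurable_const (measurable_id.sub_const ζ).norm
  have hJζ : ∫ u : ℂ, 1 / (1 + ‖u - ζ‖) ^ 3 = J := by
    rw [hJ, ← integral_sub_right_eq_self (fun u : ℂ => 1 / (1 + ‖u - 0‖) ^ 3) ζ]
    simp
  calc _ ≤ ∫⁻ u in {u : ℂ | R ≤ ‖u - ζ‖},
          ENNReal.ofReal ((1 + 1 / R) ^ 3 * (1 / (1 + ‖u - ζ‖) ^ 3)) := by
        refine setLIntegral_mono' hm fun u hu => ENNReal.ofReal_le_ofReal ?_
        have hu' : R ≤ ‖u - ζ‖ := hu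
        have h1 : 1 + ‖u - ζ‖ ≤ (1 + 1 / R) * (t + ‖u - ζ‖) := by
          have h2 : 1 ≤ 1 / R * ‖u - ζ‖ := by
            rw [one_div, le_inv_mul_iff₀ hR, mul_one]
            exact hu'
          have h3 : 0 ≤ 1 / R * t := by positivity
          nlinarith
        have h0 : 0 < t + ‖u - ζ‖ := by positivity
        rw [mul_one_div, div_le_div_iff₀ (by positivity) (by positivity), ← mul_pow, one_mul]
        gcongr
    _ ≤ ∫⁻ u, ENNReal.ofReal ((1 + 1 / R) ^ 3 * (1 / (1 + ‖u - ζ‖) ^ 3)) :=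
        setLIntegral_le_lintegral _ _
    _ = ENNReal.ofReal (∫ u, (1 + 1 / R) ^ 3 * (1 / (1 + ‖u - ζ‖) ^ 3)) :=
        (ofReal_integral_eq_lintegral_ofReal
          ((integrable_one_div_add_norm_cube ζ one_pos).const_mul _)
          (Eventually.of_forall fun u => by positivity)).symm
    _ ≤ _ := by
        apply ENNReal.ofReal_le_ofReal
        rw [integral_const_mul, hJζ]
        gcongr
        linarith

/-- Inside the chart the exterior and the tangent half-plane differ by a thin strip; outside it only
the decay of the kernel is used. -/
theorem exists_lintegral_symmDiff_le {ω : ℝ → ℝ} (hω : IsRegularModulus ω) {Ω : Set ℂ}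
    (hΩ : IsOpen Ω) {R M : ℝ} (hR : 0 < R) (hM : 1 ≤ M) :
    ∃ C : ℝ, 0 < C ∧ ∀ (ζ c : ℂ) (φ : ℝ → ℝ) (m : ℝ), UniformChart ω Ω R M ζ c φ m →
      ∀ t, 0 < t → t ≤ 1 →
      ∫⁻ u in symmDiff Ωᶜ (aboveTangent ζ c m), ENNReal.ofReal (1 / (t + ‖u - ζ‖) ^ 3) ≤
        ENNReal.ofReal (C * (ω t / t)) := by
  obtain ⟨C₁, hC₁, h₁⟩ := lintegral_strip_le hω
  obtain ⟨C₂, hC₂, h₂⟩ := exists_lintegral_outside_le hR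
  obtain ⟨C₃, hC₃, h₃⟩ := hω.exists_mul_le one_pos
  refine ⟨C₁ * M + C₂ * C₃, by positivity, fun ζ c φ m hU t ht ht1 => ?_⟩
  have hωt := hω.pos t ht
  have hm : MeasurableSet {u : ℂ | R ≤ ‖u - ζ‖} :=
    measurableSet_le measurable_const (measurable_id.sub_const ζ).norm
  set f := fun u : ℂ => ENNReal.ofReal (1 / (t + ‖u - ζ‖) ^ 3) with hf
  set S := {u : ℂ | |(chartCoord ζ c u).im - m * (chartCoord ζ c u).re| ≤
        M * |(chartCoord ζ c u).re| * ω |(chartCoord ζ c u).re|} with hS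
  have hfm : Measurable f := by fun_prop
  have hpt : ∀ u, (symmDiff Ωᶜ (aboveTangent ζ c m)).indicator f u ≤
      S.indicator f u + {u : ℂ | R ≤ ‖u - ζ‖}.indicator f u := by
    intro u
    by_cases hu : u ∈ symmDiff Ωᶜ (aboveTangent ζ c m)
    swap
    · rw [indicator_of_notMem hu]; exact zero_le
    rw [indicator_of_mem hu]
    rcases le_or_gt R ‖u - ζ‖ with hout | hin
    · rw [indicator_of_mem (show u ∈ {u : ℂ | R ≤ ‖u - ζ‖} from hout)]
      exact le_add_self
    · refine le_add_right ?_
      rw [indicator_of_mem]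
      rw [← norm_chartCoord hU.norm_eq u] at hin
      set w := chartCoord ζ c u with hw
      have hx : w.re ∈ Ioo (-R) R := abs_lt.1 ((Complex.abs_re_le_norm w).trans_lt hin)
      have hy : w.im ∈ Ioo (-R) R := abs_lt.1 ((Complex.abs_im_le_norm w).trans_lt hin)
      have h4 := hU.mem_iff _ hx _ hy
      rw [hw, chartPt_chartCoord hU.norm_eq, ← hw] at h4
      have h5 := abs_le.1 (hU.tangent _ hx)
      rw [mem_symmDiff, mem_compl_iff, h4, not_lt] at hu
      change |w.im - m * w.re| ≤ _
      rw [abs_le]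
      simp only [aboveTangent, mem_ofPred_eq, ← hw, not_le] at hu
      rcases hu with ⟨h6, h7⟩ | ⟨h6, h7⟩
      · constructor <;> linarith
      · constructor <;> linarith
  calc ∫⁻ u in symmDiff Ωᶜ (aboveTangent ζ c m), f u
      = ∫⁻ u, (symmDiff Ωᶜ (aboveTangent ζ c m)).indicator f u :=
        (lintegral_indicator (hΩ.measurableSet.compl.symmDiff
          (measurableSet_aboveTangent ζ hU.norm_eq m)) f).symm
    _ ≤ ∫⁻ u, (S.indicator f u + {u : ℂ | R ≤ ‖u - ζ‖}.indicator f u) := lintegral_mono hpt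
    _ = (∫⁻ u, S.indicator f u) + ∫⁻ u in {u : ℂ | R ≤ ‖u - ζ‖}, f u := by
        rw [lintegral_add_right _ (hfm.indicator hm), lintegral_indicator hm]
    _ ≤ ENNReal.ofReal (C₁ * M * (ω t / t)) + ENNReal.ofReal C₂ := by
        gcongr
        · exact h₁ M ζ c m t (by linarith) hU.norm_eq ht
        · exact h₂ ζ t ht
    _ ≤ _ := by
        rw [← ENNReal.ofReal_add (by positivity) hC₂.le]
        apply ENNReal.ofReal_le_ofReal
        have h8 : 1 ≤ C₃ * (ω t / t) := by
          rw [← mul_div_assoc, one_le_div ht]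
          exact h₃ t ht ht1
        nlinarith

theorem norm_setIntegral_sub_le {k : ℂ → ℂ} {A B : Set ℂ} (hA : MeasurableSet A)
    (hB : MeasurableSet B) (hkA : IntegrableOn k A) (hkB : IntegrableOn k B) {X : ℝ} (hX : 0 ≤ X)
    (h : ∫⁻ u in symmDiff A B, ‖k u‖ₑ ≤ ENNReal.ofReal X) :
    ‖(∫ u in A, k u) - ∫ u in B, k u‖ ≤ 2 * X := by
  have h1 := integral_inter_add_sdiff hB hkA
  have h2 := integral_inter_add_sdiff hA hkB
  rw [inter_comm] at h2
  have h3 : ∀ T : Set ℂ, T ⊆ symmDiff A B → ‖∫ u in T, k u‖ ≤ X := fun T hT => by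
    rw [← ENNReal.ofReal_le_ofReal_iff hX, ofReal_norm]
    exact (enorm_integral_le_lintegral_enorm _).trans ((lintegral_mono_set hT).trans h)
  rw [← h1, ← h2, add_sub_add_left_eq_sub]
  refine (norm_sub_le _ _).trans ?_
  have h4 := h3 (A \ B) (by rw [symmDiff_def]; exact le_sup_left)
  have h5 := h3 (B \ A) (by rw [symmDiff_def]; exact le_sup_right)
  linarith

/-- At distance comparable to `t` from the boundary, the transform of the characteristic function
varies at the scale `t` by at most `ω(t)`: the exterior is compared with a half-plane, over which
the difference of the kernels has integral zero. -/
theorem exists_beurling_sub_le {ω : ℝ → ℝ} (hω : IsRegularModulus ω) {Ω : Set ℂ} (hΩ : IsOpen Ω)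
    (hΩb : Bornology.IsBounded Ω) {R M κ Λ : ℝ} (hR : 0 < R) (hM : 1 ≤ M) (hκ : 0 < κ)
    (hΛ : 0 < Λ) :
    ∃ C t₁ : ℝ, 0 < C ∧ 0 < t₁ ∧ ∀ (ζ c : ℂ) (φ : ℝ → ℝ) (m : ℝ), UniformChart ω Ω R M ζ c φ m →
      ∀ t, 0 < t → t ≤ t₁ → ∀ z z' : ℂ, ‖z - ζ‖ ≤ Λ * t → ‖z' - ζ‖ ≤ Λ * t →
      (∀ u ∉ Ω, κ * t ≤ ‖u - z‖) → (∀ u ∉ Ω, κ * t ≤ ‖u - z'‖) →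
      ‖beurling (Ω.indicator fun _ => (1 : ℂ)) z - beurling (Ω.indicator fun _ => (1 : ℂ)) z'‖ ≤
        C * (‖z - z'‖ / t) * ω t := by
  obtain ⟨C₀, hC₀, h₀⟩ := exists_lintegral_symmDiff_le hω hΩ hR hM
  obtain ⟨t₂, ht₂, hωt₂⟩ := hω.exists_le (η := κ / (4 * (M * Λ))) (by positivity)
  set κ' := κ / (4 * (1 + M)) with hκ'
  have hM' : (0 : ℝ) < 1 + M := by linarith
  have hκ'0 : 0 < κ' := by positivity
  have hκκ' : κ' ≤ κ := div_le_self hκ.le (by linarith)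
  set K := 2 * (1 + (1 + Λ) / κ') ^ 3 with hK
  have hK0 : 0 < K := by positivity
  set t₁ := min 1 (min (t₂ / Λ) (R / (2 * (Λ + κ)))) with ht₁
  refine ⟨2 * (K * C₀), t₁, by positivity,
    lt_min one_pos (lt_min (by positivity) (by positivity)),
    fun ζ c φ m hU t ht htt z z' hz hz' hzu hzu' => ?_⟩
  have ht1 : t ≤ 1 := htt.trans (min_le_left _ _)
  have htt2 : Λ * t ≤ t₂ := by
    have := htt.trans ((min_le_right _ _).trans (min_le_left _ _))
    rwa [le_div_iff₀ hΛ, mul_comm] at this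
  have httR : (Λ + κ) * t ≤ R / 2 := by
    have := htt.trans ((min_le_right _ _).trans (min_le_right _ _))
    rw [le_div_iff₀ (by positivity)] at this
    linarith
  have hωt := hω.pos t ht
  have hmem : ∀ p, (∀ u ∉ Ω, κ * t ≤ ‖u - p‖) → p ∈ Ω := fun p hp => by
    by_contra hn
    have := hp p hn
    rw [sub_self, norm_zero] at this
    have : 0 < κ * t := by positivity
    linarith
  -- the point at height `κ t / 2` above `p` still lies in `Ω`, hence below the graph
  have hbelow : ∀ p, ‖p - ζ‖ ≤ Λ * t → (∀ u ∉ Ω, κ * t ≤ ‖u - p‖) →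
      (chartCoord ζ c p).im - m * (chartCoord ζ c p).re ≤ -(κ * t / 4) := by
    intro p hp hpu
    rw [← norm_chartCoord hU.norm_eq p] at hp
    have hpt := chartPt_chartCoord (ζ := ζ) hU.norm_eq p
    set w := chartCoord ζ c p with hw
    have hκt : 0 < κ * t := by positivity
    have hΛt : 0 < Λ * t := by positivity
    have hre := (Complex.abs_re_le_norm w).trans hp
    have him := (Complex.abs_im_le_norm w).trans hp
    have hx : w.re ∈ Ioo (-R) R := abs_lt.1 (by nlinarith)
    have hy : w.im + κ * t / 2 ∈ Ioo (-R) R := by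
      rw [abs_le] at him
      constructor <;> nlinarith
    have hin : chartPt ζ c w.re (w.im + κ * t / 2) ∈ Ω := by
      by_contra hn
      have h1 := hpu _ hn
      rw [← hpt] at h1
      have h2 := norm_chartPt_sub_le (ζ := ζ) hU.norm_eq w.re (w.im + κ * t / 2) w.re w.im
      rw [sub_self, abs_zero, zero_add, add_sub_cancel_left, abs_of_pos (by positivity)] at h2
      linarith
    rw [hU.mem_iff _ hx _ hy] at hin
    have h3 := (abs_le.1 (hU.tangent _ hx)).2
    have h4 : M * |w.re| * ω |w.re| ≤ κ * t / 4 := by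
      have h5 : ω |w.re| ≤ κ / (4 * (M * Λ)) := hωt₂ _ (abs_nonneg _) (hre.trans htt2)
      calc M * |w.re| * ω |w.re| ≤ M * (Λ * t) * (κ / (4 * (M * Λ))) := by
            have := hω.nonneg (abs_nonneg w.re)
            gcongr
        _ = _ := by field_simp
    linarith
  have hfar : ∀ p, ‖p - ζ‖ ≤ Λ * t → (∀ u ∉ Ω, κ * t ≤ ‖u - p‖) →
      ∀ u ∈ aboveTangent ζ c m, κ' * t ≤ ‖u - p‖ := by
    intro p hp hpu u hu
    have h1 := hbelow p hp hpu
    have h2 : m * (chartCoord ζ c u).re ≤ (chartCoord ζ c u).im := hu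
    obtain ⟨h3, h4⟩ := abs_sub_le_norm_chartPt_sub (ζ := ζ) hU.norm_eq (chartCoord ζ c u).re
      (chartCoord ζ c u).im (chartCoord ζ c p).re (chartCoord ζ c p).im
    rw [chartPt_chartCoord hU.norm_eq, chartPt_chartCoord hU.norm_eq] at h3 h4
    have h5 : |m * ((chartCoord ζ c u).re - (chartCoord ζ c p).re)| ≤ M * ‖u - p‖ := by
      rw [abs_mul]
      exact mul_le_mul hU.slope h3 (abs_nonneg _) (by linarith)
    have h6 := (abs_le.1 h4).2
    have h7 := (abs_le.1 h5).1
    rw [hκ', div_mul_eq_mul_div, div_le_iff₀ (by positivity)]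
    nlinarith
  have hfarΩ : ∀ p, (∀ u ∉ Ω, κ * t ≤ ‖u - p‖) → ∀ u ∈ Ωᶜ, κ' * t ≤ ‖u - p‖ :=
    fun p hp u hu => le_trans (by gcongr) (hp u hu)
  have hAm := hΩ.measurableSet.compl
  have hBm := measurableSet_aboveTangent ζ hU.norm_eq m
  have hkA := integrableOn_kernelDiff ht hκ'0 hz hz' hAm (hfarΩ z hzu) (hfarΩ z' hzu')
  have hkB := integrableOn_kernelDiff ht hκ'0 hz hz' hBm (hfar z hz hzu) (hfar z' hz' hzu')
  have hzero : ∫ u in aboveTangent ζ c m, kernelDiff z z' u = 0 := by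
    obtain ⟨c', hc', hiff⟩ := exists_aboveTangent_eq ζ hU.norm_eq m
    have hset : aboveTangent ζ c m = {u : ℂ | 0 ≤ (chartCoord ζ c' u).im} := by
      ext u
      exact (hiff u).symm
    have hneg : ∀ p, ‖p - ζ‖ ≤ Λ * t → (∀ u ∉ Ω, κ * t ≤ ‖u - p‖) →
        (chartCoord ζ c' p).im < 0 := fun p hp hpu => by
      rw [← not_le, hiff]
      intro hm
      have := hfar p hp hpu p hm
      rw [sub_self, norm_zero] at this
      have : 0 < κ' * t := by positivity
      linarith
    rw [hset] at hkB ⊢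
    exact setIntegral_halfPlane_kernelDiff hc' (hneg z hz hzu) (hneg z' hz' hzu') hkB
  have hX : ∫⁻ u in symmDiff Ωᶜ (aboveTangent ζ c m), ‖kernelDiff z z' u‖ₑ ≤
      ENNReal.ofReal (K * ‖z - z'‖ * (C₀ * (ω t / t))) := by
    calc _ ≤ ∫⁻ u in symmDiff Ωᶜ (aboveTangent ζ c m),
          ENNReal.ofReal (K * ‖z - z'‖) * ENNReal.ofReal (1 / (t + ‖u - ζ‖) ^ 3) := by
          refine setLIntegral_mono' (hAm.symmDiff hBm) fun u hu => ?_
          rw [← ENNReal.ofReal_mul (by positivity), ← ofReal_norm, mul_one_div]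
          apply ENNReal.ofReal_le_ofReal
          rw [mem_symmDiff] at hu
          rcases hu with ⟨hu, -⟩ | ⟨hu, -⟩
          · exact norm_kernelDiff_le ht hκ'0 hz hz' (hfarΩ z hzu u hu) (hfarΩ z' hzu' u hu)
          · exact norm_kernelDiff_le ht hκ'0 hz hz' (hfar z hz hzu u hu) (hfar z' hz' hzu' u hu)
      _ = ENNReal.ofReal (K * ‖z - z'‖) * ∫⁻ u in symmDiff Ωᶜ (aboveTangent ζ c m),
          ENNReal.ofReal (1 / (t + ‖u - ζ‖) ^ 3) := lintegral_const_mul' _ _ (by finiteness)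
      _ ≤ ENNReal.ofReal (K * ‖z - z'‖) * ENNReal.ofReal (C₀ * (ω t / t)) := by
          gcongr
          exact h₀ ζ c φ m hU t ht ht1
      _ = _ := by rw [← ENNReal.ofReal_mul (by positivity)]
  have hfin := norm_setIntegral_sub_le hAm hBm hkA hkB (by positivity) hX
  rw [hzero, sub_zero] at hfin
  rw [beurling_sub_eq hΩ hΩb (hmem z hzu) (hmem z' hzu'), norm_mul]
  have hpi := norm_neg_one_div_pi_le
  rw [norm_neg] at hpi
  calc _ ≤ 1 * (2 * (K * ‖z - z'‖ * (C₀ * (ω t / t)))) :=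
        mul_le_mul hpi hfin (norm_nonneg _) zero_le_one
    _ = _ := by ring

/-! ### Mean oscillation of the transform of the characteristic function -/

/-- Telescoping over the doubling steps from `s` to `τ`. Their number grows only logarithmically;
the square root is a convenient majorant, integrable at the origin. -/
theorem norm_sub_le_of_doubling {G : ℝ → ℂ} {τ B : ℝ} (hB : 0 ≤ B)
    (h : ∀ s s', 0 < s → s ≤ s' → s' ≤ 2 * s → s' ≤ τ → ‖G s - G s'‖ ≤ B) {s : ℝ} (hs : 0 < s)
    (hsτ : s ≤ τ) : ‖G s - G τ‖ ≤ 4 * B * √(τ / s) := by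
  have key : ∀ n : ℕ, ∀ s, 0 < s → s ≤ τ → τ ≤ 2 ^ n * s → ‖G s - G τ‖ ≤ 4 * B * √(τ / s) := by
    intro n
    induction n with
    | zero =>
      intro s hs hsτ hn
      rw [pow_zero, one_mul] at hn
      rw [le_antisymm hsτ hn, sub_self, norm_zero]
      positivity
    | succ n ih =>
      intro s hs hsτ hn
      rcases le_or_gt τ (2 * s) with h2 | h2
      · have h3 : 1 ≤ √(τ / s) := by
          rw [Real.one_le_sqrt, one_le_div hs]
          exact hsτ
        calc ‖G s - G τ‖ ≤ B := h s τ hs hsτ h2 le_rfl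
          _ = B * 1 := (mul_one B).symm
          _ ≤ (4 * B) * √(τ / s) := by
            gcongr
            linarith
      · have h3 := ih (2 * s) (by positivity) h2.le (by rw [pow_succ] at hn; linarith)
        have h4 := h s (2 * s) hs (by linarith) le_rfl h2.le
        have h5 : 1 ≤ √(τ / (2 * s)) := by
          rw [Real.one_le_sqrt, one_le_div (by positivity)]
          exact h2.le
        have h6 : √(τ / s) = √2 * √(τ / (2 * s)) := by
          rw [← Real.sqrt_mul zero_le_two]
          congr 1
          field_simp
        have h7 : (5 / 4 : ℝ) ≤ √2 := by
          apply Real.le_sqrt_of_sq_le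
          norm_num
        have h8 := norm_add_le (G s - G (2 * s)) (G (2 * s) - G τ)
        rw [sub_add_sub_cancel] at h8
        have h9 : 1 + 4 * √(τ / (2 * s)) ≤ 4 * (√2 * √(τ / (2 * s))) := by nlinarith
        rw [h6]
        calc ‖G s - G τ‖ ≤ B * (1 + 4 * √(τ / (2 * s))) := by linarith
          _ ≤ B * (4 * (√2 * √(τ / (2 * s)))) := by gcongr
          _ = _ := by ring
  obtain ⟨n, hn⟩ := pow_unbounded_of_one_lt (τ / s) one_lt_two
  rw [div_lt_iff₀ hs] at hn
  exact key n s hs hsτ hn.le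

/-- Oscillation over discs which stay away from the boundary. -/
theorem exists_interior_beurling_sub_le {ω : ℝ → ℝ} (hω : IsRegularModulus ω) {Ω : Set ℂ}
    (hΩ : IsOpen Ω) (hΩb : Bornology.IsBounded Ω) (hsmooth : HasC1OmegaBoundary ω Ω) :
    ∃ C ρ₁ : ℝ, 0 < C ∧ 0 < ρ₁ ∧ ∀ z ∈ Ω, ∀ ρ, 0 < ρ → ρ ≤ ρ₁ → 4 * ρ ≤ Metric.infDist z Ωᶜ →
      ∀ x ∈ Metric.closedBall z ρ, ‖beurling (Ω.indicator fun _ => (1 : ℂ)) x -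
        beurling (Ω.indicator fun _ => (1 : ℂ)) z‖ ≤ C * ω ρ := by
  obtain ⟨R, M, hR, hM, hchart⟩ := exists_uniformChart hω hΩ hΩb hsmooth
  obtain ⟨C₁, t₁, hC₁, ht₁, h₁⟩ := exists_beurling_sub_le hω hΩ hΩb (κ := 3 / 4) (Λ := 5 / 4)
    hR hM (by norm_num) (by norm_num)
  obtain ⟨C₂, hC₂, h₂⟩ := hω.exists_div_le
  obtain ⟨C₃, hC₃, h₃⟩ := hω.exists_mul_le ht₁
  set J := ∫ u : ℂ, 1 / (t₁ + ‖u - 0‖) ^ 3 with hJ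
  have hJ0 : 0 ≤ J := integral_nonneg fun u => by positivity
  set K : ℝ := 2 * (1 + (1 + 1) / (3 / 4)) ^ 3 with hK
  have hK0 : 0 < K := by positivity
  refine ⟨C₁ * C₂ + K * J * C₃, t₁, by positivity, ht₁, fun z hz ρ hρ hρt hd x hx => ?_⟩
  have hωρ := hω.pos ρ hρ
  rw [Metric.mem_closedBall, dist_eq_norm] at hx
  set d := Metric.infDist z Ωᶜ with hddef
  have hzu : ∀ u ∉ Ω, d ≤ ‖u - z‖ := fun u hu => infDist_compl_le hu
  have hxu : ∀ u ∉ Ω, 3 / 4 * d ≤ ‖u - x‖ := fun u hu => by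
    have h4 := norm_add_le (u - x) (x - z)
    rw [sub_add_sub_cancel] at h4
    linarith [hzu u hu]
  have hd0 : 0 < d := by linarith
  rcases le_or_gt d t₁ with hdt | hdt
  · obtain ⟨ζ, hζ, hdist⟩ := exists_mem_frontier_infDist_compl_eq_dist hz
      (ne_univ_of_isBounded hΩb)
    rw [dist_eq_norm, ← hddef] at hdist
    obtain ⟨c, φ, m, hU⟩ := hchart ζ hζ
    have h4 := norm_add_le (x - z) (z - ζ)
    rw [sub_add_sub_cancel] at h4
    calc _ ≤ C₁ * (‖x - z‖ / d) * ω d := h₁ ζ c φ m hU d hd0 hdt x z (by linarith) (by linarith)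
          hxu (fun u hu => by linarith [hzu u hu])
      _ ≤ C₁ * (ρ / d) * ω d := by
          have := hω.nonneg hd0.le
          gcongr
      _ = C₁ * (ρ * ω d / d) := by ring
      _ ≤ C₁ * (C₂ * ω ρ) := by
          gcongr
          rw [div_le_iff₀ hd0]
          linarith [h₂ ρ d hρ (by linarith)]
      _ ≤ _ := by
          have : 0 ≤ K * J * C₃ * ω ρ := by positivity
          linarith
  · have hxΩ : x ∈ Ω := by
      by_contra hn
      have := hxu x hn
      rw [sub_self, norm_zero] at this
      linarith
    have hJz : ∫ u : ℂ, 1 / (t₁ + ‖u - z‖) ^ 3 = J := by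
      rw [hJ, ← integral_sub_right_eq_self (fun u : ℂ => 1 / (t₁ + ‖u - 0‖) ^ 3) z]
      simp
    have hint := integrable_one_div_add_norm_cube z ht₁
    have h4 : ‖∫ u in Ωᶜ, kernelDiff x z u‖ ≤ K * ‖x - z‖ * J := by
      calc ‖∫ u in Ωᶜ, kernelDiff x z u‖
          ≤ ∫ u in Ωᶜ, K * ‖x - z‖ * (1 / (t₁ + ‖u - z‖) ^ 3) := by
            refine norm_integral_le_of_norm_le (hint.const_mul _).integrableOn
              ((ae_restrict_iff' hΩ.measurableSet.compl).2 (Eventually.of_forall fun u hu => ?_))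
            rw [mul_one_div]
            exact norm_kernelDiff_le (Λ := 1) (κ := 3 / 4) ht₁ (by norm_num) (by linarith)
              (by rw [sub_self, norm_zero]; linarith) (by linarith [hxu u hu])
              (by linarith [hzu u hu])
        _ ≤ ∫ u, K * ‖x - z‖ * (1 / (t₁ + ‖u - z‖) ^ 3) :=
            setIntegral_le_integral (hint.const_mul _) (Eventually.of_forall fun u => by positivity)
        _ = _ := by rw [integral_const_mul, hJz]
    have hpi := norm_neg_one_div_pi_le
    rw [norm_neg] at hpi
    rw [beurling_sub_eq hΩ hΩb hxΩ hz, norm_mul]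
    calc _ ≤ 1 * (K * ‖x - z‖ * J) := mul_le_mul hpi h4 (norm_nonneg _) zero_le_one
      _ ≤ 1 * (K * (C₃ * ω ρ) * J) := by
          gcongr
          exact hx.trans (h₃ ρ hρ hρt)
      _ ≤ _ := by
          have : 0 ≤ C₁ * C₂ * ω ρ := by positivity
          linarith

/-- Oscillation below the boundary graph: the transform may grow at the boundary, but at most like
an integrable power of the height `s` below the graph. -/
theorem exists_beurling_below_graph_le {ω : ℝ → ℝ} (hω : IsRegularModulus ω) {Ω : Set ℂ}
    (hΩ : IsOpen Ω) (hΩb : Bornology.IsBounded Ω) {R M : ℝ} (hR : 0 < R) (hM : 1 ≤ M)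
    (hchart : ∀ ζ ∈ frontier Ω, ∃ c φ m, UniformChart ω Ω R M ζ c φ m) :
    ∃ C τ₁ : ℝ, 0 < C ∧ 0 < τ₁ ∧ ∀ (ζ c : ℂ) (φ : ℝ → ℝ) (m : ℝ),
      UniformChart ω Ω R M ζ c φ m → ∀ τ, τ ≤ τ₁ → ∀ x s, |x| ≤ τ → 0 < s → s ≤ τ →
      ‖beurling (Ω.indicator fun _ => (1 : ℂ)) (chartPt ζ c x (φ x - s)) -
        beurling (Ω.indicator fun _ => (1 : ℂ)) (chartPt ζ c 0 (φ 0 - τ))‖ ≤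
          C * ω τ * √(τ / s) := by
  have hM' : (0 : ℝ) < 1 + M := by linarith
  obtain ⟨C₁, t₁, hC₁, ht₁, h₁⟩ := exists_beurling_sub_le hω hΩ hΩb (κ := 1 / (1 + M))
    (Λ := 2 + M) hR hM (by positivity) (by linarith)
  refine ⟨4 * C₁ + C₁ * (1 + M), min t₁ (R / (2 * (3 + M))), by positivity,
    lt_min ht₁ (by positivity), fun ζ c φ m hU τ hττ x s hx hs hsτ => ?_⟩
  set F := beurling (Ω.indicator fun _ => (1 : ℂ)) with hF
  have hτ : 0 < τ := hs.trans_le hsτ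
  have hωτ := hω.pos τ hτ
  have hτt : τ ≤ t₁ := hττ.trans (min_le_left _ _)
  have hτR : (3 + M) * τ ≤ R / 2 := by
    have := hττ.trans (min_le_right _ _)
    rw [le_div_iff₀ (by positivity)] at this
    linarith
  have hxI : x ∈ Ioo (-R) R := abs_lt.1 (by nlinarith)
  have hφx := hU.abs_graph_le hR hxI
  have hMx : M * |x| ≤ M * τ := by gcongr
  have hdist : ∀ x' s', |x'| ≤ τ → 0 < s' → s' ≤ τ → ∀ u ∉ Ω,
      1 / (1 + M) * s' ≤ ‖u - chartPt ζ c x' (φ x' - s')‖ := by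
    intro x' s' hx' hs' hsτ' u hu
    refine hU.le_norm_sub hR hM hs' ?_ hu
    have : (1 + M) * |x'| ≤ (1 + M) * τ := by gcongr
    linarith
  -- vertical steps, with the chart centred at the boundary point above
  have hvert : ∀ a b, 0 < a → a ≤ b → b ≤ 2 * a → b ≤ τ →
      ‖F (chartPt ζ c x (φ x - a)) - F (chartPt ζ c x (φ x - b))‖ ≤ C₁ * ω τ := by
    intro a b ha hab hba hbτ
    have hζx : chartPt ζ c x (φ x) ∈ frontier Ω :=
      hU.mem_frontier hxI (abs_lt.1 (by linarith))
    obtain ⟨c', φ', m', hU'⟩ := hchart _ hζx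
    have e1 := norm_chartPt_sub_graph (ζ := ζ) hU.norm_eq x (φ x) a
    have e2 := norm_chartPt_sub_graph (ζ := ζ) hU.norm_eq x (φ x) b
    rw [abs_of_pos ha] at e1
    rw [abs_of_pos (ha.trans_le hab)] at e2
    have h2 := h₁ _ c' φ' m' hU' a ha (by linarith) _ _ (e1.trans (by nlinarith))
      (e2.trans (by nlinarith)) (hdist x a hx ha (by linarith)) (fun u hu =>
        le_trans (by gcongr) (hdist x b hx (by linarith) hbτ u hu))
    have h3 : ‖chartPt ζ c x (φ x - a) - chartPt ζ c x (φ x - b)‖ / a ≤ 1 := by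
      rw [div_le_one ha]
      refine (norm_chartPt_sub_le hU.norm_eq _ _ _ _).trans ?_
      rw [sub_self, abs_zero, zero_add, sub_sub_sub_cancel_left, abs_of_nonneg (by linarith)]
      linarith
    have h4 : ω a ≤ ω τ := hω.mono ha.le (by linarith)
    have h5 := hω.pos a ha
    calc _ ≤ C₁ * (‖chartPt ζ c x (φ x - a) - chartPt ζ c x (φ x - b)‖ / a) * ω a := h2
      _ ≤ C₁ * 1 * ω τ := by gcongr
      _ = _ := by ring
  have h2 := norm_sub_le_of_doubling (G := fun a => F (chartPt ζ c x (φ x - a))) (by positivity)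
    hvert hs hsτ
  -- the horizontal step at height `τ`, with the chart centred at `ζ`
  have hζ0 : chartPt ζ c 0 0 = ζ := by simp [chartPt]
  have hnear : ∀ x', |x'| ≤ τ → |φ x'| ≤ M * τ → ‖chartPt ζ c x' (φ x' - τ) - ζ‖ ≤ (2 + M) * τ := by
    intro x' hx' hφ'
    have h3 := norm_chartPt_sub_le (ζ := ζ) hU.norm_eq x' (φ x' - τ) 0 0
    rw [hζ0, sub_zero, sub_zero] at h3
    have h4 := abs_sub (φ x') τ
    rw [abs_of_pos hτ] at h4
    linarith
  have hφ0 : |φ 0| ≤ M * τ := by rw [hU.map_zero, abs_zero]; positivity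
  have h0τ : |(0 : ℝ)| ≤ τ := by rw [abs_zero]; exact hτ.le
  have h3 := h₁ ζ c φ m hU τ hτ hτt _ _ (hnear x hx (by linarith)) (hnear 0 h0τ hφ0)
    (hdist x τ hx hτ le_rfl) (hdist 0 τ h0τ hτ le_rfl)
  have h4 : ‖chartPt ζ c x (φ x - τ) - chartPt ζ c 0 (φ 0 - τ)‖ / τ ≤ 1 + M := by
    rw [div_le_iff₀ hτ]
    refine (norm_chartPt_sub_le hU.norm_eq _ _ _ _).trans ?_
    rw [hU.map_zero, sub_zero, sub_sub_sub_cancel_right, sub_zero]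
    linarith
  have h5 : 1 ≤ √(τ / s) := by
    rw [Real.one_le_sqrt, one_le_div hs]
    exact hsτ
  have h6 := norm_add_le (F (chartPt ζ c x (φ x - s)) - F (chartPt ζ c x (φ x - τ)))
    (F (chartPt ζ c x (φ x - τ)) - F (chartPt ζ c 0 (φ 0 - τ)))
  rw [sub_add_sub_cancel] at h6
  calc _ ≤ _ := h6
    _ ≤ 4 * (C₁ * ω τ) * √(τ / s) + C₁ * (1 + M) * ω τ * √(τ / s) := by
        refine add_le_add h2 (h3.trans ?_)
        calc C₁ * (‖chartPt ζ c x (φ x - τ) - chartPt ζ c 0 (φ 0 - τ)‖ / τ) * ω τ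
            ≤ C₁ * (1 + M) * ω τ := by gcongr
          _ ≤ _ := le_mul_of_one_le_right (by positivity) h5
    _ = _ := by ring

theorem lintegral_sqrt_div {τ : ℝ} (hτ : 0 < τ) {B : ℝ} (hB : 0 ≤ B) :
    ∫⁻ s in Ioc 0 τ, ENNReal.ofReal (B * √(τ / s)) = ENNReal.ofReal (B * (2 * τ)) := by
  have e1 : ∀ s ∈ Ioc 0 τ, B * √(τ / s) = B * √τ * s ^ (-(1 / 2) : ℝ) := fun s hs => by
    rw [Real.sqrt_div hτ.le, Real.rpow_neg hs.1.le, ← Real.sqrt_eq_rpow]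
    ring
  have h1 : IntervalIntegrable (fun s : ℝ => s ^ (-(1 / 2) : ℝ)) volume 0 τ :=
    intervalIntegral.intervalIntegrable_rpow' (by norm_num)
  have h2 : IntegrableOn (fun s : ℝ => s ^ (-(1 / 2) : ℝ)) (Ioc 0 τ) :=
    (intervalIntegrable_iff_integrableOn_Ioc_of_le hτ.le).1 h1
  rw [setLIntegral_congr_fun measurableSet_Ioc (fun s hs => by rw [e1 s hs]),
    ← ofReal_integral_eq_lintegral_ofReal (h2.const_mul _)
      ((ae_restrict_iff' measurableSet_Ioc).2 (Eventually.of_forall fun s hs => by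
        have := hs.1
        positivity)),
    integral_const_mul, ← intervalIntegral.integral_of_le hτ.le,
    integral_rpow (Or.inl (by norm_num))]
  congr 1
  have e2 : (-(1 / 2) + 1 : ℝ) = 1 / 2 := by norm_num
  rw [e2, Real.zero_rpow (by norm_num), ← Real.sqrt_eq_rpow]
  have := Real.mul_self_sqrt hτ.le
  linear_combination 2 * B * this

/-- The transform of the characteristic function has mean oscillation `O(ω(ρ))`. Over a disc near
the boundary, the pointwise bound below the graph is integrated along vertical lines. -/
theorem exists_oscillation_beurling_indicator_one {ω : ℝ → ℝ} (hω : IsRegularModulus ω)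
    {Ω : Set ℂ} (hΩ : IsOpen Ω) (hΩb : Bornology.IsBounded Ω) (hsmooth : HasC1OmegaBoundary ω Ω) :
    ∃ C ρ₁ : ℝ, 0 ≤ C ∧ 0 < ρ₁ ∧ ∀ z ∈ Ω, ∀ ρ, 0 < ρ → ρ ≤ ρ₁ → ∃ c : ℂ,
      ∫⁻ x in Metric.closedBall z ρ ∩ Ω, ‖beurling (Ω.indicator fun _ => (1 : ℂ)) x - c‖ₑ ≤
        ENNReal.ofReal (C * ω ρ * ρ ^ 2) := by
  obtain ⟨R, M, hR, hM, hchart⟩ := exists_uniformChart hω hΩ hΩb hsmooth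
  have hM' : (0 : ℝ) < 1 + M := by linarith
  obtain ⟨C₁, ρ₁, hC₁, hρ₁, h₁⟩ := exists_interior_beurling_sub_le hω hΩ hΩb hsmooth
  obtain ⟨C₂, τ₁, hC₂, hτ₁, h₂⟩ := exists_beurling_below_graph_le hω hΩ hΩb hR hM hchart
  obtain ⟨C₃, hC₃, h₃⟩ := hω.exists_dilation_const (lam := 5 * (1 + M)) (by positivity)
  set F := beurling (Ω.indicator fun _ => (1 : ℂ)) with hF
  refine ⟨4 * C₁ + 100 * (1 + M) * C₂ * C₃,
    min ρ₁ (min (τ₁ / (5 * (1 + M))) (R / (10 * (1 + M)))), by positivity,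
    lt_min hρ₁ (lt_min (by positivity) (by positivity)), fun z hz ρ hρ hρρ => ?_⟩
  have hωρ := hω.pos ρ hρ
  rcases le_or_gt (4 * ρ) (Metric.infDist z Ωᶜ) with hd | hd
  · refine ⟨F z, ?_⟩
    have hm : MeasurableSet (Metric.closedBall z ρ ∩ Ω) :=
      measurableSet_closedBall.inter hΩ.measurableSet
    calc _ ≤ ∫⁻ x in Metric.closedBall z ρ ∩ Ω, ENNReal.ofReal (C₁ * ω ρ) := by
          refine setLIntegral_mono' hm fun x hx => ?_
          rw [← ofReal_norm]
          exact ENNReal.ofReal_le_ofReal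
            (h₁ z hz ρ hρ (hρρ.trans (min_le_left _ _)) hd x hx.1)
      _ = ENNReal.ofReal (C₁ * ω ρ) * volume (Metric.closedBall z ρ ∩ Ω) := setLIntegral_const _ _
      _ ≤ ENNReal.ofReal (C₁ * ω ρ) * ENNReal.ofReal (4 * ρ ^ 2) := by
          gcongr
          exact (measure_mono inter_subset_left).trans (volume_closedBall_le z hρ.le)
      _ ≤ _ := by
          rw [← ENNReal.ofReal_mul (by positivity)]
          apply ENNReal.ofReal_le_ofReal
          have : 0 ≤ 100 * (1 + M) * C₂ * C₃ * ω ρ * ρ ^ 2 := by positivity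
          linarith
  · obtain ⟨ζ, hζ, hdist⟩ := exists_mem_frontier_infDist_compl_eq_dist hz
      (ne_univ_of_isBounded hΩb)
    rw [dist_eq_norm] at hdist
    obtain ⟨c, φ, m, hU⟩ := hchart ζ hζ
    set τ := 5 * (1 + M) * ρ with hτdef
    have hτ : 0 < τ := by positivity
    have hωτ := hω.pos τ hτ
    have hττ : τ ≤ τ₁ := by
      have := hρρ.trans ((min_le_right _ _).trans (min_le_left _ _))
      rw [le_div_iff₀ (by positivity)] at this
      linarith
    have hτR : 2 * τ ≤ R := by
      have := hρρ.trans ((min_le_right _ _).trans (min_le_right _ _))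
      rw [le_div_iff₀ (by positivity)] at this
      linarith
    have hρτ : 5 * ρ ≤ τ := by rw [hτdef]; nlinarith
    set c₀ := F (chartPt ζ c 0 (φ 0 - τ)) with hc₀
    refine ⟨c₀, ?_⟩
    set S := Metric.closedBall z ρ ∩ Ω with hS
    have hSm : MeasurableSet S := measurableSet_closedBall.inter hΩ.measurableSet
    set H : ℝ → ℝ≥0∞ := (Ioc 0 τ).indicator fun s => ENNReal.ofReal (C₂ * ω τ * √(τ / s)) with hH
    have hpt : ∀ x y : ℝ, S.indicator (fun u => ‖F u - c₀‖ₑ) (chartPt ζ c x y) ≤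
        (Icc (-(5 * ρ)) (5 * ρ)).indicator (fun x => H (φ x - y)) x := by
      intro x y
      by_cases hu : chartPt ζ c x y ∈ S
      swap
      · rw [indicator_of_notMem hu]
        exact zero_le
      rw [indicator_of_mem hu]
      obtain ⟨hu1, hu2⟩ := hu
      rw [Metric.mem_closedBall, dist_eq_norm] at hu1
      have h4 := norm_add_le (chartPt ζ c x y - z) (z - ζ)
      rw [sub_add_sub_cancel] at h4
      have h5 : ‖chartPt ζ c x y - ζ‖ ≤ 5 * ρ := by linarith
      obtain ⟨hx, hy⟩ := abs_sub_le_norm_chartPt_sub (ζ := ζ) hU.norm_eq x y 0 0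
      have hζ0 : chartPt ζ c 0 0 = ζ := by simp [chartPt]
      rw [hζ0, sub_zero] at hx hy
      have hx5 := hx.trans h5
      have hy5 := hy.trans h5
      have hxR : x ∈ Ioo (-R) R := abs_lt.1 (by linarith)
      have hyR : y ∈ Ioo (-R) R := abs_lt.1 (by linarith)
      have hyφ := (hU.mem_iff x hxR y hyR).1 hu2
      have hφx := (abs_le.1 (hU.abs_graph_le hR hxR)).2
      have hMx : M * |x| ≤ M * (5 * ρ) := by gcongr
      have hs : φ x - y ∈ Ioc 0 τ := by
        refine ⟨by linarith, ?_⟩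
        have := (abs_le.1 hy5).1
        rw [hτdef]
        linarith
      rw [indicator_of_mem (show x ∈ Icc (-(5 * ρ)) (5 * ρ) from abs_le.1 hx5), hH,
        indicator_of_mem hs, ← ofReal_norm]
      apply ENNReal.ofReal_le_ofReal
      have h6 := h₂ ζ c φ m hU τ hττ x (φ x - y) (by linarith) hs.1 hs.2
      rwa [sub_sub_cancel] at h6
    have hHint : ∫⁻ s, H s = ENNReal.ofReal (C₂ * ω τ * (2 * τ)) := by
      rw [hH, lintegral_indicator measurableSet_Ioc, lintegral_sqrt_div hτ (by positivity)]
    calc ∫⁻ u in S, ‖F u - c₀‖ₑ = ∫⁻ u, S.indicator (fun u => ‖F u - c₀‖ₑ) u :=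
          (lintegral_indicator hSm _).symm
      _ ≤ ∫⁻ x : ℝ, ∫⁻ y : ℝ, S.indicator (fun u => ‖F u - c₀‖ₑ) (chartPt ζ c x y) :=
          lintegral_le_lintegral_chartPt ζ hU.norm_eq _
      _ ≤ ∫⁻ x : ℝ, (Icc (-(5 * ρ)) (5 * ρ)).indicator
            (fun _ => ENNReal.ofReal (C₂ * ω τ * (2 * τ))) x := by
          refine lintegral_mono fun x => (lintegral_mono (hpt x)).trans ?_
          by_cases hx : x ∈ Icc (-(5 * ρ)) (5 * ρ)
          · simp only [indicator_of_mem hx]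
            rw [lintegral_sub_left_eq_self H, hHint]
          · simp [indicator_of_notMem hx]
      _ = ENNReal.ofReal (C₂ * ω τ * (2 * τ)) * ENNReal.ofReal (5 * ρ - -(5 * ρ)) := by
          rw [lintegral_indicator measurableSet_Icc, setLIntegral_const, Real.volume_Icc]
      _ ≤ _ := by
          rw [← ENNReal.ofReal_mul (by positivity)]
          apply ENNReal.ofReal_le_ofReal
          have h7 := h₃ ρ hρ
          rw [← hτdef] at h7
          calc C₂ * ω τ * (2 * τ) * (5 * ρ - -(5 * ρ)) = 20 * C₂ * τ * ρ * ω τ := by ring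
            _ ≤ 20 * C₂ * τ * ρ * (C₃ * ω ρ) := by gcongr
            _ = 100 * (1 + M) * C₂ * C₃ * ω ρ * ρ ^ 2 := by rw [hτdef]; ring
            _ ≤ _ := by
              have : 0 ≤ 4 * C₁ * ω ρ * ρ ^ 2 := by positivity
              linarith

/-! ### The restricted Beurling transform on the Campanato space -/

theorem exists_forall_subset_closedBall {Ω : Set ℂ} (hΩb : Bornology.IsBounded Ω) :
    ∃ D : ℝ, 0 < D ∧ ∀ z ∈ Ω, Ω ⊆ Metric.closedBall z (D / 2) := by
  obtain ⟨C, hC⟩ := Metric.isBounded_iff.1 hΩb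
  refine ⟨2 * max C 1, by positivity, fun z hz w hw => ?_⟩
  rw [mul_div_cancel_left₀ _ two_ne_zero]
  exact (hC hw hz).trans (le_max_left _ _)

theorem tendsto_restrictedBeurling {ω : ℝ → ℝ} (hω : IsRegularModulus ω) {Ω : Set ℂ}
    (hΩ : IsOpen Ω) (hΩb : Bornology.IsBounded Ω) {f : ℂ → ℂ} (hf : MemCampanato ω Ω f) {z : ℂ}
    (hz : z ∈ Ω) :
    Tendsto (fun δ : ℝ => truncatedBeurling (Ω.indicator f) δ z) (𝓝[>] (0 : ℝ))
      (𝓝 (restrictedBeurling Ω f z)) := by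
  obtain ⟨K, -, hK⟩ := exists_oscData hω
  obtain ⟨g, hg, hgf⟩ := hK Ω hΩ.measurableSet f hf
  have h := hg.tendsto_beurling hω hΩ hΩb hz
  simp only [restrictedBeurling, beurling, truncatedBeurling_congr hgf.symm] at h ⊢
  exact h

theorem MemCampanato.integrable_indicator {ω : ℝ → ℝ} (hω : IsRegularModulus ω) {Ω : Set ℂ}
    (hΩ : IsOpen Ω) (hΩb : Bornology.IsBounded Ω) {f : ℂ → ℂ} (hf : MemCampanato ω Ω f) :
    Integrable (Ω.indicator f) := by
  obtain ⟨K, -, hK⟩ := exists_oscData hω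
  obtain ⟨g, hg, hgf⟩ := hK Ω hΩ.measurableSet f hf
  exact (hg.integrable hΩb).congr hgf

theorem restrictedBeurling_linear {ω : ℝ → ℝ} (hω : IsRegularModulus ω) {Ω : Set ℂ}
    (hΩ : IsOpen Ω) (hΩb : Bornology.IsBounded Ω) {f g : ℂ → ℂ} (hf : MemCampanato ω Ω f)
    (hg : MemCampanato ω Ω g) (a b : ℂ) {z : ℂ} (hz : z ∈ Ω) :
    restrictedBeurling Ω (fun x => a * f x + b * g x) z =
      a * restrictedBeurling Ω f z + b * restrictedBeurling Ω g z := by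
  have h := ((tendsto_restrictedBeurling hω hΩ hΩb hf hz).const_mul a).add
    ((tendsto_restrictedBeurling hω hΩ hΩb hg hz).const_mul b)
  refine Tendsto.limUnder_eq (h.congr' ?_)
  filter_upwards [self_mem_nhdsWithin] with δ hδ
  rw [← truncatedBeurling_linear (hf.integrable_indicator hω hΩ hΩb)
    (hg.integrable_indicator hω hΩ hΩb) a b hδ z]
  congr 1
  funext x
  by_cases hx : x ∈ Ω <;> simp [hx]

end BeurlingCampanato

theorem mainTheorem1 (ω : ℝ → ℝ) (hω : BeurlingCampanato.IsRegularModulus ω)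
    (Ω : Set ℂ) (hΩ_open : IsOpen Ω) (hΩ_conn : IsConnected Ω)
    (hΩ_bdd : Bornology.IsBounded Ω)
    (hΩ_smooth : BeurlingCampanato.HasC1OmegaBoundary ω Ω) :
    -- the principal value exists at every point of the domain
    (∀ f : ℂ → ℂ, BeurlingCampanato.MemCampanato ω Ω f → ∀ z ∈ Ω,
      Tendsto (fun δ : ℝ => BeurlingCampanato.truncatedBeurling (Ω.indicator f) δ z)
        (𝓝[>] (0 : ℝ)) (𝓝 (BeurlingCampanato.restrictedBeurling Ω f z))) ∧
    -- the restricted transform is linear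
    (∀ f g : ℂ → ℂ, BeurlingCampanato.MemCampanato ω Ω f →
      BeurlingCampanato.MemCampanato ω Ω g → ∀ a b : ℂ,
      EqOn (BeurlingCampanato.restrictedBeurling Ω (fun z => a * f z + b * g z))
        (fun z => a * BeurlingCampanato.restrictedBeurling Ω f z +
          b * BeurlingCampanato.restrictedBeurling Ω g z) Ω) ∧
    -- it maps the Campanato space into itself, with a norm bound
    (∃ C : ℝ≥0, ∀ f : ℂ → ℂ, BeurlingCampanato.MemCampanato ω Ω f →
      BeurlingCampanato.MemCampanato ω Ω (BeurlingCampanato.restrictedBeurling Ω f) ∧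
      BeurlingCampanato.campanatoNorm ω Ω (BeurlingCampanato.restrictedBeurling Ω f) ≤
        (C : ℝ≥0∞) * BeurlingCampanato.campanatoNorm ω Ω f) := by
  refine ⟨fun f hf z hz =>
    BeurlingCampanato.tendsto_restrictedBeurling hω hΩ_open hΩ_bdd hf hz,
    fun f g hf hg a b z hz =>
      BeurlingCampanato.restrictedBeurling_linear hω hΩ_open hΩ_bdd hf hg a b hz, ?_⟩
  obtain ⟨D, hD, hdiam⟩ := BeurlingCampanato.exists_forall_subset_closedBall hΩ_bdd
  obtain ⟨κ, hκ, hdens⟩ :=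
    BeurlingCampanato.exists_hasDensity hω hΩ_open hΩ_bdd hΩ_smooth hD
  obtain ⟨CF, ρ₁, hCF, hρ₁, hF⟩ :=
    BeurlingCampanato.exists_oscillation_beurling_indicator_one hω hΩ_open hΩ_bdd hΩ_smooth
  exact BeurlingCampanato.beurling_bounded_of_oscillation hω hΩ_open hΩ_bdd hκ hD hdens hdiam hCF
    hρ₁ hF
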